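/- Let $(M,\Omega)$ be a compact connected symplectic manifold (smooth, Hausdorff, without boundary, of any finite dimension), and let $S^1=\mathbb{R}/2\pi\mathbb{Z}$ act smoothly on $M$ by symplectomorphisms. Let $X$ be the vector field generating the action, $X(x)=\frac{d}{dt}\big|_{t=0}e^{it}\cdot x$. Assume that the action is not Hamiltonian, i.e. there is no $S^1$-invariant smooth function $H:M\to\mathbb{R}$ with $\iota_X\Omega=-dH$. Let $$P=\Big\{\int_A\iota_X\Omega \;:\; A\in H_1(M;\mathbb{Z})\Big\}\subset\mathbb{R}$$ be the group of periods of the closed one-form $\iota_X\Omega$, and assume that $P$ is a discrete subgroup of $\mathbb{R}$. Let $\Phi:M\to\mathbb{R}/P$ be a circle-valued Hamiltonian for the action, i.e. a smooth map with $\iota_X\Omega=-d\Phi$ (where $d\Phi$ is the differential of any local smooth real-valued lift of $\Phi$). Then for every $y\in\mathbb{R}/P$ the level set $\Phi^{-1}(y)$ is connected (and non-empty). -/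

import Mathlib

open Set
open scoped Manifold ContDiff

namespace CircleAction

/-! All manifolds below are modelled on a real normed space `E` (finite-dimensional in the theorem)
through the trivial model with corners `𝓘(ℝ, E)`, so they have no boundary. -/

section Forms

variable {E : Type*} [NormedAddCommGroup E] [NormedSpace ℝ E]
  {M : Type*} [TopologicalSpace M] [ChartedSpace E M]

variable (E M) in
/-- A (not necessarily continuous) differential `k`-form on `M`: an alternating `k`-linear form on
each tangent space. -/
abbrev DiffForm (k : ℕ) : Type _ :=
  ∀ x : M, TangentSpace 𝓘(ℝ, E) x [⋀^Fin k]→L[ℝ] ℝ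

/-- The form `η` in the preferred chart at `x₀`: the pullback of `η` under the inverse of the
chart, meaningful on the (open) target of the chart. -/
noncomputable def DiffForm.inChart {k : ℕ} (η : DiffForm E M k) (x₀ : M) :
    E → E [⋀^Fin k]→L[ℝ] ℝ := fun y =>
  (η ((extChartAt 𝓘(ℝ, E) x₀).symm y)).compContinuousLinearMap
    (mfderiv 𝓘(ℝ, E) 𝓘(ℝ, E) (extChartAt 𝓘(ℝ, E) x₀).symm y)

/-- `η` is smooth: its coefficients in the charts are smooth. -/
def DiffForm.IsSmooth {k : ℕ} (η : DiffForm E M k) : Prop :=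
  ∀ x₀ : M, ContDiffOn ℝ ∞ (η.inChart x₀) (extChartAt 𝓘(ℝ, E) x₀).target

/-- `dη = 0`: the exterior derivative vanishes in the charts. -/
def DiffForm.IsClosed {k : ℕ} (η : DiffForm E M k) : Prop :=
  ∀ x₀ : M, ∀ y ∈ (extChartAt 𝓘(ℝ, E) x₀).target, extDeriv (η.inChart x₀) y = 0

/-- The pullback `φ^* η` of a form under a map `φ : M → M`. -/
noncomputable def DiffForm.pullback {k : ℕ} (η : DiffForm E M k) (φ : M → M) : DiffForm E M k :=
  fun x => (η (φ x)).compContinuousLinearMap (mfderiv 𝓘(ℝ, E) 𝓘(ℝ, E) φ x)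

/-- The contraction `ι_X η` of a form with a vector field: `(ι_X η)(v₁, …, v_k) =
η(X, v₁, …, v_k)`. -/
noncomputable def DiffForm.contract {k : ℕ} (X : ∀ x : M, TangentSpace 𝓘(ℝ, E) x)
    (η : DiffForm E M (k + 1)) : DiffForm E M k :=
  fun x => ContinuousAlternatingMap.curryLeft (E := E) (η x) (X x)

/-- A symplectic form: a smooth, closed, nondegenerate 2-form. -/
structure IsSymplecticForm (Ω : DiffForm E M 2) : Prop where
  smooth : Ω.IsSmooth
  closed : Ω.IsClosed
  nondegenerate : ∀ (x : M) (v : TangentSpace 𝓘(ℝ, E) x),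
    (∀ w : TangentSpace 𝓘(ℝ, E) x, Ω x ![v, w] = 0) → v = 0

end Forms

section Periods

variable {E : Type*} [NormedAddCommGroup E] [NormedSpace ℝ E]
  {M : Type*} [TopologicalSpace M] [ChartedSpace E M]

variable (E M) in
/-- A smooth singular 1-simplex in `M`: a map that is smooth on `[0, 1]`. (Values of `toFun` outside
`[0, 1]` play no role.) -/
structure SmoothSimplex where
  toFun : ℝ → M
  smooth : ContMDiffOn 𝓘(ℝ, ℝ) 𝓘(ℝ, E) ∞ toFun (Icc 0 1)

/-- The integral `∫_σ η` of a 1-form over a smooth singular 1-simplex. -/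
noncomputable def SmoothSimplex.integral (η : DiffForm E M 1) (σ : SmoothSimplex E M) : ℝ :=
  ∫ t in (0 : ℝ)..1, η (σ.toFun t)
    ![mfderivWithin 𝓘(ℝ, ℝ) 𝓘(ℝ, E) σ.toFun (Icc 0 1) t (1 : ℝ)]

variable (E M) in
/-- The boundary map `∂σ = σ(1) - σ(0)` from smooth singular 1-chains with integer coefficients to
0-chains. Its kernel consists of the smooth singular 1-cycles, which represent exactly the classes
of `H₁(M; ℤ)`. -/
noncomputable def boundary : (SmoothSimplex E M →₀ ℤ) →+ (M →₀ ℤ) :=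
  Finsupp.liftAddHom fun σ =>
    Finsupp.singleAddHom (σ.toFun 1) - Finsupp.singleAddHom (σ.toFun 0)

/-- Integration of a 1-form over smooth singular 1-chains, `∑ nᵢ σᵢ ↦ ∑ nᵢ ∫_{σᵢ} η`. -/
noncomputable def chainIntegral (η : DiffForm E M 1) : (SmoothSimplex E M →₀ ℤ) →+ ℝ :=
  Finsupp.liftAddHom fun σ => (AddMonoidHom.mulRight (σ.integral η)).comp (Int.castAddHom ℝ)

/-- The group of periods of a closed 1-form `η`: the integrals of `η` over the 1-dimensional
integral homology classes of `M`, each computed on a smooth cycle in the class. -/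
noncomputable def periodGroup (η : DiffForm E M 1) : AddSubgroup ℝ :=
  (boundary E M).ker.map (chainIntegral η)

end Periods

section Actions

variable {E : Type*} [NormedAddCommGroup E] [NormedSpace ℝ E]
  {M : Type*} [TopologicalSpace M] [ChartedSpace E M] [MulAction Circle M]

variable (E M) in
/-- The vector field generating a circle action, with `S¹ = ℝ / 2πℤ`:
`X(x) = d/dt|_{t = 0} exp(i t) • x`. -/
noncomputable def generator (x : M) : TangentSpace 𝓘(ℝ, E) x :=
  mfderiv 𝓘(ℝ, ℝ) 𝓘(ℝ, E) (fun t : ℝ => Circle.exp t • x) 0 (1 : ℝ)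

/-- The circle acts by symplectomorphisms. -/
def IsSymplecticAction (Ω : DiffForm E M 2) : Prop :=
  ∀ g : Circle, Ω.pullback (fun x : M => g • x) = Ω

/-- The circle action is Hamiltonian: there is an invariant smooth function `H : M → ℝ`
with `ι_X Ω = -dH`. -/
def IsHamiltonianAction (Ω : DiffForm E M 2) : Prop :=
  ∃ H : M → ℝ, ContMDiff 𝓘(ℝ, E) 𝓘(ℝ, ℝ) ∞ H ∧ (∀ (g : Circle) (x : M), H (g • x) = H x) ∧
    ∀ (x : M) (v : TangentSpace 𝓘(ℝ, E) x),
      Ω.contract (generator E M) x ![v] = -(mfderiv 𝓘(ℝ, E) 𝓘(ℝ, ℝ) H x v : ℝ)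

variable (E) in
/-- `f` is a smooth lift, on the open set `U`, of the map `Φ : M → ℝ / Γ`. -/
structure IsSmoothLift {Γ : AddSubgroup ℝ} (Φ : M → ℝ ⧸ Γ) (U : Set M) (f : M → ℝ) : Prop where
  isOpen : IsOpen U
  smooth : ContMDiffOn 𝓘(ℝ, E) 𝓘(ℝ, ℝ) ∞ f U
  lifts : ∀ x ∈ U, (QuotientAddGroup.mk (f x) : ℝ ⧸ Γ) = Φ x

/-- For a discrete group `Γ ⊂ ℝ`, the map `Φ : M → ℝ / Γ` is a circle-valued Hamiltonian of the
action: it is smooth and satisfies `ι_X Ω = -dΦ`. The smooth structure of `ℝ / Γ` is the one for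
which the covering `ℝ → ℝ / Γ` is a local diffeomorphism; so `Φ` is smooth if it has smooth local
real-valued lifts, and `dΦ` is the differential of any of these. -/
structure IsCircleValuedHamiltonian (Ω : DiffForm E M 2) {Γ : AddSubgroup ℝ} (Φ : M → ℝ ⧸ Γ) :
    Prop where
  smooth : ∀ x : M, ∃ U f, x ∈ U ∧ IsSmoothLift E Φ U f
  differential : ∀ U f, IsSmoothLift E Φ U f → ∀ x ∈ U, ∀ v : TangentSpace 𝓘(ℝ, E) x,
    Ω.contract (generator E M) x ![v] = -(mfderiv 𝓘(ℝ, E) 𝓘(ℝ, ℝ) f x v : ℝ)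

end Actions

end CircleAction

/-!
Let `LevelCover Φ` be the pullback of the covering `ℝ → ℝ / P` along `Φ`. On it the Hamiltonian
becomes a real-valued function `level`, and every fibre of `Φ` is the image of a fibre of `level`.
Two facts about this covering use the hypotheses on `P`. It is connected: lifting the simplices of
a cycle shows that the deck transformation by each period preserves every component
(`IsPrimitive.periodGroup_le_componentStabilizer`), and `P` consists of periods. Moreover `level`
is proper, by compactness of `M` and discreteness of `P`, and it is onto, because `P` is
nontrivial: a Hamiltonian without periods would be an honest one
(`IsCircleValuedHamiltonian.isHamiltonianAction`).

The connectedness of the fibres of `level` comes from a local property, `TameAt`: near each point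
the fibres are connected, uniformly in the level, and the local extrema on the level of that point
are all or nothing. For a proper tame function a decomposition of one fibre into two disjoint
closed sets extends to nearby fibres, hence to the whole space, which is impossible in a connected
space unless one part is empty (`isPreconnected_fibre`). This replaces gradient flows and the
passage of level sets through critical values.

The function `level` is tame at regular points, where it is a coordinate. A critical point is a
fixed point of the circle (`smul_eq_of_flowField_eq_zero`). There the Hessian `Q` is invariant
under the linearized action `B t`, and the mean of `B t u` over the circle lies in the kernel of
`Q`. Hence if `u` is a positive vector, the function `t ↦ Q u (B t u)` is positive at `0` and has
mean zero, so it vanishes somewhere, and `u` and `B t u` span a positive plane; the index and the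
coindex are therefore different from one (`not_existsUnique_form_pos`). By averaging again the
critical points form a manifold tangent to the kernel of `Q` (`IsPeriodicFlowAt.tameAt`). Near
such a Morse–Bott point the function increases along the hyperbolas `ρ ↦ (z, ρ p, ρ⁻¹ q)` normal
to the critical manifold, which describes its fibres by the parameters of the hyperbolas crossing
them; these form a connected set as the unit spheres of the positive and negative directions are
connected (`tameAt_of_morseBott`, `IsSaddle.tameAt`). No normal form (Morse lemma or equivariant
Darboux theorem) is needed.
-/

open Filter Topology

namespace CircleAction

/-! ### Tame functions and the connectedness of their fibres -/

section Tame

variable {X Y : Type*} [TopologicalSpace X] [TopologicalSpace Y]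

/-- `f` is *tame* at `x` if its fibres are locally connected near `x`, uniformly in the level, and
if near `x` either all points of the level of `x` are local maxima or none is (in the first case
the clause only records `x` itself), and likewise for minima. -/
structure TameAt (f : X → ℝ) (x : X) : Prop where
  fibre : ∀ W ∈ 𝓝 x, ∃ N ∈ 𝓝 x, N ⊆ W ∧ ∀ s, IsPreconnected (N ∩ f ⁻¹' {s})
  max : IsLocalMax f x ∨ ∀ᶠ y in 𝓝 x, f y = f x → ¬ IsLocalMax f y
  min : IsLocalMin f x ∨ ∀ᶠ y in 𝓝 x, f y = f x → ¬ IsLocalMin f y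

theorem TameAt.neg {f : X → ℝ} {x : X} (h : TameAt f x) : TameAt (fun y => -f y) x where
  fibre W hW := by
    obtain ⟨N, hN, hNW, hs⟩ := h.fibre W hW
    refine ⟨N, hN, hNW, fun s => ?_⟩
    convert hs (-s) using 2
    ext y
    simp [neg_eq_iff_eq_neg]
  max := by
    refine h.min.imp (fun h => h.neg) fun h => h.mono fun y hy hxy hmax => hy (by linarith) ?_
    simpa using hmax.neg
  min := by
    refine h.max.imp (fun h => h.neg) fun h => h.mono fun y hy hxy hmax => hy (by linarith) ?_
    simpa using hmax.neg

theorem isLocalMax_comp_openPartialHomeomorph (e : OpenPartialHomeomorph X Y) {g : Y → ℝ} {x : X}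
    (hx : x ∈ e.source) : IsLocalMax g (e x) ↔ IsLocalMax (g ∘ e) x := by
  unfold IsLocalMax IsMaxFilter
  rw [← e.map_nhds_eq hx]
  simp

theorem isLocalMin_comp_openPartialHomeomorph (e : OpenPartialHomeomorph X Y) {g : Y → ℝ} {x : X}
    (hx : x ∈ e.source) : IsLocalMin g (e x) ↔ IsLocalMin (g ∘ e) x := by
  unfold IsLocalMin IsMinFilter
  rw [← e.map_nhds_eq hx]
  simp

theorem TameAt.congr {f g : X → ℝ} {x : X} (h : TameAt f x) (hfg : f =ᶠ[𝓝 x] g) : TameAt g x where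
  fibre W hW := by
    obtain ⟨N, hN, hNW, hs⟩ := h.fibre (W ∩ {y | f y = g y}) (inter_mem hW hfg)
    refine ⟨N, hN, hNW.trans inter_subset_left, fun s => ?_⟩
    convert hs s using 1
    ext y
    simp only [mem_inter_iff, mem_preimage, mem_singleton_iff, and_congr_right_iff]
    intro hy
    have : f y = g y := (hNW hy).2
    rw [this]
  max := by
    refine h.max.imp (fun h => ?_) fun h => ?_
    · exact h.congr hfg
    · filter_upwards [h, hfg, hfg.eventually_nhds] with y hy hfgy hfg' hyx hmax
      refine hy (by rw [hfgy, hfg.eq_of_nhds, hyx]) (hmax.congr ?_)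
      filter_upwards [hfg'] with z hz using hz.symm
  min := by
    refine h.min.imp (fun h => ?_) fun h => ?_
    · exact h.congr hfg
    · filter_upwards [h, hfg, hfg.eventually_nhds] with y hy hfgy hfg' hyx hmax
      refine hy (by rw [hfgy, hfg.eq_of_nhds, hyx]) (hmax.congr ?_)
      filter_upwards [hfg'] with z hz using hz.symm

theorem TameAt.of_comp (e : OpenPartialHomeomorph X Y) {g : Y → ℝ} {x : X} (hx : x ∈ e.source)
    (h : TameAt (g ∘ e) x) : TameAt g (e x) where
  fibre W hW := by
    obtain ⟨N, hN, hNW, hs⟩ := h.fibre (e ⁻¹' W ∩ e.source)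
      (inter_mem (e.continuousAt hx hW) (e.open_source.mem_nhds hx))
    refine ⟨e '' N, e.image_mem_nhds hx hN, ?_, fun s => ?_⟩
    · rintro _ ⟨y, hy, rfl⟩
      exact (hNW hy).1
    · have : e '' N ∩ g ⁻¹' {s} = e '' (N ∩ (g ∘ e) ⁻¹' {s}) := by
        ext y
        constructor
        · rintro ⟨⟨z, hz, rfl⟩, hy⟩
          exact ⟨z, ⟨hz, hy⟩, rfl⟩
        · rintro ⟨z, ⟨hz, hy⟩, rfl⟩
          exact ⟨⟨z, hz, rfl⟩, hy⟩
      rw [this]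
      exact (hs s).image _ (e.continuousOn.mono fun y hy => (hNW hy.1).2)
  max := by
    rw [isLocalMax_comp_openPartialHomeomorph e hx]
    refine h.max.imp id fun h => ?_
    rw [← e.map_nhds_eq hx, eventually_map]
    filter_upwards [h, e.open_source.mem_nhds hx] with y hy hys hyx
    rw [isLocalMax_comp_openPartialHomeomorph e hys]
    exact hy hyx
  min := by
    rw [isLocalMin_comp_openPartialHomeomorph e hx]
    refine h.min.imp id fun h => ?_
    rw [← e.map_nhds_eq hx, eventually_map]
    filter_upwards [h, e.open_source.mem_nhds hx] with y hy hys hyx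
    rw [isLocalMin_comp_openPartialHomeomorph e hys]
    exact hy hyx

theorem TameAt.add_const {f : X → ℝ} {x : X} (h : TameAt f x) (c : ℝ) :
    TameAt (fun y => f y + c) x where
  fibre W hW := by
    obtain ⟨N, hN, hNW, hs⟩ := h.fibre W hW
    refine ⟨N, hN, hNW, fun s => ?_⟩
    convert hs (s - c) using 2
    ext y
    simp [eq_sub_iff_add_eq]
  max := by simpa [IsLocalMax, IsMaxFilter] using h.max
  min := by simpa [IsLocalMin, IsMinFilter] using h.min

end Tame

section Global

variable {X : Type*} [TopologicalSpace X]

/-- `A` and `B` separate the part of `X` over `S ⊆ ℝ`: they are disjoint closed sets with union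
`f⁻¹(S)`. -/
structure Separates (f : X → ℝ) (S : Set ℝ) (A B : Set X) : Prop where
  left : IsClosed A
  right : IsClosed B
  disjoint : Disjoint A B
  union : A ∪ B = f ⁻¹' S

/-- Every separation over `S` extends to a separation over `T`. -/
def SeparationsExtend (f : X → ℝ) (S T : Set ℝ) : Prop :=
  ∀ A B, Separates f S A B → ∃ A' B', Separates f T A' B' ∧ A ⊆ A' ∧ B ⊆ B'

theorem Separates.restrict {f : X → ℝ} (hf : Continuous f) {S T : Set ℝ} {A B : Set X}
    (h : Separates f T A B) (hS : IsClosed S) (hST : S ⊆ T) :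
    Separates f S (A ∩ f ⁻¹' S) (B ∩ f ⁻¹' S) where
  left := h.left.inter (hS.preimage hf)
  right := h.right.inter (hS.preimage hf)
  disjoint := h.disjoint.mono inter_subset_left inter_subset_left
  union := by
    rw [← union_inter_distrib_right, h.union]
    exact inter_eq_right.2 (preimage_mono hST)

theorem SeparationsExtend.mono {f : X → ℝ} (hf : Continuous f) {S T T' : Set ℝ}
    (h : SeparationsExtend f S T) (hT' : IsClosed T') (hST : S ⊆ T') (hTT : T' ⊆ T) :
    SeparationsExtend f S T' := by
  intro A B hAB
  obtain ⟨A', B', h', hA, hB⟩ := h A B hAB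
  refine ⟨_, _, h'.restrict hf hT' hTT, subset_inter hA ?_, subset_inter hB ?_⟩
  · exact subset_union_left.trans (hAB.union.subset.trans (preimage_mono hST))
  · exact subset_union_right.trans (hAB.union.subset.trans (preimage_mono hST))

/-- Two separations that agree where they overlap can be glued. -/
theorem Separates.glue {f : X → ℝ} {S T : Set ℝ} {b : ℝ} (hST : S ∩ T ⊆ {b})
    {A B A' B' : Set X} (h : Separates f S A B) (h' : Separates f T A' B')
    (hA : A ∩ f ⁻¹' {b} ⊆ A') (hB : B ∩ f ⁻¹' {b} ⊆ B') :
    Separates f (S ∪ T) (A ∪ A') (B ∪ B') where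
  left := h.left.union h'.left
  right := h.right.union h'.right
  disjoint := by
    have key : ∀ x, (x ∈ A ∨ x ∈ B) → (x ∈ A' ∨ x ∈ B') → f x = b := fun x h1 h2 =>
      hST ⟨h.union.subset h1, h'.union.subset h2⟩
    rw [Set.disjoint_left]
    rintro x (hx | hx) (hy | hy)
    · exact Set.disjoint_left.1 h.disjoint hx hy
    · exact Set.disjoint_left.1 h'.disjoint (hA ⟨hx, key x (.inl hx) (.inr hy)⟩) hy
    · exact Set.disjoint_left.1 h'.disjoint hx (hB ⟨hy, key x (.inr hy) (.inl hx)⟩)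
    · exact Set.disjoint_left.1 h'.disjoint hx hy
  union := by
    rw [preimage_union, ← h.union, ← h'.union]
    ext x
    simp only [mem_union]
    tauto

theorem SeparationsExtend.trans {f : X → ℝ} (hf : Continuous f) {a b c : ℝ} (hab : a ≤ b)
    (hbc : b ≤ c) (h : SeparationsExtend f {a} (Icc a b)) (h' : SeparationsExtend f {b} (Icc b c)) :
    SeparationsExtend f {a} (Icc a c) := by
  intro A B hAB
  obtain ⟨A₁, B₁, h₁, hA₁, hB₁⟩ := h A B hAB
  obtain ⟨A₂, B₂, h₂, hA₂, hB₂⟩ := h' _ _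
    (h₁.restrict hf isClosed_singleton (singleton_subset_iff.2 (right_mem_Icc.2 hab)))
  refine ⟨A₁ ∪ A₂, B₁ ∪ B₂, ?_, hA₁.trans subset_union_left, hB₁.trans subset_union_left⟩
  rw [← Icc_union_Icc_eq_Icc hab hbc]
  refine h₁.glue ?_ h₂ hA₂ hB₂
  rintro x ⟨hx, hy⟩
  exact le_antisymm hx.2 hy.1

/-- A neighbourhood of a fibre contains a tube around it. -/
theorem exists_tube {f : X → ℝ} (hf : Continuous f)
    (hK : ∀ a b : ℝ, IsCompact (f ⁻¹' Icc a b)) {t : ℝ} {O : Set X} (hO : IsOpen O)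
    (ht : f ⁻¹' {t} ⊆ O) : ∃ δ > 0, f ⁻¹' Icc (t - δ) (t + δ) ⊆ O := by
  have hc : IsCompact (f '' (f ⁻¹' Icc (t - 1) (t + 1) \ O)) := ((hK _ _).diff hO).image hf
  have hm : (f '' (f ⁻¹' Icc (t - 1) (t + 1) \ O))ᶜ ∈ 𝓝 t := by
    refine hc.isClosed.isOpen_compl.mem_nhds ?_
    rintro ⟨x, hx, hxt⟩
    exact hx.2 (ht hxt)
  obtain ⟨ε, hε, hb⟩ := Metric.nhds_basis_closedBall.mem_iff.1 hm
  refine ⟨min ε 1, lt_min hε one_pos, fun x hx => ?_⟩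
  by_contra hxO
  rw [mem_preimage, mem_Icc] at hx
  have h1 := min_le_left ε 1
  have h2 := min_le_right ε 1
  refine hb (a := f x) ?_ ⟨x, ⟨⟨by linarith, by linarith⟩, hxO⟩, rfl⟩
  rw [Real.closedBall_eq_Icc]
  exact ⟨by linarith, by linarith⟩

/-- Near a point that is not a local maximum, all slightly larger values are attained. -/
theorem exists_fibre_nonempty_above [LocallyConnectedSpace X] {f : X → ℝ} (hf : Continuous f)
    {y : X} (hy : ¬ IsLocalMax f y) {N : Set X} (hN : N ∈ 𝓝 y) :
    ∃ δ > 0, ∀ s ∈ Icc (f y) (f y + δ), (N ∩ f ⁻¹' {s}).Nonempty := by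
  obtain ⟨C, hCN, hCo, hyC, hC⟩ := locallyConnectedSpace_iff_subsets_isOpen_isConnected.1
    inferInstance y N hN
  have : ∃ z ∈ C, f y < f z := by
    by_contra! h
    exact hy (Filter.mem_of_superset (hCo.mem_nhds hyC) h)
  obtain ⟨z, hzC, hz⟩ := this
  refine ⟨f z - f y, by linarith, fun s hs => ?_⟩
  obtain ⟨w, hw, hws⟩ := hC.isPreconnected.intermediate_value hyC hzC hf.continuousOn
    (show s ∈ Icc (f y) (f z) from ⟨hs.1, by linarith [hs.2]⟩)
  exact ⟨w, hCN hw, hws⟩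

/-- Two neighbourhoods of a common point of the level `t` either meet the slightly higher fibres
in a common point or both miss them, depending on whether that point is a local maximum. -/
theorem exists_fibre_dichotomy_above [LocallyConnectedSpace X] {f : X → ℝ} (hf : Continuous f)
    {t : ℝ} {N N' : Set X}
    (h1 : (∀ x ∈ N, f x ≤ t) ∨ ∀ x ∈ N, f x = t → ¬ IsLocalMax f x)
    (h2 : (∀ x ∈ N', f x ≤ t) ∨ ∀ x ∈ N', f x = t → ¬ IsLocalMax f x)
    {y : X} (hyt : f y = t) (hN : N ∈ 𝓝 y) (hN' : N' ∈ 𝓝 y) :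
    ∃ δ > 0, ∀ s ∈ Icc t (t + δ), (N ∩ N' ∩ f ⁻¹' {s}).Nonempty ∨
      (N ∩ f ⁻¹' {s} = ∅ ∧ N' ∩ f ⁻¹' {s} = ∅) := by
  by_cases hy : IsLocalMax f y
  · have key : ∀ N ∈ 𝓝 y, ((∀ x ∈ N, f x ≤ t) ∨ ∀ x ∈ N, f x = t → ¬ IsLocalMax f x) →
        ∀ s, t < s → N ∩ f ⁻¹' {s} = ∅ := by
      intro N hN h s hs
      rcases h with h | h
      · ext x
        simp only [mem_inter_iff, mem_preimage, mem_singleton_iff, mem_empty_iff_false, iff_false,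
          not_and]
        intro hx hxs
        linarith [h x hx]
      · exact absurd hy (h y (mem_of_mem_nhds hN) hyt)
    refine ⟨1, one_pos, fun s hs => ?_⟩
    rcases hs.1.eq_or_lt with rfl | hlt
    · exact .inl ⟨y, ⟨mem_of_mem_nhds hN, mem_of_mem_nhds hN'⟩, hyt⟩
    · exact .inr ⟨key N hN h1 s hlt, key N' hN' h2 s hlt⟩
  · obtain ⟨δ, hδ, h⟩ := exists_fibre_nonempty_above hf hy (inter_mem hN hN')
    exact ⟨δ, hδ, fun s hs => .inl (h s (by rwa [hyt]))⟩

/-- A small change of level does not disconnect two overlapping pieces of a fibre: the pieces over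
the new level still overlap, or both are empty. -/
theorem exists_fibre_dichotomy [LocallyConnectedSpace X] {f : X → ℝ} (hf : Continuous f)
    {t : ℝ} {N N' : Set X}
    (h1 : (∀ x ∈ N, f x ≤ t) ∨ ∀ x ∈ N, f x = t → ¬ IsLocalMax f x)
    (h2 : (∀ x ∈ N', f x ≤ t) ∨ ∀ x ∈ N', f x = t → ¬ IsLocalMax f x)
    (h1' : (∀ x ∈ N, t ≤ f x) ∨ ∀ x ∈ N, f x = t → ¬ IsLocalMin f x)
    (h2' : (∀ x ∈ N', t ≤ f x) ∨ ∀ x ∈ N', f x = t → ¬ IsLocalMin f x)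
    {y : X} (hyt : f y = t) (hN : N ∈ 𝓝 y) (hN' : N' ∈ 𝓝 y) :
    ∃ δ > 0, ∀ s ∈ Icc (t - δ) (t + δ), (N ∩ N' ∩ f ⁻¹' {s}).Nonempty ∨
      (N ∩ f ⁻¹' {s} = ∅ ∧ N' ∩ f ⁻¹' {s} = ∅) := by
  obtain ⟨δ, hδ, h⟩ := exists_fibre_dichotomy_above hf h1 h2 hyt hN hN'
  have key : ∀ N : Set X, ((∀ x ∈ N, t ≤ f x) ∨ ∀ x ∈ N, f x = t → ¬ IsLocalMin f x) →
      ((∀ x ∈ N, -f x ≤ -t) ∨ ∀ x ∈ N, -f x = -t → ¬ IsLocalMax (fun x => -f x) x) := by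
    intro N h
    refine h.imp (fun h x hx => neg_le_neg (h x hx)) fun h x hx hxt hmax => ?_
    exact h x hx (neg_inj.1 hxt) (by simpa using hmax.neg)
  obtain ⟨δ', hδ', h'⟩ := exists_fibre_dichotomy_above (f := fun x => -f x) hf.neg (key N h1')
    (key N' h2') (by rw [hyt]) hN hN'
  refine ⟨min δ δ', lt_min hδ hδ', fun s hs => ?_⟩
  have e1 := min_le_left δ δ'
  have e2 := min_le_right δ δ'
  rcases le_total t s with hts | hst
  · exact h s ⟨hts, by linarith [hs.2]⟩
  · have hset : (fun x => -f x) ⁻¹' {-s} = f ⁻¹' {s} := by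
      ext x
      simp
    have := h' (-s) ⟨by linarith, by linarith [hs.1]⟩
    rwa [hset] at this

/-- Near a given level `t`, separations of a single fibre extend to a whole tube around the fibre
over `t`. The tube is covered by finitely many sets with connected fibres, each of which lies
on one side of the separation. -/
theorem exists_separationsExtend_Icc [RegularSpace X] [LocallyConnectedSpace X] {f : X → ℝ}
    (hf : Continuous f) (hK : ∀ a b : ℝ, IsCompact (f ⁻¹' Icc a b)) (hT : ∀ x, TameAt f x)
    (t : ℝ) : ∃ δ > 0, ∀ s ∈ Icc (t - δ) (t + δ),
      SeparationsExtend f {s} (Icc (t - δ) (t + δ)) := by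
  have hloc : ∀ x, ∃ N V : Set X, f x = t → V ∈ 𝓝 x ∧ IsClosed V ∧ V ⊆ interior N ∧
      (∀ s, IsPreconnected (N ∩ f ⁻¹' {s})) ∧
      ((∀ x ∈ N, f x ≤ t) ∨ ∀ x ∈ N, f x = t → ¬ IsLocalMax f x) ∧
      ((∀ x ∈ N, t ≤ f x) ∨ ∀ x ∈ N, f x = t → ¬ IsLocalMin f x) := by
    intro x
    by_cases hx : f x = t
    swap
    · exact ⟨∅, ∅, fun h => absurd h hx⟩
    have h1 : ∃ W ∈ 𝓝 x, ((∀ x ∈ W, f x ≤ t) ∨ ∀ x ∈ W, f x = t → ¬ IsLocalMax f x) := by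
      rw [← hx]
      exact (hT x).max.elim (fun h => ⟨_, h, .inl fun y hy => hy⟩)
        fun h => ⟨_, h, .inr fun y hy => hy⟩
    have h2 : ∃ W ∈ 𝓝 x, ((∀ x ∈ W, t ≤ f x) ∨ ∀ x ∈ W, f x = t → ¬ IsLocalMin f x) := by
      rw [← hx]
      exact (hT x).min.elim (fun h => ⟨_, h, .inl fun y hy => hy⟩)
        fun h => ⟨_, h, .inr fun y hy => hy⟩
    obtain ⟨W, hW, h⟩ := h1
    obtain ⟨W', hW', h'⟩ := h2
    obtain ⟨N, hN, hNW, hs⟩ := (hT x).fibre _ (inter_mem hW hW')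
    obtain ⟨V, hV, hVc, hVN⟩ := exists_mem_nhds_isClosed_subset (interior_mem_nhds.2 hN)
    exact ⟨N, V, fun _ => ⟨hV, hVc, hVN, hs,
      h.imp (fun h y hy => h y (hNW hy).1) (fun h y hy => h y (hNW hy).1),
      h'.imp (fun h y hy => h y (hNW hy).2) (fun h y hy => h y (hNW hy).2)⟩⟩
  choose N V hNV using hloc
  have hF : IsCompact (f ⁻¹' {t}) := by simpa using hK t t
  obtain ⟨J, hJt, hJ⟩ := hF.elim_nhds_subcover_nhdsSet fun x hx => (hNV x hx).1
  have hcover : ∃ δ > 0, f ⁻¹' Icc (t - δ) (t + δ) ⊆ ⋃ x ∈ J, V x := by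
    obtain ⟨δ, hδ, h⟩ := exists_tube (t := t) hf hK isOpen_interior
      (subset_interior_iff_mem_nhdsSet.2 hJ)
    exact ⟨δ, hδ, h.trans interior_subset⟩
  have hpair : ∀ j k, ∃ δ > 0, j ∈ J → k ∈ J → ∀ s ∈ Icc (t - δ) (t + δ),
      (∃ x ∈ V j ∩ V k, f x ∈ Icc (t - δ) (t + δ)) →
      (N j ∩ N k ∩ f ⁻¹' {s}).Nonempty ∨ (N j ∩ f ⁻¹' {s} = ∅ ∧ N k ∩ f ⁻¹' {s} = ∅) := by
    intro j k
    by_cases hjk : j ∈ J ∧ k ∈ J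
    swap
    · exact ⟨1, one_pos, fun h h' => absurd ⟨h, h'⟩ hjk⟩
    obtain ⟨-, hVj, hVNj, -, hj1, hj2⟩ := hNV j (hJt j hjk.1)
    obtain ⟨-, hVk, hVNk, -, hk1, hk2⟩ := hNV k (hJt k hjk.2)
    by_cases hy : ∃ y ∈ V j ∩ V k, f y = t
    · obtain ⟨y, hy, hyt⟩ := hy
      obtain ⟨δ, hδ, h⟩ := exists_fibre_dichotomy hf hj1 hk1 hj2 hk2 hyt
        (mem_interior_iff_mem_nhds.1 (hVNj hy.1)) (mem_interior_iff_mem_nhds.1 (hVNk hy.2))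
      exact ⟨δ, hδ, fun _ _ s hs _ => h s hs⟩
    · push Not at hy
      obtain ⟨δ, hδ, h⟩ := exists_tube (t := t) hf hK (hVj.inter hVk).isOpen_compl
        fun x hx hx' => hy x hx' hx
      exact ⟨δ, hδ, fun _ _ s _ ⟨x, hx, hxt⟩ => absurd hx (h hxt)⟩
  choose δ hδ hpair using hpair
  obtain ⟨δ₀, hδ₀, hcover⟩ := hcover
  have hmin : ∃ d > 0, d ≤ δ₀ ∧ ∀ j ∈ J, ∀ k ∈ J, d ≤ δ j k := by
    have : ∀ᶠ d in 𝓝[>] (0 : ℝ), d ≤ δ₀ ∧ ∀ j ∈ J, ∀ k ∈ J, d ≤ δ j k := by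
      refine (eventually_nhdsWithin_of_eventually_nhds (eventually_le_nhds hδ₀)).and ?_
      rw [Filter.eventually_all_finset]
      intro j _
      rw [Filter.eventually_all_finset]
      intro k _
      exact eventually_nhdsWithin_of_eventually_nhds (eventually_le_nhds (hδ j k))
    obtain ⟨d, hd, hd0⟩ := (this.and self_mem_nhdsWithin).exists
    exact ⟨d, hd0, hd⟩
  obtain ⟨d, hd, hd0, hdjk⟩ := hmin
  refine ⟨d, hd, fun s hs A B hAB => ?_⟩
  set T := f ⁻¹' Icc (t - d) (t + d) with hTdef
  have hTc : IsClosed T := isClosed_Icc.preimage hf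
  have hTV : ∀ x ∈ T, ∃ j ∈ J, x ∈ V j := by
    intro x hx
    have := hcover (show x ∈ f ⁻¹' Icc (t - δ₀) (t + δ₀) from
      ⟨by linarith [hx.1], by linarith [hx.2]⟩)
    simpa using this
  have hVN : ∀ j ∈ J, V j ⊆ N j := fun j hj => (hNV j (hJt j hj)).2.2.1.trans interior_subset
  have hAs : A ⊆ f ⁻¹' {s} := subset_union_left.trans hAB.union.subset
  -- A fibrewise connected piece that meets `A` lies in `A` over the level `s`.
  have hside : ∀ j ∈ J, (N j ∩ A).Nonempty → N j ∩ f ⁻¹' {s} ⊆ A := by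
    intro j hj hne x hx
    rcases (hAB.union.symm.subset hx.2 : x ∈ A ∪ B) with hxA | hxB
    · exact hxA
    · obtain ⟨z, hz, hzA⟩ := hne
      obtain ⟨w, -, hw⟩ := isPreconnected_closed_iff.1 ((hNV j (hJt j hj)).2.2.2.1 s) A B hAB.left
        hAB.right (inter_subset_right.trans hAB.union.symm.subset) ⟨z, ⟨hz, hAs hzA⟩, hzA⟩
        ⟨x, hx, hxB⟩
      exact absurd hw.2 (Set.disjoint_left.1 hAB.disjoint hw.1)
  have hBs : B ⊆ f ⁻¹' {s} := subset_union_right.trans hAB.union.subset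
  have hsT : f ⁻¹' {s} ⊆ T := preimage_mono (singleton_subset_iff.2 hs)
  refine ⟨⋃ j ∈ {j ∈ (J : Set X) | (N j ∩ A).Nonempty}, V j ∩ T,
    ⋃ j ∈ {j ∈ (J : Set X) | ¬ (N j ∩ A).Nonempty}, V j ∩ T, ⟨?_, ?_, ?_, ?_⟩, ?_, ?_⟩
  · exact (J.finite_toSet.subset (sep_subset _ _)).isClosed_biUnion
      fun j hj => (hNV j (hJt j hj.1)).2.1.inter hTc
  · exact (J.finite_toSet.subset (sep_subset _ _)).isClosed_biUnion
      fun j hj => (hNV j (hJt j hj.1)).2.1.inter hTc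
  · simp only [Set.disjoint_left, mem_iUnion, exists_prop, not_exists, not_and]
    rintro x ⟨j, ⟨hj, hjA⟩, hxj, hxT⟩ k ⟨hk, hkA⟩ hxk
    exfalso
    have hle : ∀ r ∈ Icc (t - d) (t + d), r ∈ Icc (t - δ j k) (t + δ j k) := fun r hr =>
      ⟨by linarith [hr.1, hdjk j hj k hk], by linarith [hr.2, hdjk j hj k hk]⟩
    rcases hpair j k hj hk s (hle s hs) ⟨x, ⟨hxj, hxk.1⟩, hle _ hxT⟩ with ⟨z, hz, hzs⟩ | ⟨h, -⟩
    · exact hkA ⟨z, hz.2, hside j hj hjA ⟨hz.1, hzs⟩⟩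
    · obtain ⟨z, hz, hzA⟩ := hjA
      exact (h.subset ⟨hz, hAs hzA⟩ : z ∈ (∅ : Set X))
  · ext x
    simp only [mem_union, mem_iUnion, exists_prop]
    constructor
    · rintro (⟨j, -, hx⟩ | ⟨j, -, hx⟩) <;> exact hx.2
    · intro hx
      obtain ⟨j, hj, hxj⟩ := hTV x hx
      by_cases h : (N j ∩ A).Nonempty
      · exact .inl ⟨j, ⟨hj, h⟩, hxj, hx⟩
      · exact .inr ⟨j, ⟨hj, h⟩, hxj, hx⟩
  · intro x hx
    obtain ⟨j, hj, hxj⟩ := hTV x (hsT (hAs hx))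
    simp only [mem_iUnion, exists_prop]
    exact ⟨j, ⟨hj, x, hVN j hj hxj, hx⟩, hxj, hsT (hAs hx)⟩
  · intro x hx
    obtain ⟨j, hj, hxj⟩ := hTV x (hsT (hBs hx))
    simp only [mem_iUnion, exists_prop]
    exact ⟨j, ⟨hj, fun h => Set.disjoint_left.1 hAB.disjoint
      (hside j hj h ⟨hVN j hj hxj, hBs hx⟩) hx⟩, hxj, hsT (hBs hx)⟩

theorem separationsExtend_Icc [RegularSpace X] [LocallyConnectedSpace X] {f : X → ℝ}
    (hf : Continuous f) (hK : ∀ a b : ℝ, IsCompact (f ⁻¹' Icc a b)) (hT : ∀ x, TameAt f x)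
    {a b : ℝ} (hab : a ≤ b) : SeparationsExtend f {a} (Icc a b) := by
  have hstep := exists_separationsExtend_Icc hf hK hT
  suffices h : Icc a b ⊆ {T | SeparationsExtend f {a} (Icc a T)} from h (right_mem_Icc.2 hab)
  refine IsClosed.Icc_subset_of_forall_exists_gt ?_ ?_ ?_
  · refine isClosed_of_closure_subset fun c hc => ?_
    have hcI : c ∈ Icc a b := closure_minimal inter_subset_right isClosed_Icc hc
    refine ⟨?_, hcI⟩
    obtain ⟨δ, hδ, h⟩ := hstep c
    obtain ⟨T, ⟨hT, hTI⟩, hTc⟩ := Metric.mem_closure_iff.1 hc δ hδ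
    rw [Real.dist_eq, abs_lt] at hTc
    rcases le_total c T with hcT | hcT
    · exact SeparationsExtend.mono hf hT isClosed_Icc
        (singleton_subset_iff.2 (left_mem_Icc.2 hcI.1)) (Icc_subset_Icc_right hcT)
    · refine SeparationsExtend.trans hf hTI.1 hcT hT ((h T ⟨?_, ?_⟩).mono hf isClosed_Icc
        (singleton_subset_iff.2 (left_mem_Icc.2 hcT)) (Icc_subset_Icc ?_ ?_)) <;> linarith
  · intro A B hAB
    refine ⟨A, B, ?_, subset_rfl, subset_rfl⟩
    rwa [Icc_self]
  · rintro x ⟨hx, hxI⟩ y hy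
    obtain ⟨δ, hδ, h⟩ := hstep x
    have hy : x < y := hy
    have h1 := min_le_left y (x + δ)
    have h2 := min_le_right y (x + δ)
    have h3 : x < min y (x + δ) := lt_min hy (by linarith)
    refine ⟨min y (x + δ), ?_, h3, h1⟩
    refine SeparationsExtend.trans hf hxI.1 h3.le hx ((h x ⟨?_, ?_⟩).mono hf isClosed_Icc
      (singleton_subset_iff.2 (left_mem_Icc.2 h3.le)) (Icc_subset_Icc ?_ ?_)) <;> linarith

theorem separationsExtend_Ici [RegularSpace X] [LocallyConnectedSpace X] {f : X → ℝ}
    (hf : Continuous f) (hK : ∀ a b : ℝ, IsCompact (f ⁻¹' Icc a b)) (hT : ∀ x, TameAt f x)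
    (a : ℝ) : SeparationsExtend f {a} (Ici a) := by
  intro A B hAB
  have hstep : ∀ (n : ℕ) (p : Set X × Set X), Separates f (Icc a (a + n)) p.1 p.2 →
      ∃ q : Set X × Set X, Separates f (Icc a (a + (n + 1 : ℕ))) q.1 q.2 ∧ p ≤ q := by
    intro n p hp
    have hn : a ≤ a + n := by simp
    have hn' : a + n ≤ a + (n + 1 : ℕ) := by simp
    obtain ⟨A', B', h', hA', hB'⟩ := separationsExtend_Icc hf hK hT hn' _ _
      (hp.restrict hf isClosed_singleton (singleton_subset_iff.2 (right_mem_Icc.2 hn)))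
    refine ⟨(p.1 ∪ A', p.2 ∪ B'), ?_, subset_union_left, subset_union_left⟩
    rw [← Icc_union_Icc_eq_Icc hn hn']
    refine hp.glue ?_ h' hA' hB'
    rintro x ⟨hx, hy⟩
    exact le_antisymm hx.2 hy.1
  choose! q hq hpq using hstep
  let p : ℕ → Set X × Set X := fun n => Nat.rec (A, B) q n
  have hp : ∀ n : ℕ, Separates f (Icc a (a + n)) (p n).1 (p n).2 := by
    intro n
    induction n with
    | zero => simpa [p] using hAB
    | succ n ih => exact hq n _ ih
  have hmono : Monotone p := monotone_nat_of_le_succ fun n => hpq n _ (hp n)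
  have hloc : ∀ x, ∃ n : ℕ, f x < a + n := fun x => by
    obtain ⟨n, hn⟩ := exists_nat_gt (f x - a)
    exact ⟨n, by linarith⟩
  have hsub : ∀ n, (p n).1 ∪ (p n).2 ⊆ f ⁻¹' Icc a (a + n) := fun n => (hp n).union.subset
  -- Below the level `a + n` the union of the increasing sequence is its `n`-th term.
  have hA : ∀ (n : ℕ) x, f x < a + n → ((∃ m, x ∈ (p m).1) ↔ x ∈ (p n).1) := by
    refine fun n x hx => ⟨fun ⟨m, hm⟩ => ?_, fun h => ⟨n, h⟩⟩
    have hxn : x ∈ (p n).1 ∪ (p n).2 := by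
      rw [(hp n).union]
      exact ⟨(hsub m (.inl hm)).1, hx.le⟩
    refine hxn.resolve_right fun h => ?_
    exact Set.disjoint_left.1 (hp (max m n)).disjoint ((hmono (le_max_left m n)).1 hm)
      ((hmono (le_max_right m n)).2 h)
  have hB : ∀ (n : ℕ) x, f x < a + n → ((∃ m, x ∈ (p m).2) ↔ x ∈ (p n).2) := by
    refine fun n x hx => ⟨fun ⟨m, hm⟩ => ?_, fun h => ⟨n, h⟩⟩
    have hxn : x ∈ (p n).1 ∪ (p n).2 := by
      rw [(hp n).union]
      exact ⟨(hsub m (.inr hm)).1, hx.le⟩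
    refine hxn.resolve_left fun h => ?_
    exact Set.disjoint_left.1 (hp (max m n)).disjoint ((hmono (le_max_right m n)).1 h)
      ((hmono (le_max_left m n)).2 hm)
  have hclosed : ∀ (S : ℕ → Set X), (∀ n, IsClosed (S n)) →
      (∀ (n : ℕ) x, f x < a + n → ((∃ m, x ∈ S m) ↔ x ∈ S n)) → IsClosed (⋃ n, S n) := by
    intro S hS h
    refine isClosed_of_closure_subset fun x hx => ?_
    obtain ⟨n, hn⟩ := hloc x
    refine mem_iUnion.2 ⟨n, (hS n).closure_subset (mem_closure_iff_nhds.2 fun W hW => ?_)⟩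
    obtain ⟨y, hy, hyS⟩ := mem_closure_iff_nhds.1 hx _
      (inter_mem hW ((isOpen_lt hf continuous_const).mem_nhds hn))
    exact ⟨y, hy.1, (h n y hy.2).1 (mem_iUnion.1 hyS)⟩
  refine ⟨⋃ n, (p n).1, ⋃ n, (p n).2, ⟨hclosed _ (fun n => (hp n).left) hA,
    hclosed _ (fun n => (hp n).right) hB, ?_, ?_⟩, subset_iUnion (fun n => (p n).1) 0,
    subset_iUnion (fun n => (p n).2) 0⟩
  · rw [Set.disjoint_left]
    intro x hx hx'
    obtain ⟨n, hn⟩ := hloc x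
    exact Set.disjoint_left.1 (hp n).disjoint ((hA n x hn).1 (mem_iUnion.1 hx))
      ((hB n x hn).1 (mem_iUnion.1 hx'))
  · rw [← iUnion_union_distrib]
    ext x
    simp only [mem_iUnion, mem_preimage, mem_Ici]
    refine ⟨fun ⟨n, h⟩ => (hsub n h).1, fun h => ?_⟩
    obtain ⟨n, hn⟩ := hloc x
    exact ⟨n, (hp n).union.symm.subset ⟨h, hn.le⟩⟩

/-- A proper tame function on a connected space has connected fibres: a separation of one fibre
would extend to a separation of the whole space. -/
theorem isPreconnected_fibre [RegularSpace X] [LocallyConnectedSpace X] [PreconnectedSpace X]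
    {f : X → ℝ} (hf : Continuous f) (hK : ∀ a b : ℝ, IsCompact (f ⁻¹' Icc a b))
    (hT : ∀ x, TameAt f x) (t : ℝ) : IsPreconnected (f ⁻¹' {t}) := by
  have hFc : IsClosed (f ⁻¹' {t}) := isClosed_singleton.preimage hf
  rw [isPreconnected_closed_iff]
  intro A B hA hB hAB hA' hB'
  by_contra hne
  have hsep : Separates f {t} (f ⁻¹' {t} ∩ A) (f ⁻¹' {t} ∩ B) :=
    { left := hFc.inter hA
      right := hFc.inter hB
      disjoint := Set.disjoint_left.2 fun x hx hx' => hne ⟨x, hx.1, hx.2, hx'.2⟩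
      union := by
        rw [← inter_union_distrib_left]
        exact inter_eq_left.2 hAB }
  obtain ⟨A₁, B₁, h₁, hA₁, hB₁⟩ := separationsExtend_Ici hf hK hT t _ _ hsep
  have hpre : ∀ S : Set ℝ, (fun x => -f x) ⁻¹' S = f ⁻¹' (-S) := fun S => rfl
  obtain ⟨A₂, B₂, h₂, hA₂, hB₂⟩ := separationsExtend_Ici (f := fun x => -f x) hf.neg
    (fun a b => by simpa [hpre] using hK (-b) (-a)) (fun x => (hT x).neg) (-t)
    (f ⁻¹' {t} ∩ A) (f ⁻¹' {t} ∩ B) ⟨hsep.left, hsep.right, hsep.disjoint, by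
      rw [hsep.union, hpre]
      simp⟩
  have h₂ : Separates f (Iic t) A₂ B₂ := ⟨h₂.left, h₂.right, h₂.disjoint, by
    rw [h₂.union, hpre]
    simp⟩
  have key : Separates f (Ici t ∪ Iic t) (A₁ ∪ A₂) (B₁ ∪ B₂) := by
    have hr := h₁.restrict hf isClosed_singleton (singleton_subset_iff.2 self_mem_Ici)
    refine h₁.glue (b := t) (fun x hx => le_antisymm hx.2 hx.1) h₂ ?_ ?_
    · rintro x ⟨hx, hxt⟩
      refine hA₂ ((hsep.union.symm.subset hxt).resolve_right fun h => ?_)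
      exact Set.disjoint_left.1 h₁.disjoint hx (hB₁ h)
    · rintro x ⟨hx, hxt⟩
      refine hB₂ ((hsep.union.symm.subset hxt).resolve_left fun h => ?_)
      exact Set.disjoint_left.1 h₁.disjoint (hA₁ h) hx
  rw [union_comm, Iic_union_Ici] at key
  obtain ⟨x, -, hx⟩ := isPreconnected_closed_iff.1
    (PreconnectedSpace.isPreconnected_univ (α := X)) _ _ key.left
    key.right (by rw [key.union]; simp) (hA'.mono fun x hx => ⟨trivial, .inl (hA₁ hx)⟩)
    (hB'.mono fun x hx => ⟨trivial, .inl (hB₁ hx)⟩)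
  exact Set.disjoint_left.1 key.disjoint hx.1 hx.2

end Global

/-! ### Saddles -/

section Saddle

variable {Z P N : Type*} [NormedAddCommGroup Z] [NormedAddCommGroup P] [NormedAddCommGroup N]

/-- Exchange of the two coordinates normal to the axis. -/
def swapSnd (Z P N : Type*) [TopologicalSpace Z] [TopologicalSpace P] [TopologicalSpace N] :
    Z × P × N ≃ₜ Z × N × P :=
  (Homeomorph.refl Z).prodCongr (Homeomorph.prodComm P N)

theorem norm_prod_le_iff₃ {z : Z} {p : P} {q : N} {r : ℝ} :
    ‖(z, p, q)‖ ≤ r ↔ ‖z‖ ≤ r ∧ ‖p‖ ≤ r ∧ ‖q‖ ≤ r := by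
  simp [Prod.norm_def]

/-- The part of the box swept out by the hyperbolas `‖p‖ ‖q‖ < a`, at levels close to `c`. -/
def saddleNhd (K : Z × P × N → ℝ) (r c a η : ℝ) : Set (Z × P × N) :=
  {x | ‖x.1‖ < r ∧ ‖x.2.1‖ < r ∧ ‖x.2.2‖ < r ∧ ‖x.2.1‖ * ‖x.2.2‖ < a ∧ |K x - c| < η}

theorem saddleNhd_swap (K : Z × P × N → ℝ) (r c a η : ℝ) :
    saddleNhd (fun x => -K (swapSnd Z N P x)) r (-c) a η =
      swapSnd Z N P ⁻¹' saddleNhd K r c a η := by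
  ext ⟨z, q, p⟩
  change (‖z‖ < r ∧ ‖q‖ < r ∧ ‖p‖ < r ∧ ‖q‖ * ‖p‖ < a ∧ |-K (z, p, q) - -c| < η) ↔
    (‖z‖ < r ∧ ‖p‖ < r ∧ ‖q‖ < r ∧ ‖p‖ * ‖q‖ < a ∧ |K (z, p, q) - c| < η)
  rw [mul_comm ‖q‖, show -K (z, p, q) - -c = -(K (z, p, q) - c) by ring, abs_neg]
  tauto

variable [NormedSpace ℝ P] [NormedSpace ℝ N]

/-- On the box `‖x‖ ≤ r` in `Z × P × N`, the function `K` is constant on the axis `Z` and strictly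
increases along the hyperbolas `ρ ↦ (z, ρ p, ρ⁻¹ q)`. -/
structure IsSaddle (K : Z × P × N → ℝ) (r c : ℝ) : Prop where
  pos : 0 < r
  cont : ContinuousOn K {x | ‖x‖ ≤ r}
  axis : ∀ z, ‖z‖ ≤ r → K (z, 0, 0) = c
  mono : ∀ (z : Z) (p : P) (q : N) (ρ : ℝ), 1 < ρ → ‖z‖ ≤ r → ‖ρ • p‖ ≤ r → ‖q‖ ≤ r →
    (p ≠ 0 ∨ q ≠ 0) → K (z, p, q) < K (z, ρ • p, ρ⁻¹ • q)

theorem IsSaddle.shrink {K : Z × P × N → ℝ} {r r' c : ℝ} (h : IsSaddle K r c) (h0 : 0 < r')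
    (hr : r' ≤ r) : IsSaddle K r' c where
  pos := h0
  cont := h.cont.mono fun _ hx => le_trans hx hr
  axis z hz := h.axis z (hz.trans hr)
  mono z p q ρ hρ hz hp hq hpq := h.mono z p q ρ hρ (hz.trans hr) (hp.trans hr) (hq.trans hr) hpq

theorem IsSaddle.swap {K : Z × P × N → ℝ} {r c : ℝ} (h : IsSaddle K r c) :
    IsSaddle (fun x => -K (swapSnd Z N P x)) r (-c) where
  pos := h.pos
  cont := by
    refine (h.cont.comp (swapSnd Z N P).continuous.continuousOn fun x hx => ?_).neg
    simp only [mem_ofPred_eq, Prod.norm_def, swapSnd] at hx ⊢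
    simpa [max_comm] using hx
  axis z hz := by simpa [swapSnd] using h.axis z hz
  mono z p q ρ hρ hz hp hq hpq := by
    have hρ0 : ρ ≠ 0 := by positivity
    have := h.mono z (ρ⁻¹ • q) (ρ • p) ρ hρ hz (by rwa [smul_inv_smul₀ hρ0]) hp
      (by simpa [hρ0] using hpq.symm)
    rw [smul_inv_smul₀ hρ0, inv_smul_smul₀ hρ0] at this
    simpa [swapSnd] using this

theorem IsSaddle.lt_above {K : Z × P × N → ℝ} {r c : ℝ} (h : IsSaddle K r c) {z : Z} {p : P}
    (hz : ‖z‖ ≤ r) (hp : ‖p‖ ≤ r) (hp0 : p ≠ 0) : c < K (z, p, 0) := by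
  have h1 : ∀ s t : ℝ, 0 < s → s < t → t ≤ 1 → K (z, s • p, 0) < K (z, t • p, 0) := by
    intro s t hs hst ht
    have := h.mono z (s • p) 0 (t / s) ((one_lt_div hs).2 hst) hz ?_ (by simp [h.pos.le])
      (.inl (smul_ne_zero hs.ne' hp0))
    · simpa [smul_smul, div_mul_cancel₀ _ hs.ne'] using this
    · rw [smul_smul, div_mul_cancel₀ _ hs.ne', norm_smul, Real.norm_of_nonneg (hs.trans hst).le]
      exact (mul_le_of_le_one_left (norm_nonneg _) ht).trans hp
  have h2 : Tendsto (fun s : ℝ => K (z, s • p, 0)) (𝓝[>] 0) (𝓝 c) := by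
    rw [← h.axis z hz]
    have hc : ContinuousWithinAt K {x | ‖x‖ ≤ r} (z, 0, 0) :=
      h.cont _ (norm_prod_le_iff₃.2 ⟨hz, by simp [h.pos.le], by simp [h.pos.le]⟩)
    refine hc.tendsto.comp (tendsto_nhdsWithin_iff.2 ⟨?_, ?_⟩)
    · have : Continuous fun s : ℝ => (z, s • p, (0 : N)) := by fun_prop
      have := this.tendsto 0
      rw [zero_smul] at this
      exact this.mono_left nhdsWithin_le_nhds
    · filter_upwards [Ioc_mem_nhdsGT (zero_lt_one' ℝ)] with s hs
      refine norm_prod_le_iff₃.2 ⟨hz, ?_, by simp [h.pos.le]⟩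
      rw [norm_smul, Real.norm_of_nonneg hs.1.le]
      exact (mul_le_of_le_one_left (norm_nonneg _) hs.2).trans hp
  have h3 : c ≤ K (z, (1 / 2 : ℝ) • p, 0) := by
    refine le_of_tendsto h2 ?_
    filter_upwards [Ioo_mem_nhdsGT (show (0 : ℝ) < 1 / 2 by norm_num)] with s hs
    exact (h1 s _ hs.1 hs.2 (by norm_num)).le
  have := h1 (1 / 2) 1 (by norm_num) (by norm_num) le_rfl
  rw [one_smul] at this
  exact h3.trans_lt this

/-- The strict inequality of `IsSaddle.lt_above` on the sphere `‖p‖ = r` is uniform and persists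
for small `q`, by compactness. -/
theorem IsSaddle.exists_margin [NormedSpace ℝ Z] [FiniteDimensional ℝ Z] [FiniteDimensional ℝ P]
    {K : Z × P × N → ℝ} {r c : ℝ} (h : IsSaddle K r c) :
    ∃ ε > 0, ∀ z p q, ‖z‖ ≤ r → ‖p‖ = r → ‖q‖ ≤ ε → c + ε < K (z, p, q) := by
  have : ProperSpace Z := FiniteDimensional.proper ℝ Z
  have : ProperSpace P := FiniteDimensional.proper ℝ P
  have hC : IsCompact (Metric.closedBall (0 : Z) r ×ˢ Metric.sphere (0 : P) r) :=
    (isCompact_closedBall _ _).prod (isCompact_sphere _ _)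
  have hr := h.pos
  have hev : ∀ᶠ s : N × ℝ in 𝓝 (0, 0), ∀ y ∈ Metric.closedBall (0 : Z) r ×ˢ
      Metric.sphere (0 : P) r, ‖s.1‖ ≤ r → c + s.2 < K (y.1, y.2, s.1) := by
    have hcont : ContinuousOn (fun v : (Z × P) × (N × ℝ) => K (v.1.1, v.1.2, v.2.1) - v.2.2)
        {v | ‖(v.1.1, v.1.2, v.2.1)‖ ≤ r} :=
      (h.cont.comp (f := fun v : (Z × P) × (N × ℝ) => (v.1.1, v.1.2, v.2.1)) (by fun_prop)
        fun v hv => hv).sub (by fun_prop)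
    have key : ∀ y ∈ Metric.closedBall (0 : Z) r ×ˢ Metric.sphere (0 : P) r,
        ∀ᶠ v : (Z × P) × (N × ℝ) in 𝓝 (y, 0), ‖(v.1.1, v.1.2, v.2.1)‖ ≤ r →
          c + v.2.2 < K (v.1.1, v.1.2, v.2.1) := by
      rintro ⟨z, p⟩ ⟨hz, hp⟩
      simp only [Metric.mem_closedBall, dist_zero_right, mem_sphere_iff_norm, sub_zero] at hz hp
      have hp0 : p ≠ 0 := by
        rintro rfl
        simp at hp
        linarith
      have := (hcont ((z, p), 0) (norm_prod_le_iff₃.2 ⟨hz, hp.le, by simp [hr.le]⟩)).eventually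
        (lt_mem_nhds (show c < K (z, p, 0) - 0 by simpa using h.lt_above hz hp.le hp0))
      rw [eventually_nhdsWithin_iff] at this
      filter_upwards [this] with v hv hvr
      linarith [hv hvr]
    have := hC.eventually_forall_of_forall_eventually (x₀ := (0 : N × ℝ))
      (P := fun s y => y ∈ Metric.closedBall (0 : Z) r ×ˢ Metric.sphere (0 : P) r →
        ‖s.1‖ ≤ r → c + s.2 < K (y.1, y.2, s.1)) ?_
    · filter_upwards [this] with s hs y hy using hs y hy hy
    · intro y hy
      filter_upwards [(continuous_swap.tendsto _).eventually (key y hy)] with v hv hvy hvr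
      refine hv (norm_prod_le_iff₃.2 ⟨?_, ?_, hvr⟩)
      · simpa using hvy.1
      · exact (by simpa using hvy.2 : ‖v.2.2‖ = r).le
  obtain ⟨ε, hε, hb⟩ := Metric.eventually_nhds_iff_ball.1 hev
  refine ⟨min r (ε / 2), by positivity, fun z p q hz hp hq => ?_⟩
  refine hb (q, min r (ε / 2)) ?_ (z, p) ⟨by simpa using hz, by simpa using hp⟩
    (hq.trans (min_le_left _ _))
  have h1 := min_le_right r (ε / 2)
  have h2 : 0 < min r (ε / 2) := by positivity
  rw [← Prod.zero_eq_mk, mem_ball_zero_iff, Prod.norm_def, max_lt_iff, Real.norm_of_nonneg h2.le]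
  constructor <;> linarith

/-- A saddle together with widths `a` and `η` such that every hyperbola `‖p‖ ‖q‖ < a` enters the box
below the level `c - η` and leaves it above the level `c + η`. -/
structure IsSaddleBox (K : Z × P × N → ℝ) (r c a η : ℝ) : Prop extends IsSaddle K r c where
  width_pos : 0 < a
  width_le : a ≤ r * r
  height_pos : 0 < η
  above : ∀ z p q, ‖z‖ ≤ r → ‖p‖ = r → ‖q‖ * r ≤ a → c + η < K (z, p, q)
  below : ∀ z p q, ‖z‖ ≤ r → ‖q‖ = r → ‖p‖ * r ≤ a → K (z, p, q) < c - η

theorem IsSaddle.exists_box [NormedSpace ℝ Z] [FiniteDimensional ℝ Z] [FiniteDimensional ℝ P]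
    [FiniteDimensional ℝ N] {K : Z × P × N → ℝ} {r c : ℝ} (h : IsSaddle K r c) :
    ∃ a η, IsSaddleBox K r c a η := by
  obtain ⟨ε, hε, h1⟩ := h.exists_margin
  obtain ⟨ε', hε', h2⟩ := h.swap.exists_margin
  have hr := h.pos
  refine ⟨r * min r (min ε ε'), min ε ε', h, by positivity,
    mul_le_mul_of_nonneg_left (min_le_left _ _) hr.le, by positivity, ?_, ?_⟩
  · intro z p q hz hp hq
    rw [mul_comm, mul_le_mul_iff_right₀ hr] at hq
    have := h1 z p q hz hp (hq.trans ((min_le_right _ _).trans (min_le_left _ _)))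
    linarith [min_le_left ε ε']
  · intro z p q hz hp hq
    rw [mul_comm, mul_le_mul_iff_right₀ hr] at hq
    have := h2 z q p hz hp (hq.trans ((min_le_right _ _).trans (min_le_right _ _)))
    simp only [swapSnd, Homeomorph.prodCongr] at this
    change -c + ε' < -K (z, p, q) at this
    linarith [min_le_right ε ε']

theorem IsSaddleBox.swap {K : Z × P × N → ℝ} {r c a η : ℝ} (h : IsSaddleBox K r c a η) :
    IsSaddleBox (fun x => -K (swapSnd Z N P x)) r (-c) a η where
  toIsSaddle := h.toIsSaddle.swap
  width_pos := h.width_pos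
  width_le := h.width_le
  height_pos := h.height_pos
  above z p q hz hp hq := by
    have := h.below z q p hz hp hq
    change -c + η < -K (z, q, p)
    linarith
  below z p q hz hp hq := by
    have := h.above z q p hz hp hq
    change -K (z, q, p) < -c - η
    linarith

theorem IsSaddleBox.saddleNhd_mem_nhds {K : Z × P × N → ℝ} {r c a η : ℝ}
    (h : IsSaddleBox K r c a η) : saddleNhd K r c a η ∈ 𝓝 0 := by
  have hr := h.pos
  have hc : ContinuousAt K 0 := h.cont.continuousAt (by
    filter_upwards [Metric.closedBall_mem_nhds (0 : Z × P × N) hr] with x hx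
    simpa using hx)
  have h0 : K 0 = c := h.axis 0 (by simp [hr.le])
  have hlt : ∀ f : Z × P × N → ℝ, ∀ b, Continuous f → f 0 < b → ∀ᶠ x in 𝓝 0, f x < b :=
    fun f b hf hb => hf.continuousAt.eventually (gt_mem_nhds hb)
  filter_upwards [hlt (fun x => ‖x.1‖) r (by fun_prop) (by simpa),
    hlt (fun x => ‖x.2.1‖) r (by fun_prop) (by simpa),
    hlt (fun x => ‖x.2.2‖) r (by fun_prop) (by simpa),
    hlt (fun x => ‖x.2.1‖ * ‖x.2.2‖) a (by fun_prop) (by simpa using h.width_pos),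
    hc.eventually (Metric.ball_mem_nhds (K 0) h.height_pos)] with x h1 h2 h3 h4 h5
  refine ⟨h1, h2, h3, h4, ?_⟩
  rw [← h0]
  exact h5

theorem norm_hyperbola_le {r : ℝ}
    {z : Z} {u : P} {w : N} {ρ : ℝ} (hz : ‖z‖ ≤ r) (hu : ‖u‖ = 1) (hρ : 0 < ρ)
    (h1 : ‖w‖ ≤ ρ * r) (h2 : ρ ≤ r) : ‖(z, ρ • u, ρ⁻¹ • w)‖ ≤ r := by
  refine norm_prod_le_iff₃.2 ⟨hz, ?_, ?_⟩
  · rwa [norm_smul, hu, mul_one, Real.norm_of_nonneg hρ.le]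
  · rwa [norm_smul, norm_inv, Real.norm_of_nonneg hρ.le, inv_mul_le_iff₀ hρ]

theorem IsSaddleBox.strictMono {K : Z × P × N → ℝ} {r c a η : ℝ} (h : IsSaddleBox K r c a η)
    {z : Z} {u : P} {w : N} {ρ ρ' : ℝ} (hz : ‖z‖ ≤ r) (hu : ‖u‖ = 1) (hρ : 0 < ρ) (hρρ : ρ < ρ')
    (h1 : ‖w‖ ≤ ρ * r) (h2 : ρ' ≤ r) :
    K (z, ρ • u, ρ⁻¹ • w) < K (z, ρ' • u, ρ'⁻¹ • w) := by
  have hle := norm_prod_le_iff₃.1 (norm_hyperbola_le hz hu hρ h1 (hρρ.le.trans h2))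
  have hle' := norm_prod_le_iff₃.1 (norm_hyperbola_le (w := w) hz hu (hρ.trans hρρ)
    (h1.trans (mul_le_mul_of_nonneg_right hρρ.le h.pos.le)) h2)
  have hu0 : u ≠ 0 := by
    rintro rfl
    simp at hu
  have e1 : (ρ' / ρ) • ρ • u = ρ' • u := by rw [smul_smul, div_mul_cancel₀ _ hρ.ne']
  have e2 : (ρ' / ρ)⁻¹ • ρ⁻¹ • w = ρ'⁻¹ • w := by
    rw [smul_smul, inv_div, div_mul_eq_mul_div, mul_inv_cancel₀ hρ.ne', one_div]
  have := h.mono z (ρ • u) (ρ⁻¹ • w) (ρ' / ρ) ((one_lt_div hρ).2 hρρ) hz (e1 ▸ hle'.2.1) hle.2.2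
    (.inl (smul_ne_zero hρ.ne' hu0))
  rwa [e1, e2] at this

/-- Parameters `(z, u, w)` of the hyperbolas `ρ ↦ (z, ρ u, ρ⁻¹ w)` that cross the level `τ`. -/
def saddleParams (Z P N : Type*) [NormedAddCommGroup Z] [NormedAddCommGroup P]
    [NormedAddCommGroup N] (r c a τ : ℝ) : Set (Z × P × N) :=
  {y | ‖y.1‖ < r ∧ ‖y.2.1‖ = 1 ∧ ‖y.2.2‖ < a ∧ (c < τ ∨ y.2.2 ≠ 0)}

theorem IsSaddleBox.exists_crossing {K : Z × P × N → ℝ} {r c a η τ : ℝ}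
    (h : IsSaddleBox K r c a η) (hτ : τ ∈ Ioo (c - η) (c + η)) {z : Z} {u : P} {w : N}
    (hy : (z, u, w) ∈ saddleParams Z P N r c a τ) :
    ∃ ρ, 0 < ρ ∧ ‖w‖ < ρ * r ∧ ρ < r ∧ K (z, ρ • u, ρ⁻¹ • w) = τ := by
  obtain ⟨hz, hu, hw, hcτ⟩ := hy
  dsimp only at hz hu hw hcτ
  have hr := h.pos
  have htop : τ < K (z, r • u, r⁻¹ • w) := by
    refine hτ.2.trans (h.above _ _ _ hz.le ?_ ?_)
    · rw [norm_smul, hu, mul_one, Real.norm_of_nonneg hr.le]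
    · rw [norm_smul, norm_inv, Real.norm_of_nonneg hr.le, mul_comm, mul_inv_cancel_left₀ hr.ne']
      exact hw.le
  have hbot : ∃ ρ, 0 < ρ ∧ ρ < r ∧ ‖w‖ ≤ ρ * r ∧ K (z, ρ • u, ρ⁻¹ • w) < τ := by
    by_cases hw0 : w = 0
    · subst hw0
      have hcτ : c < τ := by simpa using hcτ
      have hc : ContinuousWithinAt K {x | ‖x‖ ≤ r} (z, 0, 0) :=
        h.cont _ (norm_prod_le_iff₃.2 ⟨hz.le, by simp [hr.le], by simp [hr.le]⟩)
      have h2 : Tendsto (fun s : ℝ => K (z, s • u, 0)) (𝓝[>] 0) (𝓝 c) := by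
        rw [← h.axis z hz.le]
        refine hc.tendsto.comp (tendsto_nhdsWithin_iff.2 ⟨?_, ?_⟩)
        · have : Continuous fun s : ℝ => (z, s • u, (0 : N)) := by fun_prop
          have := this.tendsto 0
          rw [zero_smul] at this
          exact this.mono_left nhdsWithin_le_nhds
        · filter_upwards [Ioc_mem_nhdsGT hr] with s hs
          refine norm_prod_le_iff₃.2 ⟨hz.le, ?_, by simp [hr.le]⟩
          rw [norm_smul, hu, mul_one, Real.norm_of_nonneg hs.1.le]
          exact hs.2
      obtain ⟨s, hs, hsr⟩ := ((h2.eventually (gt_mem_nhds hcτ)).and (Ioo_mem_nhdsGT hr)).exists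
      refine ⟨s, hsr.1, hsr.2, ?_, by simpa using hs⟩
      simpa using (mul_pos hsr.1 hr).le
    · have hw0' : 0 < ‖w‖ := norm_pos_iff.2 hw0
      have hpos : 0 < ‖w‖ / r := by positivity
      refine ⟨‖w‖ / r, hpos, ?_, by rw [div_mul_cancel₀ _ hr.ne'], ?_⟩
      · rw [div_lt_iff₀ hr]
        exact hw.trans_le h.width_le
      · refine (h.below _ _ _ hz.le ?_ ?_).trans hτ.1
        · rw [norm_smul, norm_inv, Real.norm_of_nonneg hpos.le]
          field_simp
        · rw [norm_smul, hu, mul_one, Real.norm_of_nonneg hpos.le, div_mul_cancel₀ _ hr.ne']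
          exact hw.le
  obtain ⟨ρ₀, hρ₀, hρr, hwρ, hlow⟩ := hbot
  have hcont : ContinuousOn (fun ρ : ℝ => K (z, ρ • u, ρ⁻¹ • w)) (Icc ρ₀ r) := by
    refine h.cont.comp (fun ρ hρ => ContinuousAt.continuousWithinAt ?_) fun ρ hρ => ?_
    · have : ρ ≠ 0 := (hρ₀.trans_le hρ.1).ne'
      fun_prop (disch := assumption)
    · exact norm_hyperbola_le hz.le hu (hρ₀.trans_le hρ.1)
        (hwρ.trans (mul_le_mul_of_nonneg_right hρ.1 hr.le)) hρ.2
  obtain ⟨ρ, hρ, hρτ⟩ := intermediate_value_Ioo hρr.le hcont ⟨hlow, htop⟩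
  exact ⟨ρ, hρ₀.trans hρ.1, hwρ.trans_lt (mul_lt_mul_of_pos_right hρ.1 hr), hρ.2, hρτ⟩

/-- The crossing parameter with the level `τ` depends continuously on the hyperbola. -/
theorem IsSaddleBox.exists_continuousOn_crossing {K : Z × P × N → ℝ} {r c a η τ : ℝ}
    (h : IsSaddleBox K r c a η) (hτ : τ ∈ Ioo (c - η) (c + η)) :
    ∃ ρ : Z × P × N → ℝ, ContinuousOn ρ (saddleParams Z P N r c a τ) ∧
      ∀ y ∈ saddleParams Z P N r c a τ, 0 < ρ y ∧ ‖y.2.2‖ < ρ y * r ∧ ρ y < r ∧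
        K (y.1, ρ y • y.2.1, (ρ y)⁻¹ • y.2.2) = τ := by
  have hex : ∀ y : Z × P × N, ∃ ρ, y ∈ saddleParams Z P N r c a τ → 0 < ρ ∧ ‖y.2.2‖ < ρ * r ∧
      ρ < r ∧ K (y.1, ρ • y.2.1, ρ⁻¹ • y.2.2) = τ := by
    intro y
    by_cases hy : y ∈ saddleParams Z P N r c a τ
    · obtain ⟨ρ, hρ⟩ := h.exists_crossing hτ hy
      exact ⟨ρ, fun _ => hρ⟩
    · exact ⟨0, fun h => absurd h hy⟩
  choose ρ hρ using hex
  refine ⟨ρ, ?_, hρ⟩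
  have hr := h.pos
  intro y hy
  obtain ⟨h0, h1, h2, h3⟩ := hρ y hy
  -- Continuity in the hyperbola at a fixed parameter `s` strictly inside the box.
  have hcont : ∀ s, 0 < s → ‖y.2.2‖ < s * r → s < r →
      Tendsto (fun y' : Z × P × N => K (y'.1, s • y'.2.1, s⁻¹ • y'.2.2))
        (𝓝[saddleParams Z P N r c a τ] y) (𝓝 (K (y.1, s • y.2.1, s⁻¹ • y.2.2))) := by
    intro s hs hs1 hs2
    refine (h.cont (y.1, s • y.2.1, s⁻¹ • y.2.2)
      (norm_hyperbola_le hy.1.le hy.2.1 hs hs1.le hs2.le)).tendsto.comp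
          (tendsto_nhdsWithin_iff.2 ⟨?_, ?_⟩)
    · have : Continuous fun y' : Z × P × N => (y'.1, s • y'.2.1, s⁻¹ • y'.2.2) := by fun_prop
      exact (this.tendsto y).mono_left nhdsWithin_le_nhds
    · have : ∀ᶠ y' : Z × P × N in 𝓝 y, ‖y'.2.2‖ < s * r :=
        (show Continuous fun y' : Z × P × N => ‖y'.2.2‖ by fun_prop).continuousAt.eventually
          (gt_mem_nhds hs1)
      filter_upwards [nhdsWithin_le_nhds this, self_mem_nhdsWithin] with y' hy' hys
      exact norm_hyperbola_le hys.1.le hys.2.1 hs hy'.le hs2.le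
  have hnear : ∀ s, ‖y.2.2‖ < s * r → ∀ᶠ y' in 𝓝[saddleParams Z P N r c a τ] y,
      ‖y'.2.2‖ < s * r := fun s hs => nhdsWithin_le_nhds
    ((show Continuous fun y' : Z × P × N => ‖y'.2.2‖ by fun_prop).continuousAt.eventually
      (gt_mem_nhds hs))
  refine tendsto_order.2 ⟨fun b hb => ?_, fun b hb => ?_⟩
  · obtain ⟨s, hs, hsρ⟩ := exists_between (max_lt hb (max_lt h0 ((div_lt_iff₀ hr).2 h1)))
    rw [max_lt_iff, max_lt_iff, div_lt_iff₀ hr] at hs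
    obtain ⟨hbs, hs0, hs1⟩ := hs
    have hlow : K (y.1, s • y.2.1, s⁻¹ • y.2.2) < τ := by
      rw [← h3]
      exact h.strictMono hy.1.le hy.2.1 hs0 hsρ hs1.le h2.le
    filter_upwards [(hcont s hs0 hs1 (hsρ.trans h2)).eventually (gt_mem_nhds hlow),
      self_mem_nhdsWithin] with y' hy' hys
    refine hbs.trans (lt_of_not_ge fun hle => ?_)
    obtain ⟨h0', h1', h2', h3'⟩ := hρ y' hys
    rcases hle.eq_or_lt with heq | hlt
    · rw [heq] at h3'
      exact hy'.ne h3'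
    · have := h.strictMono hys.1.le hys.2.1 h0' hlt h1'.le (hsρ.trans h2).le
      rw [h3'] at this
      exact lt_asymm hy' this
  · obtain ⟨s, hsρ, hs⟩ := exists_between (lt_min hb h2)
    rw [lt_min_iff] at hs
    have hs0 := h0.trans hsρ
    have hs1 : ‖y.2.2‖ < s * r := h1.trans (mul_lt_mul_of_pos_right hsρ hr)
    have hhigh : τ < K (y.1, s • y.2.1, s⁻¹ • y.2.2) := by
      rw [← h3]
      exact h.strictMono hy.1.le hy.2.1 h0 hsρ h1.le hs.2.le
    filter_upwards [(hcont s hs0 hs1 hs.2).eventually (lt_mem_nhds hhigh),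
      self_mem_nhdsWithin, hnear s hs1] with y' hy' hys hys1
    refine (lt_of_not_ge fun hle => ?_).trans hs.1
    obtain ⟨h0', h1', h2', h3'⟩ := hρ y' hys
    rcases hle.eq_or_lt with heq | hlt
    · rw [← heq] at h3'
      exact hy'.ne' h3'
    · have := h.strictMono hys.1.le hys.2.1 hs0 hlt hys1.le h2'.le
      rw [h3'] at this
      exact lt_asymm hy' this

theorem IsSaddleBox.hyperbola_mem {K : Z × P × N → ℝ} {r c a η τ : ℝ}
    (hτ : τ ∈ Ioo (c - η) (c + η)) {z : Z} {u : P} {w : N} {ρ : ℝ}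
    (hy : (z, u, w) ∈ saddleParams Z P N r c a τ) (h0 : 0 < ρ) (h1 : ‖w‖ < ρ * r) (h2 : ρ < r)
    (h3 : K (z, ρ • u, ρ⁻¹ • w) = τ) :
    (z, ρ • u, ρ⁻¹ • w) ∈ saddleNhd K r c a η ∩ K ⁻¹' {τ} := by
  obtain ⟨hz, hu, hw, -⟩ := hy
  dsimp only at hz hu hw
  have e1 : ‖ρ • u‖ = ρ := by rw [norm_smul, hu, mul_one, Real.norm_of_nonneg h0.le]
  have e2 : ‖ρ⁻¹ • w‖ = ρ⁻¹ * ‖w‖ := by rw [norm_smul, norm_inv, Real.norm_of_nonneg h0.le]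
  refine ⟨⟨hz, ?_, ?_, ?_, ?_⟩, h3⟩
  · dsimp only
    rwa [e1]
  · dsimp only
    rwa [e2, inv_mul_lt_iff₀ h0]
  · dsimp only
    rwa [e1, e2, mul_inv_cancel_left₀ h0.ne']
  · rw [h3, abs_lt]
    constructor <;> linarith [hτ.1, hτ.2]

/-- A point of the box off the plane `p = 0` lies on the hyperbola with parameters
`(z, p / ‖p‖, ‖p‖ q)`. -/
theorem IsSaddleBox.eq_crossing {K : Z × P × N → ℝ} {r c a η τ : ℝ}
    (h : IsSaddleBox K r c a η) {ρ : Z × P × N → ℝ}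
    (hρ : ∀ y ∈ saddleParams Z P N r c a τ, 0 < ρ y ∧ ‖y.2.2‖ < ρ y * r ∧ ρ y < r ∧
        K (y.1, ρ y • y.2.1, (ρ y)⁻¹ • y.2.2) = τ)
    {z : Z} {p : P} {q : N} (hx : (z, p, q) ∈ saddleNhd K r c a η ∩ K ⁻¹' {τ}) (hp : p ≠ 0)
    (hq : c < τ ∨ q ≠ 0) :
    (z, ‖p‖⁻¹ • p, ‖p‖ • q) ∈ saddleParams Z P N r c a τ ∧
      ρ (z, ‖p‖⁻¹ • p, ‖p‖ • q) = ‖p‖ := by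
  obtain ⟨⟨hz, hpr, hqr, hpq, -⟩, hτ⟩ := hx
  dsimp only at hz hpr hqr hpq
  have hp0 : 0 < ‖p‖ := norm_pos_iff.2 hp
  have hmem : (z, ‖p‖⁻¹ • p, ‖p‖ • q) ∈ saddleParams Z P N r c a τ := by
    refine ⟨hz, ?_, ?_, ?_⟩
    · simp [norm_smul, hp0.ne']
    · simpa [norm_smul] using hpq
    · simpa [hp] using hq
  refine ⟨hmem, ?_⟩
  obtain ⟨h0, h1, h2, h3⟩ := hρ _ hmem
  set σ := ρ (z, ‖p‖⁻¹ • p, ‖p‖ • q)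
  dsimp only at h1 h3
  have hK : K (z, ‖p‖ • ‖p‖⁻¹ • p, ‖p‖⁻¹ • ‖p‖ • q) = τ := by
    rw [smul_inv_smul₀ hp0.ne', inv_smul_smul₀ hp0.ne']
    exact hτ
  have hq' : ‖‖p‖ • q‖ ≤ ‖p‖ * r := by
    rw [norm_smul, norm_norm]
    exact mul_le_mul_of_nonneg_left hqr.le hp0.le
  rcases lt_trichotomy σ ‖p‖ with hlt | heq | hgt
  · have := h.strictMono hz.le hmem.2.1 h0 hlt h1.le hpr.le
    rw [hK, h3] at this
    exact absurd this (lt_irrefl _)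
  · exact heq
  · have := h.strictMono hz.le hmem.2.1 hp0 hgt hq' h2.le
    rw [hK, h3] at this
    exact absurd this (lt_irrefl _)

/-- Above the critical level, the fibre is a continuous image of the set of the hyperbolas
crossing it, and that set is connected because the unit sphere of `P` is. -/
theorem IsSaddleBox.isPreconnected_above [NormedSpace ℝ Z] {K : Z × P × N → ℝ} {r c a η τ : ℝ}
    (h : IsSaddleBox K r c a η) (hP : IsPreconnected (Metric.sphere (0 : P) 1))
    (hτ : τ ∈ Ioo (c - η) (c + η)) (hcτ : c < τ) :
    IsPreconnected (saddleNhd K r c a η ∩ K ⁻¹' {τ}) := by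
  obtain ⟨ρ, hρc, hρ⟩ := h.exists_continuousOn_crossing hτ
  have hS : IsPreconnected (saddleParams Z P N r c a τ) := by
    have : saddleParams Z P N r c a τ =
        Metric.ball 0 r ×ˢ Metric.sphere 0 1 ×ˢ Metric.ball 0 a := by
      ext y
      simp [saddleParams, hcτ]
    rw [this]
    exact (convex_ball _ _).isPreconnected.prod (hP.prod (convex_ball _ _).isPreconnected)
  have : saddleNhd K r c a η ∩ K ⁻¹' {τ} =
      (fun y => (y.1, ρ y • y.2.1, (ρ y)⁻¹ • y.2.2)) '' saddleParams Z P N r c a τ := by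
    ext ⟨z, p, q⟩
    constructor
    · intro hx
      have hp : p ≠ 0 := by
        rintro rfl
        have hlow : K (z, 0, q) ≤ c := by
          by_cases hq : q = 0
          · rw [hq, h.axis z hx.1.1.le]
          · have := h.swap.lt_above (z := z) (p := q) hx.1.1.le hx.1.2.2.1.le hq
            change -c < -K (z, 0, q) at this
            linarith
        have : K (z, 0, q) = τ := hx.2
        linarith
      have hp0 : ‖p‖ ≠ 0 := norm_ne_zero_iff.2 hp
      obtain ⟨hm, he⟩ := h.eq_crossing hρ hx hp (.inl hcτ)
      refine ⟨_, hm, ?_⟩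
      dsimp only
      rw [he, smul_inv_smul₀ hp0, inv_smul_smul₀ hp0]
    · rintro ⟨y, hy, hyx⟩
      rw [← hyx]
      obtain ⟨h0, h1, h2, h3⟩ := hρ y hy
      exact IsSaddleBox.hyperbola_mem hτ hy h0 h1 h2 h3
  rw [this]
  refine hS.image _ (continuousOn_fst.prodMk ((hρc.smul (by fun_prop)).prodMk
    ((hρc.inv₀ fun y hy => (hρ y hy).1.ne').smul (by fun_prop))))

/-- At the critical level every point is joined to the axis inside the level, by moving its
hyperbola towards the axis. -/
theorem IsSaddleBox.isPreconnected_critical [NormedSpace ℝ Z] {K : Z × P × N → ℝ} {r c a η : ℝ}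
    (h : IsSaddleBox K r c a η) :
    IsPreconnected (saddleNhd K r c a η ∩ K ⁻¹' {c}) := by
  have hr := h.pos
  have hτ : c ∈ Ioo (c - η) (c + η) := ⟨by linarith [h.height_pos], by linarith [h.height_pos]⟩
  obtain ⟨ρ, hρc, hρ⟩ := h.exists_continuousOn_crossing hτ
  set F := saddleNhd K r c a η ∩ K ⁻¹' {c} with hF
  have haxis : ∀ z, ‖z‖ < r → (z, (0 : P), (0 : N)) ∈ F := fun z hz => by
    have := h.axis z hz.le
    exact ⟨⟨hz, by simpa, by simpa, by simpa using h.width_pos,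
      by simpa [this] using h.height_pos⟩, this⟩
  have haxisc : IsPreconnected ((fun z : Z => (z, (0 : P), (0 : N))) '' Metric.ball 0 r) :=
    (convex_ball _ _).isPreconnected.image _ (by fun_prop)
  refine isPreconnected_of_forall (0, 0, 0) fun x hx => ?_
  obtain ⟨z, p, q⟩ := x
  have hz : ‖z‖ < r := hx.1.1
  suffices hC : ∃ C ⊆ F, (z, 0, 0) ∈ C ∧ (z, p, q) ∈ C ∧ IsPreconnected C by
    obtain ⟨C, hCF, hzC, hxC, hC⟩ := hC
    refine ⟨(fun z : Z => (z, (0 : P), (0 : N))) '' Metric.ball 0 r ∪ C, union_subset ?_ hCF,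
      .inl ⟨0, by simpa using hr, rfl⟩, .inr hxC,
      haxisc.union (z, 0, 0) ⟨z, by simpa using hz, rfl⟩ hzC hC⟩
    rintro _ ⟨z', hz', rfl⟩
    exact haxis z' (by simpa using hz')
  by_cases hp : p = 0
  · by_cases hq : q = 0
    · subst hp hq
      exact ⟨{(z, 0, 0)}, by simpa using hx, rfl, rfl, isPreconnected_singleton⟩
    · have := h.swap.lt_above (z := z) (p := q) hx.1.1.le hx.1.2.2.1.le hq
      change -c < -K (z, 0, q) at this
      have h' : K (z, p, q) = c := hx.2
      rw [hp] at h'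
      linarith
  by_cases hq : q = 0
  · have := h.lt_above (z := z) (p := p) hx.1.1.le hx.1.2.1.le hp
    have h' : K (z, p, q) = c := hx.2
    rw [hq] at h'
    linarith
  obtain ⟨hm, he⟩ := h.eq_crossing hρ hx hp (.inr hq)
  have hp0 : 0 < ‖p‖ := norm_pos_iff.2 hp
  set u := ‖p‖⁻¹ • p with hu
  set w := ‖p‖ • q with hw
  have hw0 : w ≠ 0 := smul_ne_zero hp0.ne' hq
  have hu0 : u ≠ 0 := smul_ne_zero (inv_ne_zero hp0.ne') hp
  clear_value u w
  have hθ : ∀ θ ∈ Ioc (0 : ℝ) 1, (z, u, θ • w) ∈ saddleParams Z P N r c a c := by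
    intro θ hθ
    refine ⟨hm.1, hm.2.1, ?_, .inr (smul_ne_zero hθ.1.ne' hw0)⟩
    dsimp only
    rw [norm_smul, Real.norm_of_nonneg hθ.1.le]
    exact (mul_le_of_le_one_left (norm_nonneg _) hθ.2).trans_lt hm.2.2.1
  let σ : ℝ → ℝ := fun θ => ρ (z, u, θ • w)
  have hσc : ContinuousOn σ (Ioc 0 1) := hρc.comp (by fun_prop) hθ
  have hσ0 : ∀ θ ∈ Ioc (0 : ℝ) 1, 0 < σ θ := fun θ h => (hρ _ (hθ θ h)).1
  let γ : ℝ → Z × P × N := fun θ => (z, σ θ • u, (σ θ)⁻¹ • θ • w)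
  have hγc : ContinuousOn γ (Ioc 0 1) :=
    continuousOn_const.prodMk ((hσc.smul continuousOn_const).prodMk
      ((hσc.inv₀ fun θ h => (hσ0 θ h).ne').smul (by fun_prop)))
  have hγF : γ '' Ioc 0 1 ⊆ F := by
    rintro _ ⟨θ, h, rfl⟩
    obtain ⟨h0, h1, h2, h3⟩ := hρ _ (hθ θ h)
    exact IsSaddleBox.hyperbola_mem hτ (hθ θ h) h0 h1 h2 h3
  have hγ1 : γ 1 = (z, p, q) := by
    have : σ 1 = ‖p‖ := by
      simp only [σ, one_smul]
      exact he
    simp only [γ, this, one_smul, hu, hw]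
    rw [smul_inv_smul₀ hp0.ne', inv_smul_smul₀ hp0.ne']
  refine ⟨insert (z, 0, 0) (γ '' Ioc 0 1), insert_subset (haxis z hz) hγF, mem_insert _ _,
    .inr ⟨1, by simp, hγ1⟩, ?_⟩
  refine (isPreconnected_Ioc.image γ hγc).subset_closure (subset_insert _ _)
    (insert_subset ?_ subset_closure)
  -- The crossing points tend to the axis: for `ε > 0` the values of `K` at `(z, ε u, 0)` and
  -- `(z, 0, ε w)` are separated by `c`, which bounds the crossing parameter on both sides.
  have hKc : ∀ x : Z × P × N, ‖x‖ ≤ r → ∀ g : ℝ → Z × P × N, Tendsto g (𝓝[>] 0) (𝓝 x) →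
      (∀ᶠ θ in 𝓝[>] 0, ‖g θ‖ ≤ r) → Tendsto (fun θ => K (g θ)) (𝓝[>] 0) (𝓝 (K x)) :=
    fun x hx g hg hgr => (h.cont x hx).tendsto.comp (tendsto_nhdsWithin_iff.2 ⟨hg, hgr⟩)
  have hI : ∀ᶠ θ : ℝ in 𝓝[>] 0, θ ∈ Ioc (0 : ℝ) 1 := Ioc_mem_nhdsGT one_pos
  have hupper : ∀ ε > 0, ε < r → ∀ᶠ θ in 𝓝[>] 0, σ θ < ε := by
    intro ε hε hεr
    have hu1 : ‖ε • u‖ = ε := by rw [norm_smul, hm.2.1, mul_one, Real.norm_of_nonneg hε.le]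
    have hcont : Continuous fun θ : ℝ => (z, ε • u, ε⁻¹ • θ • w) := by fun_prop
    have h0 := hcont.tendsto 0
    simp only [zero_smul, smul_zero] at h0
    have hsmall : ∀ᶠ θ : ℝ in 𝓝 0, ‖θ • w‖ < ε * r :=
      (show Continuous fun θ : ℝ => ‖θ • w‖ by fun_prop).continuousAt.eventually
        (gt_mem_nhds (by simpa using mul_pos hε hr))
    have hle : ∀ᶠ θ in 𝓝[>] (0 : ℝ), ‖(z, ε • u, ε⁻¹ • θ • w)‖ ≤ r := by
      filter_upwards [nhdsWithin_le_nhds hsmall] with θ hθ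
      exact norm_hyperbola_le hz.le hm.2.1 hε hθ.le hεr.le
    have hlim := hKc (z, ε • u, 0) (norm_prod_le_iff₃.2 ⟨hz.le, by rw [hu1]; exact hεr.le,
      by simpa using hr.le⟩) _ (h0.mono_left nhdsWithin_le_nhds) hle
    filter_upwards [hlim.eventually (lt_mem_nhds (h.lt_above hz.le (by rw [hu1]; exact hεr.le)
      (smul_ne_zero hε.ne' hu0))), hI, nhdsWithin_le_nhds hsmall] with θ hθ1 hθI hθs
    refine lt_of_not_ge fun hle => ?_
    obtain ⟨-, -, h2, h3⟩ := hρ _ (hθ θ hθI)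
    change K (z, σ θ • u, (σ θ)⁻¹ • θ • w) = c at h3
    rcases hle.eq_or_lt with heq | hlt
    · rw [heq] at hθ1
      exact hθ1.ne' h3
    · have := h.strictMono hz.le hm.2.1 hε hlt hθs.le h2.le
      rw [h3] at this
      exact lt_asymm hθ1 this
  have hlower : ∀ ε > 0, ε * ‖w‖ < r → ∀ᶠ θ in 𝓝[>] 0, θ / σ θ < ε := by
    intro ε hε hεr
    have hcont : Continuous fun θ : ℝ => (z, (θ / ε) • u, ε • w) := by fun_prop
    have h0 := hcont.tendsto 0
    simp only [zero_div, zero_smul] at h0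
    have hew : ‖ε • w‖ < r := by rwa [norm_smul, Real.norm_of_nonneg hε.le]
    have hew' : ‖ε • w‖ = ε * ‖w‖ := by rw [norm_smul, Real.norm_of_nonneg hε.le]
    have hsmall : ∀ᶠ θ : ℝ in 𝓝 0, θ / ε < r :=
      (show Continuous fun θ : ℝ => θ / ε by fun_prop).continuousAt.eventually
        (gt_mem_nhds (by simpa using hr))
    have hle : ∀ᶠ θ in 𝓝[>] (0 : ℝ), ‖(z, (θ / ε) • u, ε • w)‖ ≤ r := by
      filter_upwards [nhdsWithin_le_nhds hsmall, hI] with θ hθs hθI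
      refine norm_prod_le_iff₃.2 ⟨hz.le, ?_, hew.le⟩
      rw [norm_smul, hm.2.1, mul_one, Real.norm_of_nonneg (div_nonneg hθI.1.le hε.le)]
      exact hθs.le
    have hlim := hKc (z, 0, ε • w) (norm_prod_le_iff₃.2 ⟨hz.le, by simpa using hr.le, hew.le⟩) _
      (h0.mono_left nhdsWithin_le_nhds) hle
    have hlow := h.swap.lt_above (z := z) (p := ε • w) hz.le hew.le (smul_ne_zero hε.ne' hw0)
    change -c < -K (z, 0, ε • w) at hlow
    filter_upwards [hlim.eventually (gt_mem_nhds (show K (z, 0, ε • w) < c by linarith)), hI,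
      nhdsWithin_le_nhds hsmall] with θ hθ1 hθI hθs
    have hσθ := hσ0 θ hθI
    rw [div_lt_iff₀ hσθ, mul_comm, ← div_lt_iff₀ hε]
    refine lt_of_not_ge fun hle => ?_
    obtain ⟨-, h1, -, h3⟩ := hρ _ (hθ θ hθI)
    change ‖θ • w‖ < σ θ * r at h1
    change K (z, σ θ • u, (σ θ)⁻¹ • θ • w) = c at h3
    have e : ε • w = (θ / ε)⁻¹ • θ • w := by
      rw [smul_smul, inv_div, div_mul_cancel₀ _ hθI.1.ne']
    rw [e] at hθ1
    rcases hle.eq_or_lt with heq | hlt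
    · rw [heq] at h3
      exact hθ1.ne h3
    · have := h.strictMono hz.le hm.2.1 hσθ hlt h1.le hθs.le
      rw [h3] at this
      exact lt_asymm hθ1 this
  have hlim : Tendsto γ (𝓝[>] 0) (𝓝 (z, 0, 0)) := by
    have hσ : Tendsto σ (𝓝[>] 0) (𝓝 0) := by
      refine tendsto_order.2 ⟨fun b hb => ?_, fun b hb => ?_⟩
      · filter_upwards [hI] with θ hθ using hb.trans (hσ0 θ hθ)
      · filter_upwards [hupper (min b (r / 2)) (by positivity)
          ((min_le_right _ _).trans_lt (by linarith))] with θ hθ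
        exact hθ.trans_le (min_le_left _ _)
    have hσ' : Tendsto (fun θ => (σ θ)⁻¹ * θ) (𝓝[>] 0) (𝓝 0) := by
      refine tendsto_order.2 ⟨fun b hb => ?_, fun b hb => ?_⟩
      · filter_upwards [hI] with θ hθ
        exact hb.trans (mul_pos (inv_pos.2 (hσ0 θ hθ)) hθ.1)
      · have hw' : 0 < ‖w‖ := norm_pos_iff.2 hw0
        filter_upwards [hlower (min b (r / ‖w‖ / 2)) (by positivity) (by
          calc min b (r / ‖w‖ / 2) * ‖w‖ ≤ r / ‖w‖ / 2 * ‖w‖ := by gcongr; exact min_le_right _ _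
            _ = r / 2 := by field_simp
            _ < r := by linarith)] with θ hθ
        rw [inv_mul_eq_div]
        exact hθ.trans_le (min_le_left _ _)
    have := tendsto_const_nhds (x := z) (f := 𝓝[>] (0 : ℝ)) |>.prodMk_nhds
      ((hσ.smul_const u).prodMk_nhds (hσ'.smul_const w))
    simpa [γ, smul_smul] using this
  exact mem_closure_of_tendsto hlim (hI.mono fun θ hθ => ⟨θ, hθ, rfl⟩)

/-- Levels below the critical one are handled by exchanging `P` and `N` and the sign of `K`. -/
theorem IsSaddleBox.isPreconnected_level [NormedSpace ℝ Z] {K : Z × P × N → ℝ} {r c a η : ℝ}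
    (h : IsSaddleBox K r c a η) (hP : IsPreconnected (Metric.sphere (0 : P) 1))
    (hN : IsPreconnected (Metric.sphere (0 : N) 1)) (τ : ℝ) :
    IsPreconnected (saddleNhd K r c a η ∩ K ⁻¹' {τ}) := by
  by_cases hτ : τ ∈ Ioo (c - η) (c + η)
  swap
  · convert isPreconnected_empty
    ext x
    simp only [mem_inter_iff, mem_preimage, mem_singleton_iff, mem_empty_iff_false, iff_false,
      not_and]
    rintro hx rfl
    have := abs_lt.1 hx.2.2.2.2
    exact hτ ⟨by linarith, by linarith⟩
  rcases lt_trichotomy τ c with hlt | rfl | hgt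
  · have := h.swap.isPreconnected_above (τ := -τ) hN ⟨by linarith [hτ.2], by linarith [hτ.1]⟩
      (by linarith)
    rw [saddleNhd_swap] at this
    have := this.image (swapSnd Z N P) (swapSnd Z N P).continuous.continuousOn
    convert this using 1
    have e : (fun x => -K (swapSnd Z N P x)) ⁻¹' {-τ} = swapSnd Z N P ⁻¹' (K ⁻¹' {τ}) := by
      ext x
      simp
    rw [e, ← preimage_inter, image_preimage_eq _ (swapSnd Z N P).surjective]
  · exact h.isPreconnected_critical
  · exact h.isPreconnected_above hP hτ hgt

theorem IsSaddle.not_isLocalMax {K : Z × P × N → ℝ} {r c : ℝ} (h : IsSaddle K r c)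
    [Nontrivial P] {x : Z × P × N} (hx : ‖x‖ < r) : ¬ IsLocalMax K x := by
  obtain ⟨z, p, q⟩ := x
  intro hmax
  have hx' : ‖z‖ ≤ r ∧ ‖p‖ ≤ r ∧ ‖q‖ ≤ r := norm_prod_le_iff₃.1 hx.le
  by_cases hpq : p ≠ 0 ∨ q ≠ 0
  · have hc : ContinuousAt (fun ρ : ℝ => (z, ρ • p, ρ⁻¹ • q)) 1 := by
      fun_prop (disch := norm_num)
    have hc1 : (z, (1 : ℝ) • p, (1 : ℝ)⁻¹ • q) = (z, p, q) := by simp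
    have hc' : Tendsto (fun ρ : ℝ => (z, ρ • p, ρ⁻¹ • q)) (𝓝 1) (𝓝 (z, p, q)) := by
      rw [← hc1]
      exact hc.tendsto
    have h1 := (hc'.eventually hmax).filter_mono (nhdsWithin_le_nhds (s := Ioi 1))
    have h2 := (hc'.eventually (continuous_norm.continuousAt.eventually
      (gt_mem_nhds hx))).filter_mono (nhdsWithin_le_nhds (s := Ioi 1))
    obtain ⟨ρ, ⟨hρ1, hρ2⟩, hρ⟩ := ((h1.and h2).and self_mem_nhdsWithin).exists
    exact hρ1.not_gt (h.mono z p q ρ hρ hx'.1 (norm_prod_le_iff₃.1 hρ2.le).2.1 hx'.2.2 hpq)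
  · push Not at hpq
    obtain ⟨rfl, rfl⟩ := hpq
    obtain ⟨v, hv⟩ := exists_ne (0 : P)
    have hc : Continuous fun s : ℝ => (z, s • v, (0 : N)) := by fun_prop
    have hc' : Tendsto (fun s : ℝ => (z, s • v, (0 : N))) (𝓝 0) (𝓝 (z, 0, 0)) := by
      have := hc.tendsto 0
      rwa [zero_smul] at this
    have h1 := (hc'.eventually hmax).filter_mono (nhdsWithin_le_nhds (s := Ioi 0))
    have h2 := (hc'.eventually (continuous_norm.continuousAt.eventually
      (gt_mem_nhds hx))).filter_mono (nhdsWithin_le_nhds (s := Ioi 0))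
    obtain ⟨s, ⟨hs1, hs2⟩, hs⟩ := ((h1.and h2).and self_mem_nhdsWithin).exists
    have := h.lt_above hx'.1 (norm_prod_le_iff₃.1 hs2.le).2.1 (smul_ne_zero (ne_of_gt hs) hv)
    rw [h.axis z hx'.1] at hs1
    exact hs1.not_gt this

theorem IsSaddle.isLocalMax_of_subsingleton {K : Z × P × N → ℝ} {r c : ℝ} (h : IsSaddle K r c)
    [Subsingleton P] : IsLocalMax K 0 := by
  have h0 : K 0 = c := h.axis 0 (by simpa using h.pos.le)
  filter_upwards [Metric.closedBall_mem_nhds (0 : Z × P × N) h.pos] with x hx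
  obtain ⟨z, p, q⟩ := x
  have hx' : ‖z‖ ≤ r ∧ ‖p‖ ≤ r ∧ ‖q‖ ≤ r := norm_prod_le_iff₃.1 (by simpa using hx)
  rw [h0, Subsingleton.elim p 0]
  by_cases hq : q = 0
  · rw [hq, h.axis z hx'.1]
  · have := h.swap.lt_above (z := z) (p := q) hx'.1 hx'.2.2 hq
    change -c < -K (z, 0, q) at this
    linarith

theorem IsSaddle.max_dichotomy {K : Z × P × N → ℝ} {r c : ℝ} (h : IsSaddle K r c) :
    IsLocalMax K 0 ∨ ∀ᶠ y in 𝓝 0, K y = K 0 → ¬ IsLocalMax K y := by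
  rcases subsingleton_or_nontrivial P with hP | hP
  · exact .inl h.isLocalMax_of_subsingleton
  · right
    filter_upwards [Metric.ball_mem_nhds (0 : Z × P × N) h.pos] with y hy _
    exact h.not_isLocalMax (by simpa using hy)

/-- A saddle whose positive and negative normal directions have connected unit spheres (that is,
dimension different from one) is tame. -/
theorem IsSaddle.tameAt [NormedSpace ℝ Z] [FiniteDimensional ℝ Z] [FiniteDimensional ℝ P]
    [FiniteDimensional ℝ N] {K : Z × P × N → ℝ} {r c : ℝ} (h : IsSaddle K r c)
    (hP : IsPreconnected (Metric.sphere (0 : P) 1))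
    (hN : IsPreconnected (Metric.sphere (0 : N) 1)) : TameAt K 0 where
  fibre W hW := by
    obtain ⟨ε, hε, hb⟩ := Metric.nhds_basis_ball.mem_iff.1 hW
    obtain ⟨a, η, hbox⟩ := (h.shrink (r' := min r ε) (lt_min h.pos hε)
      (min_le_left _ _)).exists_box
    refine ⟨_, hbox.saddleNhd_mem_nhds, fun x hx => hb ?_, hbox.isPreconnected_level hP hN⟩
    rw [mem_ball_zero_iff, Prod.norm_def, Prod.norm_def, max_lt_iff, max_lt_iff]
    exact ⟨hx.1.trans_le (min_le_right _ _), hx.2.1.trans_le (min_le_right _ _),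
      hx.2.2.1.trans_le (min_le_right _ _)⟩
  max := h.max_dichotomy
  min := by
    have hloc : ∀ x, IsLocalMin K (swapSnd Z N P x) ↔
        IsLocalMax (fun x => -K (swapSnd Z N P x)) x := by
      intro x
      have := isLocalMin_comp_openPartialHomeomorph (swapSnd Z N P).toOpenPartialHomeomorph
        (g := K) (x := x) (mem_univ x)
      rw [Homeomorph.toOpenPartialHomeomorph_apply] at this
      rw [this]
      exact ⟨fun h => h.neg, fun h => by simpa using! h.neg⟩
    have h0 : swapSnd Z N P 0 = 0 := rfl
    have := h.swap.max_dichotomy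
    rw [← hloc, h0] at this
    refine this.imp id fun h => ?_
    rw [← h0, ← (swapSnd Z N P).map_nhds_eq 0, eventually_map]
    filter_upwards [h] with y hy hy0
    rw [hloc]
    exact hy (by rw [hy0, h0])

end Saddle

/-! ### Morse–Bott critical points -/

section MorseBott

variable {Z P N E : Type*} [NormedAddCommGroup Z] [NormedSpace ℝ Z]
  [NormedAddCommGroup P] [NormedSpace ℝ P] [NormedAddCommGroup N] [NormedSpace ℝ N]
  [NormedAddCommGroup E] [NormedSpace ℝ E]

/-- The chart `(z, n) ↦ y₀ + L (z, γ z + n)` straightening the graph of `γ`. -/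
noncomputable def shear (L : (Z × P × N) ≃L[ℝ] E) (y₀ : E) {γ : Z → P × N} {r : ℝ}
    (hγ : ContinuousOn γ (Metric.ball 0 r)) : OpenPartialHomeomorph (Z × P × N) E where
  toFun x := y₀ + L (x.1, γ x.1 + x.2)
  invFun y := ((L.symm (y - y₀)).1, (L.symm (y - y₀)).2 - γ (L.symm (y - y₀)).1)
  source := {x | x.1 ∈ Metric.ball 0 r}
  target := {y | (L.symm (y - y₀)).1 ∈ Metric.ball 0 r}
  map_source' x hx := by simpa using hx
  map_target' y hy := hy
  left_inv' x _ := by simp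
  right_inv' y _ := by simp [-map_sub]
  open_source := Metric.isOpen_ball.preimage continuous_fst
  open_target := Metric.isOpen_ball.preimage (by fun_prop)
  continuousOn_toFun := by
    have : ContinuousOn (fun x : Z × P × N => γ x.1) {x | x.1 ∈ Metric.ball 0 r} :=
      hγ.comp continuousOn_fst fun x hx => hx
    exact continuousOn_const.add (L.continuous.comp_continuousOn
      (continuousOn_fst.prodMk (this.add continuousOn_snd)))
  continuousOn_invFun := by
    have : ContinuousOn (fun y : E => γ (L.symm (y - y₀)).1)
        {y | (L.symm (y - y₀)).1 ∈ Metric.ball 0 r} :=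
      hγ.comp (by fun_prop) fun x hx => hx
    have hL : Continuous fun y : E => L.symm (y - y₀) := by fun_prop
    exact (continuous_fst.comp hL).continuousOn.prodMk
      ((continuous_snd.comp hL).continuousOn.sub this)

/-- Reflection of the negative normal directions. -/
def reflect (P N : Type*) [NormedAddCommGroup P] [NormedSpace ℝ P] [NormedAddCommGroup N]
    [NormedSpace ℝ N] : P × N →L[ℝ] P × N :=
  (ContinuousLinearMap.fst ℝ P N).prod (-ContinuousLinearMap.snd ℝ P N)

theorem reflect_apply (p : P) (q : N) : reflect P N (p, q) = (p, -q) := rfl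

/-- The inclusion of the normal directions. -/
noncomputable def normalIncl (L : (Z × P × N) ≃L[ℝ] E) : P × N →L[ℝ] E :=
  (L : (Z × P × N) →L[ℝ] E).comp (ContinuousLinearMap.inr ℝ Z (P × N))

theorem normalIncl_apply (L : (Z × P × N) ≃L[ℝ] E) (n : P × N) : normalIncl L n = L (0, n) := rfl

variable {h : E → ℝ} {y₀ : E} {L : (Z × P × N) ≃L[ℝ] E}

/-- The reflection turns the indefinite normal Hessian into a definite one; the mixed terms cancel
by symmetry. -/
theorem hessian_reflect_pos (Q : E →L[ℝ] E →L[ℝ] ℝ) (hQ : ∀ u v, Q u v = Q v u)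
    (hP : ∀ p : P, p ≠ 0 → 0 < Q (L (0, p, 0)) (L (0, p, 0)))
    (hN : ∀ q : N, q ≠ 0 → Q (L (0, 0, q)) (L (0, 0, q)) < 0) {n : P × N} (hn : n ≠ 0) :
    0 < Q (normalIncl L n) (normalIncl L (reflect P N n)) := by
  obtain ⟨p, q⟩ := n
  have e1 : normalIncl L (p, q) = L (0, p, 0) + L (0, 0, q) := by
    rw [← map_add, normalIncl_apply]
    simp
  have e2 : normalIncl L (reflect P N (p, q)) = L (0, p, 0) - L (0, 0, q) := by
    rw [← map_sub, normalIncl_apply, reflect_apply]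
    simp
  have : Q (normalIncl L (p, q)) (normalIncl L (reflect P N (p, q))) =
      Q (L (0, p, 0)) (L (0, p, 0)) - Q (L (0, 0, q)) (L (0, 0, q)) := by
    rw [e1, e2]
    simp only [map_add, map_sub, add_apply]
    rw [hQ (L (0, 0, q)) (L (0, p, 0))]
    ring
  rw [this]
  by_cases hp : p = 0
  · have hq : q ≠ 0 := by
      rintro rfl
      exact hn (by rw [hp]; rfl)
    have := hN q hq
    have h0 : Q (L (0, p, 0)) (L (0, p, 0)) = 0 := by
      rw [hp]
      have : ((0 : Z), (0 : P), (0 : N)) = 0 := rfl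
      simp [this]
    linarith
  · have h1 := hP p hp
    by_cases hq : q = 0
    · have h0 : Q (L (0, 0, q)) (L (0, 0, q)) = 0 := by
        rw [hq]
        have : ((0 : Z), (0 : P), (0 : N)) = 0 := rfl
        simp [this]
      linarith
    · linarith [hN q hq]

/-- Definiteness of the reflected Hessian persists at nearby points, by compactness of the sphere.
-/
theorem eventually_hessian_reflect_pos [FiniteDimensional ℝ P] [FiniteDimensional ℝ N]
    (hh : ContDiffAt ℝ 2 h y₀)
    (hpos : ∀ n : P × N, n ≠ 0 →
      0 < fderiv ℝ (fderiv ℝ h) y₀ (normalIncl L n) (normalIncl L (reflect P N n))) :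
    ∀ᶠ y in 𝓝 y₀, ∀ n : P × N, n ≠ 0 →
      0 < fderiv ℝ (fderiv ℝ h) y (normalIncl L n) (normalIncl L (reflect P N n)) := by
  have : ProperSpace (P × N) := FiniteDimensional.proper ℝ _
  have hc : ContinuousAt (fderiv ℝ (fderiv ℝ h)) y₀ :=
    ((hh.fderiv_right (m := 1) (by norm_num)).fderiv_right (m := 0) (by norm_num)).continuousAt
  have key := (isCompact_sphere (0 : P × N) 1).eventually_forall_of_forall_eventually (x₀ := y₀)
    (P := fun y n => 0 < fderiv ℝ (fderiv ℝ h) y (normalIncl L n) (normalIncl L (reflect P N n)))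
    (by
      intro n hn
      have hn0 : n ≠ 0 := by
        rintro rfl
        simp at hn
      have hc' : ContinuousAt (fun v : E × (P × N) => fderiv ℝ (fderiv ℝ h) v.1
          (normalIncl L v.2) (normalIncl L (reflect P N v.2))) (y₀, n) := by
        have : ContinuousAt (fun v : E × (P × N) => fderiv ℝ (fderiv ℝ h) v.1) (y₀, n) :=
          ContinuousAt.comp (f := Prod.fst) hc continuousAt_fst
        fun_prop
      exact hc'.eventually (lt_mem_nhds (hpos n hn0)))
  filter_upwards [key] with y hy n hn
  have hn0 : 0 < ‖n‖ := norm_pos_iff.2 hn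
  have := hy (‖n‖⁻¹ • n) (by simp [norm_smul, hn0.ne'])
  simp only [map_smul, smul_apply, smul_eq_mul] at this
  have h2 : 0 < ‖n‖⁻¹ := inv_pos.2 hn0
  exact (mul_pos_iff_of_pos_left h2).1 ((mul_pos_iff_of_pos_left h2).1 this)

/-- The critical points of `h` in the normal directions form the graph of a `C¹` map `γ`. -/
theorem exists_criticalGraph [FiniteDimensional ℝ Z] [FiniteDimensional ℝ P]
    [FiniteDimensional ℝ N] (hh : ContDiffAt ℝ 2 h y₀) (h0 : fderiv ℝ h y₀ = 0)
    (hpos : ∀ n : P × N, n ≠ 0 →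
      0 < fderiv ℝ (fderiv ℝ h) y₀ (normalIncl L n) (normalIncl L (reflect P N n))) :
    ∃ γ : Z → P × N, γ 0 = 0 ∧ ContDiffAt ℝ 1 γ 0 ∧
      ∀ᶠ z in 𝓝 0, ∀ n, fderiv ℝ h (y₀ + L (z, γ z)) (normalIncl L n) = 0 := by
  let G : Z × (P × N) → (P × N →L[ℝ] ℝ) :=
    fun v => (fderiv ℝ h (y₀ + L v)).comp (normalIncl L)
  have hL : ContDiff ℝ 1 fun v : Z × (P × N) => y₀ + L v := by fun_prop
  have hf : ContDiffAt ℝ 1 (fderiv ℝ h) (y₀ + L 0) := by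
    simpa using hh.fderiv_right (m := 1) (by norm_num)
  have hG : ContDiffAt ℝ 1 G 0 := (hf.comp 0 hL.contDiffAt).clm_comp contDiffAt_const
  have hG0 : G 0 = 0 := by simp [G, h0]
  have hG' : ∀ v, fderiv ℝ G 0 v = (fderiv ℝ (fderiv ℝ h) y₀ (L v)).comp (normalIncl L) := by
    intro v
    have h1 : HasFDerivAt (fun v : Z × (P × N) => y₀ + L v)
        (L : (Z × P × N) →L[ℝ] E) 0 := L.hasFDerivAt.const_add y₀
    have h2 : HasFDerivAt (fderiv ℝ h) (fderiv ℝ (fderiv ℝ h) y₀) (y₀ + L 0) := by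
      have := (hf.differentiableAt (by norm_num)).hasFDerivAt
      simpa using this
    have h3 := ((ContinuousLinearMap.compL ℝ (P × N) E ℝ).flip
      (normalIncl L)).hasFDerivAt.comp (0 : Z × (P × N)) (h2.comp (0 : Z × (P × N)) h1)
    rw [HasFDerivAt.fderiv (f := G) h3]
    rfl
  have hinj : Function.Injective (fderiv ℝ G 0 ∘L .inr ℝ Z (P × N)) := by
    refine (injective_iff_map_eq_zero _).2 fun n hn => ?_
    by_contra hne
    refine (hpos n hne).ne' ?_
    rw [ContinuousLinearMap.comp_apply, hG'] at hn
    exact DFunLike.congr_fun hn (reflect P N n)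
  have hfin : Module.finrank ℝ (P × N) = Module.finrank ℝ (P × N →L[ℝ] ℝ) := by
    rw [← (LinearMap.toContinuousLinearMap (𝕜 := ℝ) (E := P × N) (F' := ℝ)).finrank_eq]
    exact (Subspace.dual_finrank_eq (K := ℝ) (V := P × N)).symm
  have hinv : (fderiv ℝ G 0 ∘L .inr ℝ Z (P × N)).IsInvertible := by
    refine ⟨(LinearEquiv.ofInjectiveOfFinrankEq (fderiv ℝ G 0 ∘L .inr ℝ Z (P × N)).toLinearMap
      hinj hfin).toContinuousLinearEquiv, ?_⟩
    refine ContinuousLinearMap.ext fun n => ?_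
    rfl
  refine ⟨hG.implicitFunction one_ne_zero hinv, hG.implicitFunction_apply_self _ _,
    hG.contDiffAt_implicitFunction _ _, ?_⟩
  filter_upwards [hG.eventually_apply_implicitFunction one_ne_zero hinv] with z hz n
  rw [hG0] at hz
  exact DFunLike.congr_fun hz n

/-- Off the critical set, the function increases in the direction of the reflected displacement,
which is the direction of the hyperbola `ρ ↦ (ρ p, ρ⁻¹ q)`. -/
theorem transversal_gradient_pos {y : E} {n : P × N}
    (hy : ∀ t ∈ Icc (0 : ℝ) 1, ContDiffAt ℝ 2 h (y + t • normalIncl L n) ∧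
      0 < fderiv ℝ (fderiv ℝ h) (y + t • normalIncl L n) (normalIncl L n)
        (normalIncl L (reflect P N n)))
    (hcrit : fderiv ℝ h y = 0) :
    0 < fderiv ℝ h (y + normalIncl L n) (normalIncl L (reflect P N n)) := by
  set v := normalIncl L n
  set w := normalIncl L (reflect P N n)
  let g : ℝ → ℝ := fun t => fderiv ℝ h (y + t • v) w
  have hg : ∀ t ∈ Icc (0 : ℝ) 1, HasDerivAt g (fderiv ℝ (fderiv ℝ h) (y + t • v) v w) t := by
    intro t ht
    have e1 : HasFDerivAt (fderiv ℝ h) (fderiv ℝ (fderiv ℝ h) (y + t • v)) (y + t • v) :=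
      (((hy t ht).1.fderiv_right (m := 1) (by norm_num)).differentiableAt
        (by norm_num)).hasFDerivAt
    have e2 : HasDerivAt (fun t : ℝ => y + t • v) v t := by
      simpa using ((hasDerivAt_id t).smul_const v).const_add y
    exact ((ContinuousLinearMap.apply ℝ ℝ w).hasFDerivAt.comp_hasDerivAt t
      (e1.comp_hasDerivAt t e2))
  have hmono : StrictMonoOn g (Icc 0 1) := by
    refine strictMonoOn_of_deriv_pos (convex_Icc 0 1)
      (fun t ht => (hg t ht).continuousAt.continuousWithinAt) fun t ht => ?_
    have ht := interior_subset ht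
    rw [(hg t ht).deriv]
    exact (hy t ht).2
  have := hmono (left_mem_Icc.2 zero_le_one) (right_mem_Icc.2 zero_le_one) zero_lt_one
  simpa [g, hcrit] using this

theorem lt_along_hyperbola {y : E} {p : P} {q : N} {ρ : ℝ} (hρ : 1 < ρ)
    (hy : ∀ s ∈ Icc 1 ρ, DifferentiableAt ℝ h (y + normalIncl L (s • p, s⁻¹ • q)) ∧
      0 < fderiv ℝ h (y + normalIncl L (s • p, s⁻¹ • q))
        (normalIncl L (reflect P N (s • p, s⁻¹ • q)))) :
    h (y + normalIncl L (p, q)) < h (y + normalIncl L (ρ • p, ρ⁻¹ • q)) := by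
  let g : ℝ → ℝ := fun s => h (y + normalIncl L (s • p, s⁻¹ • q))
  have hg : ∀ s ∈ Icc 1 ρ, HasDerivAt g (s⁻¹ * fderiv ℝ h (y + normalIncl L (s • p, s⁻¹ • q))
      (normalIncl L (reflect P N (s • p, s⁻¹ • q)))) s := by
    intro s hs
    have hs0 : 0 < s := one_pos.trans_le hs.1
    have e1 := (hy s hs).1.hasFDerivAt
    have e2 : HasDerivAt (fun s : ℝ => y + normalIncl L (s • p, s⁻¹ • q))
        (normalIncl L (p, -(s ^ 2)⁻¹ • q)) s := by
      have e3 : HasDerivAt (fun s : ℝ => (s • p, s⁻¹ • q)) (p, -(s ^ 2)⁻¹ • q) s := by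
        have := ((hasDerivAt_id s).smul_const p).prodMk
          ((hasDerivAt_inv hs0.ne').smul_const q)
        simpa using this
      exact ((normalIncl L).hasFDerivAt.comp_hasDerivAt s e3).const_add _
    have e5 : normalIncl L (p, -(s ^ 2)⁻¹ • q) =
        s⁻¹ • normalIncl L (reflect P N (s • p, s⁻¹ • q)) := by
      rw [← map_smul, reflect_apply, Prod.smul_mk, inv_smul_smul₀ hs0.ne', smul_neg,
        smul_smul, ← mul_inv, ← sq, neg_smul]
    have := e1.comp_hasDerivAt s e2
    rw [e5, map_smul] at this
    exact this
  have hmono : StrictMonoOn g (Icc 1 ρ) := by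
    refine strictMonoOn_of_deriv_pos (convex_Icc 1 ρ)
      (fun t ht => (hg t ht).continuousAt.continuousWithinAt) fun s hs => ?_
    have hs := interior_subset hs
    rw [(hg s hs).deriv]
    exact mul_pos (inv_pos.2 (one_pos.trans_le hs.1)) (hy s hs).2
  have := hmono (left_mem_Icc.2 hρ.le) (right_mem_Icc.2 hρ.le) hρ
  simpa only [g, one_smul, inv_one] using this

/-- **Morse–Bott critical points are tame** if the index and coindex are different from one.
Transversally to its critical manifold the function increases along the hyperbolas
`ρ ↦ (ρ p, ρ⁻¹ q)`. -/
theorem tameAt_of_morseBott [FiniteDimensional ℝ Z] [FiniteDimensional ℝ P]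
    [FiniteDimensional ℝ N] (hh : ContDiffAt ℝ 2 h y₀)
    (h0 : fderiv ℝ h y₀ = 0)
    (hP : ∀ p : P, p ≠ 0 → 0 < fderiv ℝ (fderiv ℝ h) y₀ (L (0, p, 0)) (L (0, p, 0)))
    (hN : ∀ q : N, q ≠ 0 → fderiv ℝ (fderiv ℝ h) y₀ (L (0, 0, q)) (L (0, 0, q)) < 0)
    (hcrit : ∀ᶠ y in 𝓝 y₀, (∀ n, fderiv ℝ h y (normalIncl L n) = 0) → fderiv ℝ h y = 0)
    (hP1 : IsPreconnected (Metric.sphere (0 : P) 1))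
    (hN1 : IsPreconnected (Metric.sphere (0 : N) 1)) : TameAt h y₀ := by
  have hsymm : ∀ u v, fderiv ℝ (fderiv ℝ h) y₀ u v = fderiv ℝ (fderiv ℝ h) y₀ v u :=
    fun u v => (hh.isSymmSndFDerivAt (by simp)) u v
  have hpos₀ : ∀ n : P × N, n ≠ 0 →
      0 < fderiv ℝ (fderiv ℝ h) y₀ (normalIncl L n) (normalIncl L (reflect P N n)) :=
    fun n hn => hessian_reflect_pos _ hsymm hP hN hn
  obtain ⟨γ, hγ0, hγ, hγcrit⟩ := exists_criticalGraph hh h0 hpos₀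
  let β : Z → E := fun z => y₀ + L (z, γ z)
  let θ : Z × P × N → E := fun x => y₀ + L (x.1, γ x.1 + x.2)
  have hθβ : ∀ x, θ x = β x.1 + normalIncl L x.2 := by
    intro x
    simp only [θ, β]
    rw [normalIncl_apply, add_assoc, ← map_add]
    simp
  have hθ0 : θ 0 = y₀ := by
    simp [θ, hγ0]
  have hθcont : ∀ x : Z × P × N, ContinuousAt γ x.1 → ContinuousAt θ x := by
    intro x hx
    have : ContinuousAt (fun x : Z × P × N => γ x.1) x :=
      ContinuousAt.comp (f := Prod.fst) hx continuousAt_fst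
    fun_prop
  have hgood : ∀ᶠ y in 𝓝 y₀, (∀ n : P × N, n ≠ 0 →
      0 < fderiv ℝ (fderiv ℝ h) y (normalIncl L n) (normalIncl L (reflect P N n))) ∧
      ContDiffAt ℝ 2 h y ∧ ((∀ n, fderiv ℝ h y (normalIncl L n) = 0) → fderiv ℝ h y = 0) :=
    (eventually_hessian_reflect_pos hh hpos₀).and ((hh.eventually (by simp)).and hcrit)
  have hθgood := (hθcont 0 hγ.continuousAt).eventually (by rw [hθ0]; exact hgood)
  have hγd : ∀ᶠ z in 𝓝 (0 : Z), DifferentiableAt ℝ γ z :=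
    (hγ.eventually (by simp)).mono fun z hz => hz.differentiableAt (by norm_num)
  have hZ : ∀ᶠ x : Z × P × N in 𝓝 0, (∀ n, fderiv ℝ h (β x.1) (normalIncl L n) = 0) ∧
      DifferentiableAt ℝ γ x.1 :=
    (continuous_fst.tendsto (0 : Z × P × N)).eventually (hγcrit.and hγd)
  obtain ⟨r, hr, hball⟩ := Metric.nhds_basis_closedBall.eventually_iff.1 (hθgood.and hZ)
  replace hball : ∀ x : Z × P × N, ‖x‖ ≤ r → _ := fun x hx => hball (x := x) (by simpa using hx)
  simp only [hθβ] at hball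
  have haxis : ∀ z : Z, ‖z‖ ≤ r → ‖(z, (0 : P × N))‖ ≤ r := fun z hz =>
    norm_prod_le_iff₃.2 ⟨hz, by simpa using hr.le, by simpa using hr.le⟩
  have hβ : ∀ z : Z, ‖z‖ ≤ r → ContDiffAt ℝ 2 h (β z) ∧ fderiv ℝ h (β z) = 0 ∧
      DifferentiableAt ℝ γ z := by
    intro z hz
    obtain ⟨⟨-, h1, h2⟩, h3, h4⟩ := hball _ (haxis z hz)
    simp only [map_zero, add_zero] at h1 h2
    exact ⟨h1, h2 h3, h4⟩
  -- `h` is constant on the critical manifold.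
  have hconst : ∀ z : Z, ‖z‖ ≤ r → h (β z) = h y₀ := by
    intro z hz
    have hd : ∀ z ∈ Metric.closedBall (0 : Z) r,
        HasFDerivWithinAt (h ∘ β) (0 : Z →L[ℝ] ℝ) (Metric.closedBall (0 : Z) r) z := by
      intro z hz
      obtain ⟨h1, h2, h3⟩ := hβ z (by simpa using hz)
      have e1 : HasFDerivAt h (fderiv ℝ h (β z)) (β z) :=
        (h1.differentiableAt (by norm_num)).hasFDerivAt
      have e2 : DifferentiableAt ℝ β z := by fun_prop
      have := e1.comp z e2.hasFDerivAt
      rw [h2, ContinuousLinearMap.zero_comp] at this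
      exact this.hasFDerivWithinAt
    have := (convex_closedBall (0 : Z) r).norm_image_sub_le_of_norm_hasFDerivWithin_le
      (C := 0) hd (by simp) (Metric.mem_closedBall_self hr.le) (by simpa using hz)
    rw [zero_mul, norm_le_zero_iff, sub_eq_zero] at this
    have hβ0 : β 0 = y₀ := by
      change y₀ + L (0, γ 0) = y₀
      rw [hγ0]
      change y₀ + L 0 = y₀
      simp
    rwa [Function.comp_apply, Function.comp_apply, hβ0] at this
  have hgrad : ∀ (z : Z) (n : P × N), ‖(z, n)‖ ≤ r → n ≠ 0 →
      0 < fderiv ℝ h (β z + normalIncl L n) (normalIncl L (reflect P N n)) := by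
    intro z n hzn hn
    have hz : ‖z‖ ≤ r := (norm_fst_le (z, n)).trans hzn
    refine transversal_gradient_pos (fun t ht => ?_) (hβ z hz).2.1
    have hin : ‖(z, t • n)‖ ≤ r := by
      refine max_le hz ?_
      dsimp only
      rw [norm_smul, Real.norm_of_nonneg ht.1]
      exact (mul_le_of_le_one_left (norm_nonneg _) ht.2).trans ((norm_snd_le (z, n)).trans hzn)
    obtain ⟨⟨h1, h2, -⟩, -⟩ := hball _ hin
    rw [map_smul] at h1 h2
    exact ⟨h2, h1 n hn⟩
  have hmono : ∀ (z : Z) (p : P) (q : N) (ρ : ℝ), 1 < ρ → ‖z‖ ≤ r → ‖ρ • p‖ ≤ r → ‖q‖ ≤ r →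
      (p ≠ 0 ∨ q ≠ 0) →
      h (β z + normalIncl L (p, q)) < h (β z + normalIncl L (ρ • p, ρ⁻¹ • q)) := by
    intro z p q ρ hρ hz hp hq hpq
    have hρ0 : 0 < ρ := one_pos.trans hρ
    refine lt_along_hyperbola hρ fun s hs => ?_
    have hs0 : 0 < s := one_pos.trans_le hs.1
    have hin : ‖(z, s • p, s⁻¹ • q)‖ ≤ r := by
      refine norm_prod_le_iff₃.2 ⟨hz, ?_, ?_⟩
      · rw [norm_smul, Real.norm_of_nonneg hρ0.le] at hp
        rw [norm_smul, Real.norm_of_nonneg hs0.le]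
        exact (mul_le_mul_of_nonneg_right hs.2 (norm_nonneg _)).trans hp
      · rw [norm_smul, Real.norm_of_nonneg (inv_nonneg.2 hs0.le)]
        exact (mul_le_of_le_one_left (norm_nonneg _) (inv_le_one_of_one_le₀ hs.1)).trans hq
    refine ⟨(hball _ hin).1.2.1.differentiableAt (by norm_num), hgrad z _ hin fun hzero => ?_⟩
    rw [Prod.mk_eq_zero] at hzero
    rcases hpq with hp0 | hq0
    · exact smul_ne_zero hs0.ne' hp0 hzero.1
    · exact smul_ne_zero (inv_ne_zero hs0.ne') hq0 hzero.2
  have hsaddle : IsSaddle (h ∘ θ) r (h y₀) :=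
    { pos := hr
      cont := by
        intro x hx
        obtain ⟨⟨-, h1, -⟩, -, h2⟩ := hball x hx
        rw [← hθβ] at h1
        exact (h1.continuousAt.comp (hθcont x h2.continuousAt)).continuousWithinAt
      axis := fun z hz => by
        have : θ (z, 0, 0) = β z := by
          rw [hθβ]
          change β z + normalIncl L 0 = β z
          rw [map_zero, add_zero]
        rw [Function.comp_apply, this, hconst z hz]
      mono := by
        intro z p q ρ hρ hz hp hq hpq
        rw [Function.comp_apply, Function.comp_apply, hθβ, hθβ]
        exact hmono z p q ρ hρ hz hp hq hpq }
  have hγc : ContinuousOn γ (Metric.ball 0 r) := fun z hz =>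
    (hβ z (by simpa using (Metric.mem_ball.1 hz).le)).2.2.continuousAt.continuousWithinAt
  have := TameAt.of_comp (shear L y₀ hγc) (g := h) (x := 0)
    (show (0 : Z) ∈ Metric.ball 0 r by simpa using hr) (hsaddle.tameAt hP1 hN1)
  have e : shear L y₀ hγc 0 = y₀ := hθ0
  rwa [e] at this

end MorseBott

/-! ### Quadratic forms invariant under a loop, and periodic local flows -/

section Splitting

variable {E : Type*} [NormedAddCommGroup E] [NormedSpace ℝ E] {ι : Type*} [Fintype ι]

/-- The unit sphere of a space is connected if the dimension is not one; in dimension zero it is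
empty. -/
theorem isPreconnected_sphere_of_not_existsUnique {p : ι → Prop} (hp : ¬ ∃! i, p i)
    [Fintype {i // p i}] :
    IsPreconnected (Metric.sphere (0 : {i // p i} → ℝ) 1) := by
  by_cases h : ∃ i, p i
  · refine isPreconnected_sphere ?_ 0 1
    obtain ⟨i, hi⟩ := h
    have : ∃ j, p j ∧ j ≠ i := by
      by_contra! hj
      exact hp ⟨i, hi, hj⟩
    obtain ⟨j, hj, hji⟩ := this
    rw [rank_fun']
    have : Nontrivial {i // p i} :=
      ⟨⟨i, hi⟩, ⟨j, hj⟩, fun h => hji (congrArg Subtype.val h).symm⟩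
    exact_mod_cast Fintype.one_lt_card (α := {i // p i})
  · have : IsEmpty {i // p i} := ⟨fun i => h ⟨i, i.2⟩⟩
    convert isPreconnected_empty
    ext x
    simp [Subsingleton.elim x 0]

variable (v : Module.Basis ι ℝ E) (lam : ι → ℝ)

open Classical in
/-- The splitting of `E` according to the signs of numbers `lam i` attached to the vectors of
a basis. -/
noncomputable def signSplitting [FiniteDimensional ℝ E] :
    (({i // lam i = 0} → ℝ) × ({i // 0 < lam i} → ℝ) × ({i // lam i < 0} → ℝ)) ≃L[ℝ] E :=
  LinearEquiv.toContinuousLinearEquiv <| LinearEquiv.trans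
    { toFun := fun x i => if h : lam i = 0 then x.1 ⟨i, h⟩ else
        if h' : 0 < lam i then x.2.1 ⟨i, h'⟩ else
          x.2.2 ⟨i, lt_of_le_of_ne (not_lt.1 h') h⟩
      map_add' := fun x y => by
        ext i
        dsimp
        split_ifs <;> rfl
      map_smul' := fun c x => by
        ext i
        dsimp
        split_ifs <;> rfl
      invFun := fun c => (fun i => c i, fun i => c i, fun i => c i)
      left_inv := fun x => by
        refine Prod.ext (funext fun i => ?_) (Prod.ext (funext fun i => ?_) (funext fun i => ?_))
        · simp [i.2]
        · simp [i.2, i.2.ne']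
        · simp [i.2.ne, i.2.not_gt]
      right_inv := fun c => by
        ext i
        dsimp
        split_ifs <;> rfl } v.equivFun.symm

theorem equivFun_signSplitting [FiniteDimensional ℝ E] (p : {i // 0 < lam i} → ℝ)
    (q : {i // lam i < 0} → ℝ) (i : ι) :
    (0 < lam i → v.equivFun (signSplitting v lam (0, p, q)) i =
      if h : 0 < lam i then p ⟨i, h⟩ else 0) ∧
    (lam i < 0 → v.equivFun (signSplitting v lam (0, p, q)) i =
      if h : lam i < 0 then q ⟨i, h⟩ else 0) := by
  classical
  have key : v.equivFun (signSplitting v lam (0, p, q)) i = if h : lam i = 0 then 0 else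
        if h' : 0 < lam i then p ⟨i, h'⟩ else q ⟨i, lt_of_le_of_ne (not_lt.1 h') h⟩ :=
    congrFun (v.equivFun.apply_symm_apply _) i
  rw [key]
  constructor <;> intro h
  · simp [h, h.ne']
  · simp [h, h.ne, h.not_gt]

theorem equivFun_signSplitting_axis [FiniteDimensional ℝ E] (z : {i // lam i = 0} → ℝ) (i : ι)
    (hi : lam i ≠ 0) : v.equivFun (signSplitting v lam (z, 0, 0)) i = 0 := by
  classical
  have key : v.equivFun (signSplitting v lam (z, 0, 0)) i = if h : lam i = 0 then z ⟨i, h⟩ else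
        if h' : 0 < lam i then 0 else 0 :=
    congrFun (v.equivFun.apply_symm_apply _) i
  rw [key, dif_neg hi]
  simp

variable {v} {Q : E →L[ℝ] E →L[ℝ] ℝ}

theorem form_apply_eq_sum (hv : ∀ i j, i ≠ j → Q (v i) (v j) = 0) (x y : E) :
    Q x y = ∑ i, Q (v i) (v i) * (v.equivFun x i * v.equivFun y i) := by
  conv_lhs => rw [← v.sum_equivFun x, ← v.sum_equivFun y]
  simp only [map_sum, map_smul, sum_apply, smul_apply, smul_eq_mul]
  refine Finset.sum_congr rfl fun i _ => ?_
  rw [Finset.sum_eq_single i]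
  · ring
  · intro j _ hji
    rw [hv j i hji]
    ring
  · simp

theorem form_signSplitting_pos [FiniteDimensional ℝ E] (hv : ∀ i j, i ≠ j → Q (v i) (v j) = 0)
    {p : {i // 0 < Q (v i) (v i)} → ℝ} (hp : p ≠ 0) :
    0 < Q (signSplitting v (fun i => Q (v i) (v i)) (0, p, 0))
      (signSplitting v (fun i => Q (v i) (v i)) (0, p, 0)) := by
  rw [form_apply_eq_sum hv]
  obtain ⟨i, hi⟩ := Function.ne_iff.1 hp
  have key := equivFun_signSplitting v (fun i => Q (v i) (v i)) p 0
  refine Finset.sum_pos' (fun j _ => ?_) ⟨i, Finset.mem_univ _, ?_⟩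
  · rcases lt_trichotomy (Q (v j) (v j)) 0 with h | h | h
    · rw [(key j).2 h]
      simp
    · simp [h]
    · exact mul_nonneg h.le (mul_self_nonneg _)
  · rw [(key i).1 i.2, dif_pos i.2]
    exact mul_pos i.2 (mul_self_pos.2 hi)

theorem form_signSplitting_neg [FiniteDimensional ℝ E] (hv : ∀ i j, i ≠ j → Q (v i) (v j) = 0)
    {q : {i // Q (v i) (v i) < 0} → ℝ} (hq : q ≠ 0) :
    Q (signSplitting v (fun i => Q (v i) (v i)) (0, 0, q))
      (signSplitting v (fun i => Q (v i) (v i)) (0, 0, q)) < 0 := by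
  rw [form_apply_eq_sum hv]
  obtain ⟨i, hi⟩ := Function.ne_iff.1 hq
  have key := equivFun_signSplitting v (fun i => Q (v i) (v i)) 0 q
  refine Finset.sum_neg' (fun j _ => ?_) ⟨i, Finset.mem_univ _, ?_⟩
  · rcases lt_trichotomy (Q (v j) (v j)) 0 with h | h | h
    · exact mul_nonpos_of_nonpos_of_nonneg h.le (mul_self_nonneg _)
    · simp [h]
    · rw [(key j).1 h]
      simp
  · rw [(key i).2 i.2, dif_pos i.2]
    exact mul_neg_of_neg_of_pos i.2 (mul_self_pos.2 hi)

theorem form_signSplitting_axis [FiniteDimensional ℝ E] (hv : ∀ i j, i ≠ j → Q (v i) (v j) = 0)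
    (z : {i // Q (v i) (v i) = 0} → ℝ) (y : E) :
    Q (signSplitting v (fun i => Q (v i) (v i)) (z, 0, 0)) y = 0 := by
  rw [form_apply_eq_sum hv]
  refine Finset.sum_eq_zero fun i _ => ?_
  by_cases h : Q (v i) (v i) = 0
  · rw [h, zero_mul]
  · rw [equivFun_signSplitting_axis v (fun i => Q (v i) (v i)) z i h]
    simp

/-- If a form is invariant under a loop `B` of linear maps whose mean is orthogonal to
everything, then its positive index is not one: some `B t u` is orthogonal to a positive vector
`u`, and `u`, `B t u` span a positive plane. -/
theorem not_existsUnique_form_pos (hv : ∀ i j, i ≠ j → Q (v i) (v j) = 0) {T : ℝ} (hT : 0 < T)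
    {B : ℝ → E →L[ℝ] E} (hB0 : B 0 = 1) (hBc : ContinuousOn B (Icc 0 T))
    (hBQ : ∀ t ∈ Icc 0 T, ∀ u w, Q (B t u) (B t w) = Q u w)
    (hmean : ∀ u, ∫ t in (0 : ℝ)..T, Q u (B t u) = 0) : ¬ ∃! i, 0 < Q (v i) (v i) := by
  rintro ⟨i, hi, huniq⟩
  set u := v i with hu
  have hc : ContinuousOn (fun t => Q u (B t u)) (Icc 0 T) := by fun_prop
  have hzero : ∃ t ∈ Icc 0 T, Q u (B t u) = 0 := by
    by_contra! hne
    have hpos : ∀ t ∈ Icc 0 T, 0 < Q u (B t u) := by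
      intro t ht
      by_contra! hle
      have h0 : 0 < Q u (B 0 u) := by rw [hB0]; exact hi
      obtain ⟨s, hs, hs0⟩ := intermediate_value_Icc' ht.1
        (hc.mono (Icc_subset_Icc_right ht.2)) ⟨hle, h0.le⟩
      exact hne s ⟨hs.1, hs.2.trans ht.2⟩ hs0
    refine (intervalIntegral.intervalIntegral_pos_of_pos_on ?_ (fun t ht =>
      hpos t (Ioo_subset_Icc_self ht)) hT).ne' (hmean u)
    exact (hc.mono (by rw [uIcc_of_le hT.le])).intervalIntegrable
  obtain ⟨t, ht, h0⟩ := hzero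
  have hcoord : v.equivFun (B t u) i = 0 := by
    rw [form_apply_eq_sum hv, Finset.sum_eq_single i] at h0
    · have : Q (v i) (v i) ≠ 0 := hi.ne'
      simpa [hu, this] using h0
    · intro j _ hji
      simp [hu, Finsupp.single_eq_of_ne hji]
    · simp
  have hle : Q (B t u) (B t u) ≤ 0 := by
    rw [form_apply_eq_sum hv]
    refine Finset.sum_nonpos fun j _ => ?_
    by_cases hji : j = i
    · rw [hji, hcoord]
      simp
    · have : Q (v j) (v j) ≤ 0 := not_lt.1 fun h => hji (huniq j h)
      exact mul_nonpos_of_nonpos_of_nonneg this (mul_self_nonneg _)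
  rw [hBQ t ht] at hle
  exact hle.not_gt hi

theorem not_existsUnique_form_neg (hv : ∀ i j, i ≠ j → Q (v i) (v j) = 0) {T : ℝ} (hT : 0 < T)
    {B : ℝ → E →L[ℝ] E} (hB0 : B 0 = 1) (hBc : ContinuousOn B (Icc 0 T))
    (hBQ : ∀ t ∈ Icc 0 T, ∀ u w, Q (B t u) (B t w) = Q u w)
    (hmean : ∀ u, ∫ t in (0 : ℝ)..T, Q u (B t u) = 0) : ¬ ∃! i, Q (v i) (v i) < 0 := by
  have := not_existsUnique_form_pos (Q := -Q) (v := v) (by simpa using hv) hT hB0 hBc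
    (by simpa using hBQ) (by simpa using hmean)
  simpa using this

end Splitting

section Flow

variable {E : Type*} [NormedAddCommGroup E] [NormedSpace ℝ E]

/-- The derivative of a product `L y (X y)` at a zero of `X`; no differentiability of `L` is
needed. -/
theorem hasFDerivAt_clm_apply_of_zero {F G : Type*} [NormedAddCommGroup F] [NormedSpace ℝ F]
    [NormedAddCommGroup G] [NormedSpace ℝ G] {L : E → F →L[ℝ] G} {X : E → F} {A : E →L[ℝ] F}
    {y₀ : E} (hL : ContinuousAt L y₀) (hX : HasFDerivAt X A y₀) (h0 : X y₀ = 0) :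
    HasFDerivAt (fun y => L y (X y)) ((L y₀).comp A) y₀ := by
  have h1 : HasFDerivAt (fun y => L y₀ (X y)) ((L y₀).comp A) y₀ :=
    (L y₀).hasFDerivAt.comp y₀ hX
  have h2 : HasFDerivAt (fun y => (L y - L y₀) (X y)) (0 : E →L[ℝ] G) y₀ := by
    rw [hasFDerivAt_iff_isLittleO]
    have hXO : X =O[𝓝 y₀] fun y => y - y₀ := by
      simpa [h0] using hX.isBigO_sub
    have hLo : (fun y => L y - L y₀) =o[𝓝 y₀] fun _ => (1 : ℝ) := by
      rw [Asymptotics.isLittleO_one_iff]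
      simpa using (hL.tendsto.sub_const (L y₀))
    have hbound : (fun y => (L y - L y₀) (X y)) =O[𝓝 y₀] fun y => ‖L y - L y₀‖ * ‖X y‖ :=
      Asymptotics.isBigO_of_le _ fun y => by
        simpa using (L y - L y₀).le_opNorm (X y)
    have := hbound.trans_isLittleO (hLo.norm_left.mul_isBigO hXO.norm_norm)
    simp only [one_mul] at this
    simpa [h0] using this.norm_right
  convert! h1.add h2 using 1
  · ext y
    simp
  · simp

/-- `F` is a smooth local flow `(t, y) ↦ F (t, y)` with domain `O`. -/
structure IsLocalFlow (F : ℝ × E → E) (O : Set (ℝ × E)) : Prop where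
  isOpen : IsOpen O
  smooth : ContDiffOn ℝ ∞ F O
  zero : ∀ y, (0, y) ∈ O → F (0, y) = y
  comp : ∀ s t y, (t, y) ∈ O → F (s + t, y) = F (s, F (t, y))

/-- A local flow near the rest point `y₀`, all of whose orbits close up after the time `T`. -/
structure IsPeriodicFlowAt (F : ℝ × E → E) (O : Set (ℝ × E)) (y₀ : E) (T : ℝ) : Prop
    extends IsLocalFlow F O where
  period_pos : 0 < T
  mem : ∀ t, (t, y₀) ∈ O
  fixed : ∀ t, F (t, y₀) = y₀
  period : ∀ y, (0, y) ∈ O → F (T, y) = y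

/-- The vector field generating a flow. -/
noncomputable def flowField (F : ℝ × E → E) (y : E) : E := fderiv ℝ F (0, y) (1, 0)

/-- The derivative of the time-`t` map of a flow. -/
noncomputable def flowDeriv (F : ℝ × E → E) (t : ℝ) (y : E) : E →L[ℝ] E :=
  (fderiv ℝ F (t, y)).comp (ContinuousLinearMap.inr ℝ ℝ E)

variable {F : ℝ × E → E} {O : Set (ℝ × E)} {y₀ : E} {T : ℝ}

theorem IsLocalFlow.hasFDerivAt (h : IsLocalFlow F O) {p : ℝ × E} (hp : p ∈ O) :
    HasFDerivAt F (fderiv ℝ F p) p :=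
  ((h.smooth.contDiffAt (h.isOpen.mem_nhds hp)).differentiableAt (by simp)).hasFDerivAt

theorem IsLocalFlow.hasDerivAt_time (h : IsLocalFlow F O) {t : ℝ} {y : E}
    (hp : (t, y) ∈ O) : HasDerivAt (fun s => F (s, y)) (fderiv ℝ F (t, y) (1, 0)) t :=
  (h.hasFDerivAt hp).comp_hasDerivAt t ((hasDerivAt_id t).prodMk (hasDerivAt_const t y))

theorem IsLocalFlow.hasFDerivAt_space (h : IsLocalFlow F O) {t : ℝ} {y : E}
    (hp : (t, y) ∈ O) : HasFDerivAt (fun z => F (t, z)) (flowDeriv F t y) y :=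
  (h.hasFDerivAt hp).comp y (hasFDerivAt_prodMk_right t y)

theorem IsLocalFlow.fderiv_time (h : IsLocalFlow F O) {t : ℝ} {y : E}
    (hp : (t, y) ∈ O) (h0 : (0, y) ∈ O) :
    fderiv ℝ F (t, y) (1, 0) = flowDeriv F t y (flowField F y) := by
  have h1 : HasDerivAt (fun s => F (t + s, y)) (fderiv ℝ F (t, y) (1, 0)) 0 := by
    have : HasDerivAt (fun s => F (s, y)) (fderiv ℝ F (t, y) (1, 0)) (t + 0) := by
      rw [add_zero]
      exact h.hasDerivAt_time hp
    exact this.comp_const_add t 0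
  have h2 : HasDerivAt (fun s => F (t, F (s, y))) (flowDeriv F t y (flowField F y)) 0 := by
    have e1 : HasFDerivAt (fun z => F (t, z)) (flowDeriv F t y) (F (0, y)) := by
      rw [h.zero y h0]
      exact h.hasFDerivAt_space hp
    exact HasFDerivAt.comp_hasDerivAt (l := fun z => F (t, z)) (0 : ℝ) e1 (h.hasDerivAt_time h0)
  have hev : ∀ᶠ s in 𝓝 (0 : ℝ), (s, y) ∈ O :=
    (Continuous.tendsto (f := fun s : ℝ => (s, y)) (by fun_prop) 0).eventually
      (h.isOpen.mem_nhds h0)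
  refine h1.unique (h2.congr_of_eventuallyEq ?_)
  filter_upwards [hev] with s hs using h.comp t s y hs

theorem IsLocalFlow.flowField_flow (h : IsLocalFlow F O) {t : ℝ} {y : E}
    (hp : (t, y) ∈ O) (h0 : (0, F (t, y)) ∈ O) :
    flowField F (F (t, y)) = fderiv ℝ F (t, y) (1, 0) := by
  have h1 : HasDerivAt (fun s => F (s + t, y)) (fderiv ℝ F (t, y) (1, 0)) 0 := by
    have : HasDerivAt (fun s => F (s, y)) (fderiv ℝ F (t, y) (1, 0)) (0 + t) := by
      rw [zero_add]
      exact h.hasDerivAt_time hp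
    exact this.comp_add_const 0 t
  have h2 : HasDerivAt (fun s => F (s, F (t, y))) (flowField F (F (t, y))) 0 :=
    h.hasDerivAt_time h0
  have : (fun s => F (s + t, y)) = fun s => F (s, F (t, y)) := by
    ext s
    exact h.comp s t y hp
  rw [this] at h1
  exact h2.unique h1

theorem IsPeriodicFlowAt.eventually_mem (h : IsPeriodicFlowAt F O y₀ T) :
    ∀ᶠ y in 𝓝 y₀, ∀ t ∈ Icc 0 T, (t, y) ∈ O := by
  refine isCompact_Icc.eventually_forall_of_forall_eventually (P := fun y t => (t, y) ∈ O)
    fun t _ => ?_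
  exact (continuous_swap.tendsto (y₀, t)).eventually (h.isOpen.mem_nhds (h.mem t))

theorem IsLocalFlow.continuousOn_flowDeriv (h : IsLocalFlow F O) :
    ContinuousOn (fun p : ℝ × E => flowDeriv F p.1 p.2) O := by
  have : ContinuousOn (fderiv ℝ F) O := h.smooth.continuousOn_fderiv_of_isOpen h.isOpen (by simp)
  exact this.clm_comp continuousOn_const

/-- The integral of the derivatives of the flow over the times in `[0, t]`. -/
noncomputable def flowMean (F : ℝ × E → E) (t : ℝ) (y : E) : E →L[ℝ] E :=
  ∫ s in (0 : ℝ)..t, flowDeriv F s y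

theorem IsPeriodicFlowAt.continuousOn_flowDeriv_time (h : IsPeriodicFlowAt F O y₀ T) {y : E}
    (hy : ∀ t ∈ Icc 0 T, (t, y) ∈ O) {t : ℝ} (ht : t ∈ Icc 0 T) :
    ContinuousOn (fun s => flowDeriv F s y) (uIcc 0 t) := by
  rw [uIcc_of_le ht.1]
  exact h.continuousOn_flowDeriv.comp (f := fun s => (s, y)) (by fun_prop)
    fun s hs => hy s ⟨hs.1, hs.2.trans ht.2⟩

/-- The displacement of `y` along the flow is the mean of the flow applied to the vector field at
`y`, as the velocity at time `s` is the image of the field at `y` under the derivative of the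
flow. -/
theorem IsPeriodicFlowAt.flow_sub [CompleteSpace E] (h : IsPeriodicFlowAt F O y₀ T) {y : E}
    (hy : ∀ t ∈ Icc 0 T, (t, y) ∈ O) {t : ℝ} (ht : t ∈ Icc 0 T) :
    F (t, y) - y = flowMean F t y (flowField F y) := by
  have h0 : (0, y) ∈ O := hy 0 ⟨le_rfl, h.period_pos.le⟩
  have hc := h.continuousOn_flowDeriv_time hy ht
  rw [flowMean, ContinuousLinearMap.intervalIntegral_apply hc.intervalIntegrable]
  have hsub : ∀ s ∈ uIcc 0 t, (s, y) ∈ O := by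
    rw [uIcc_of_le ht.1]
    exact fun s hs => hy s ⟨hs.1, hs.2.trans ht.2⟩
  rw [intervalIntegral.integral_eq_sub_of_hasDerivAt (f := fun s => F (s, y)), h.zero y h0]
  · intro s hs
    rw [← h.fderiv_time (hsub s hs) h0]
    exact h.hasDerivAt_time (hsub s hs)
  · exact (hc.clm_apply continuousOn_const).intervalIntegrable

theorem IsPeriodicFlowAt.continuousAt_flowMean (h : IsPeriodicFlowAt F O y₀ T) {t : ℝ}
    (ht : t ∈ Icc 0 T) : ContinuousAt (flowMean F t) y₀ := by
  rw [Metric.continuousAt_iff']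
  intro ε hε
  have hT := h.period_pos
  have hclose : ∀ᶠ y in 𝓝 y₀, ∀ s ∈ Icc 0 T,
      ‖flowDeriv F s y - flowDeriv F s y₀‖ < ε / (2 * T) := by
    refine isCompact_Icc.eventually_forall_of_forall_eventually
      (P := fun y s => ‖flowDeriv F s y - flowDeriv F s y₀‖ < ε / (2 * T)) fun s _ => ?_
    have hc : ContinuousAt (fun p : ℝ × E => flowDeriv F p.1 p.2) (s, y₀) :=
      h.continuousOn_flowDeriv.continuousAt (h.isOpen.mem_nhds (h.mem s))
    have h1 : ContinuousAt (fun p : E × ℝ => flowDeriv F p.2 p.1) (y₀, s) :=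
      ContinuousAt.comp (g := fun p : ℝ × E => flowDeriv F p.1 p.2)
        (f := fun p : E × ℝ => (p.2, p.1)) (x := (y₀, s)) hc
        (Continuous.continuousAt (by fun_prop))
    have h2 : ContinuousAt (fun p : E × ℝ => flowDeriv F p.2 y₀) (y₀, s) :=
      ContinuousAt.comp (g := fun p : ℝ × E => flowDeriv F p.1 p.2)
        (f := fun p : E × ℝ => (p.2, y₀)) (x := (y₀, s)) hc
        (Continuous.continuousAt (by fun_prop))
    have h3 := (h1.sub h2).norm
    refine h3.eventually (gt_mem_nhds ?_)
    have : 0 < ε / (2 * T) := by positivity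
    simpa using this
  filter_upwards [hclose, h.eventually_mem] with y hy hyO
  have i1 := (h.continuousOn_flowDeriv_time hyO ht).intervalIntegrable
    (μ := MeasureTheory.volume)
  have i2 := (h.continuousOn_flowDeriv_time (fun s _ => h.mem s) ht).intervalIntegrable
    (μ := MeasureTheory.volume)
  rw [dist_eq_norm, flowMean, flowMean, ← intervalIntegral.integral_sub i1 i2]
  calc ‖∫ s in (0 : ℝ)..t, (flowDeriv F s y - flowDeriv F s y₀)‖
      ≤ ε / (2 * T) * |t - 0| := by
        refine intervalIntegral.norm_integral_le_of_norm_le_const fun s hs => ?_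
        rw [uIoc_of_le ht.1] at hs
        exact (hy s ⟨hs.1.le, hs.2.trans ht.2⟩).le
    _ ≤ ε / (2 * T) * T := by
        rw [sub_zero, abs_of_nonneg ht.1]
        exact mul_le_mul_of_nonneg_left ht.2 (by positivity)
    _ = ε / 2 := by field_simp
    _ < ε := by linarith

end Flow

/-! ### Linearized flows and Hamiltonians at rest points -/

section LinearizedFlow

variable {E : Type*} [NormedAddCommGroup E] [NormedSpace ℝ E]
variable {F : ℝ × E → E} {O : Set (ℝ × E)} {y₀ : E} {T : ℝ}

theorem IsPeriodicFlowAt.flowField_self (h : IsPeriodicFlowAt F O y₀ T) : flowField F y₀ = 0 := by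
  have h1 := h.hasDerivAt_time (h.mem 0)
  have h2 : (fun s => F (s, y₀)) = fun _ => y₀ := funext h.fixed
  rw [h2] at h1
  exact h1.unique (hasDerivAt_const 0 y₀)

theorem IsPeriodicFlowAt.hasFDerivAt_flowField (h : IsPeriodicFlowAt F O y₀ T) :
    HasFDerivAt (flowField F) (fderiv ℝ (flowField F) y₀) y₀ := by
  refine DifferentiableAt.hasFDerivAt ?_
  have h1 : DifferentiableAt ℝ (fderiv ℝ F) (0, y₀) :=
    ((h.smooth.contDiffAt (h.isOpen.mem_nhds (h.mem 0))).fderiv_right (m := 1)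
      (WithTop.coe_le_coe.2 le_top)).differentiableAt (by simp)
  have h2 : DifferentiableAt ℝ (fun y : E => fderiv ℝ F (0, y)) y₀ :=
    DifferentiableAt.comp (g := fderiv ℝ F) (f := fun y : E => ((0 : ℝ), y)) y₀ h1
      (by fun_prop)
  exact h2.clm_apply (differentiableAt_const _)

theorem IsPeriodicFlowAt.flowDeriv_sub_one [CompleteSpace E] (h : IsPeriodicFlowAt F O y₀ T)
    {t : ℝ} (ht : t ∈ Icc 0 T) :
    flowDeriv F t y₀ - 1 = (flowMean F t y₀).comp (fderiv ℝ (flowField F) y₀) := by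
  have h1 : HasFDerivAt (fun y => F (t, y) - y) (flowDeriv F t y₀ - 1) y₀ :=
    (h.hasFDerivAt_space (h.mem t)).sub (hasFDerivAt_id y₀)
  have h2 := hasFDerivAt_clm_apply_of_zero (h.continuousAt_flowMean ht) h.hasFDerivAt_flowField
    h.flowField_self
  refine h1.unique (h2.congr_of_eventuallyEq ?_)
  filter_upwards [h.eventually_mem] with y hy using h.flow_sub hy ht

theorem IsPeriodicFlowAt.flowDeriv_zero [CompleteSpace E] (h : IsPeriodicFlowAt F O y₀ T) :
    flowDeriv F 0 y₀ = 1 := by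
  have := h.flowDeriv_sub_one ⟨le_rfl, h.period_pos.le⟩
  rw [← sub_eq_zero, this, flowMean]
  simp

/-- The linearized field commutes with the linearized flow. -/
theorem IsPeriodicFlowAt.comp_flowDeriv (h : IsPeriodicFlowAt F O y₀ T)
    {t : ℝ} (ht : t ∈ Icc 0 T) :
    (fderiv ℝ (flowField F) y₀).comp (flowDeriv F t y₀) =
      (flowDeriv F t y₀).comp (fderiv ℝ (flowField F) y₀) := by
  have hX : HasFDerivAt (flowField F) (fderiv ℝ (flowField F) y₀) (F (t, y₀)) := by
    rw [h.fixed]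
    exact h.hasFDerivAt_flowField
  have h1 : HasFDerivAt (fun y => flowField F (F (t, y)))
      ((fderiv ℝ (flowField F) y₀).comp (flowDeriv F t y₀)) y₀ :=
    HasFDerivAt.comp (g := flowField F) (f := fun y => F (t, y)) y₀ hX
      (h.hasFDerivAt_space (h.mem t))
  have hcont : ContinuousAt (fun y => flowDeriv F t y) y₀ :=
    ContinuousAt.comp (g := fun p : ℝ × E => flowDeriv F p.1 p.2) (f := fun y => (t, y))
      (h.continuousOn_flowDeriv.continuousAt (h.isOpen.mem_nhds (h.mem t)))
      (Continuous.continuousAt (by fun_prop))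
  have h2 := hasFDerivAt_clm_apply_of_zero hcont h.hasFDerivAt_flowField h.flowField_self
  refine h1.unique (h2.congr_of_eventuallyEq ?_)
  have hev : ∀ᶠ y in 𝓝 y₀, (0, F (t, y)) ∈ O := by
    have hc : ContinuousAt (fun y => ((0 : ℝ), F (t, y))) y₀ :=
      continuousAt_const.prodMk (h.hasFDerivAt_space (h.mem t)).continuousAt
    refine hc.eventually (h.isOpen.mem_nhds ?_)
    simpa [h.fixed] using h.mem 0
  filter_upwards [h.eventually_mem, hev] with y hy hy'
  rw [h.flowField_flow (hy t ht) hy', h.fderiv_time (hy t ht) (hy 0 ⟨le_rfl, h.period_pos.le⟩)]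

/-- The mean over a period kills the range of the linearized field, as the flow returns to the
identity. -/
theorem IsPeriodicFlowAt.flowMean_fderiv [CompleteSpace E] (h : IsPeriodicFlowAt F O y₀ T)
    (u : E) : flowMean F T y₀ (fderiv ℝ (flowField F) y₀ u) = 0 := by
  have h1 := h.hasFDerivAt_space (h.mem T)
  have h2 : flowDeriv F T y₀ = 1 := by
    refine h1.unique ((hasFDerivAt_id y₀).congr_of_eventuallyEq ?_)
    filter_upwards [h.eventually_mem] with y hy
    exact h.period y (hy 0 ⟨le_rfl, h.period_pos.le⟩)
  have h3 := h.flowDeriv_sub_one ⟨h.period_pos.le, le_rfl⟩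
  rw [h2, sub_self] at h3
  simpa using (DFunLike.congr_fun h3 u).symm

theorem IsPeriodicFlowAt.flowMean_apply [CompleteSpace E] (h : IsPeriodicFlowAt F O y₀ T)
    {G : Type*} [NormedAddCommGroup G] [NormedSpace ℝ G] [CompleteSpace G]
    (l : E →L[ℝ] G) (u : E) :
    ∫ t in (0 : ℝ)..T, l (flowDeriv F t y₀ u) = l (flowMean F T y₀ u) := by
  have hc := h.continuousOn_flowDeriv_time (fun s _ => h.mem s) (t := T)
    ⟨h.period_pos.le, le_rfl⟩
  rw [flowMean, ContinuousLinearMap.intervalIntegral_apply hc.intervalIntegrable,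
    ContinuousLinearMap.intervalIntegral_comp_comm]
  exact (hc.clm_apply continuousOn_const).intervalIntegrable

/-- The mean of an orbit of the linearized flow is a zero of the linearized field. -/
theorem IsPeriodicFlowAt.fderiv_flowMean [CompleteSpace E] (h : IsPeriodicFlowAt F O y₀ T)
    (u : E) : fderiv ℝ (flowField F) y₀ (flowMean F T y₀ u) = 0 := by
  rw [← h.flowMean_apply, ← h.flowMean_fderiv u,
    ← ContinuousLinearMap.id_apply (R₁ := ℝ) (flowMean F T y₀ _), ← h.flowMean_apply]
  refine intervalIntegral.integral_congr fun t ht => ?_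
  rw [uIcc_of_le h.period_pos.le] at ht
  exact DFunLike.congr_fun (h.comp_flowDeriv ht) u

/-- A linearized rotation fixes the kernel of the linearized vector field. -/
theorem IsPeriodicFlowAt.flowDeriv_of_fderiv_eq_zero [CompleteSpace E]
    (h : IsPeriodicFlowAt F O y₀ T) {z : E} (hz : fderiv ℝ (flowField F) y₀ z = 0) {t : ℝ}
    (ht : t ∈ Icc 0 T) : flowDeriv F t y₀ z = z := by
  have := DFunLike.congr_fun (h.flowDeriv_sub_one ht) z
  simpa [hz, sub_eq_zero] using this

end LinearizedFlow

section Hamiltonian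

variable {E : Type*} [NormedAddCommGroup E] [NormedSpace ℝ E]
variable {F : ℝ × E → E} {O : Set (ℝ × E)} {y₀ : E} {T : ℝ} {h : E → ℝ}
  {Ω : E → E →L[ℝ] E →L[ℝ] ℝ}

theorem IsPeriodicFlowAt.hessian_eq (hF : IsPeriodicFlowAt F O y₀ T) (hOm : ContinuousAt Ω y₀)
    (hd : ∀ᶠ y in 𝓝 y₀, ∀ w, fderiv ℝ h y w = -Ω y (flowField F y) w) (u : E) :
    fderiv ℝ (fderiv ℝ h) y₀ u = -Ω y₀ (fderiv ℝ (flowField F) y₀ u) := by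
  have h1 := (hasFDerivAt_clm_apply_of_zero hOm hF.hasFDerivAt_flowField hF.flowField_self).neg
  have h2 : fderiv ℝ h =ᶠ[𝓝 y₀] fun y => -(Ω y (flowField F y)) := by
    filter_upwards [hd] with y hy
    ext w
    simpa using hy w
  rw [(h1.congr_of_eventuallyEq h2).fderiv]
  simp

/-- The triviality of the joint kernel of two linear maps is an open condition. -/
theorem eventually_joint_ker_eq_bot {Y V W : Type*} [TopologicalSpace Y] [FiniteDimensional ℝ E]
    [NormedAddCommGroup V] [NormedSpace ℝ V] [NormedAddCommGroup W] [NormedSpace ℝ W]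
    {f : Y → E →L[ℝ] V} {g : Y → E →L[ℝ] W} {y₀ : Y} (hf : ContinuousAt f y₀)
    (hg : ContinuousAt g y₀) (h0 : ∀ ξ, f y₀ ξ = 0 → g y₀ ξ = 0 → ξ = 0) :
    ∀ᶠ y in 𝓝 y₀, ∀ ξ, f y ξ = 0 → g y ξ = 0 → ξ = 0 := by
  let S : Y → E →L[ℝ] V × W := fun y =>
    (ContinuousLinearMap.inl ℝ V W).comp (f y) + (ContinuousLinearMap.inr ℝ V W).comp (g y)
  have hS : ∀ y ξ, S y ξ = (f y ξ, g y ξ) := fun y ξ => by simp [S]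
  have hScont : ContinuousAt S y₀ :=
    (continuousAt_const.clm_comp hf).add (continuousAt_const.clm_comp hg)
  have hSinj : Function.Injective (S y₀) := by
    rw [injective_iff_map_eq_zero]
    intro ξ hξ
    rw [hS, Prod.mk_eq_zero] at hξ
    exact h0 ξ hξ.1 hξ.2
  have hSev : ∀ᶠ y in 𝓝 y₀, Function.Injective (S y) :=
    hScont.eventually (ContinuousLinearMap.isOpen_injective.mem_nhds hSinj)
  filter_upwards [hSev] with y hy ξ h1 h2
  refine (injective_iff_map_eq_zero (S y)).1 hy ξ ?_
  rw [hS, h1, h2, Prod.mk_zero_zero]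

/-- At a zero of the vector field, the Hamiltonian of a symplectic circle action is Morse–Bott,
and neither of its indices is one. -/
theorem IsPeriodicFlowAt.tameAt [FiniteDimensional ℝ E] (hF : IsPeriodicFlowAt F O y₀ T)
    (hh : ContDiffAt ℝ 2 h y₀) (hOm : ContinuousAt Ω y₀) (hnd : ∀ v, (∀ w, Ω y₀ v w = 0) → v = 0)
    (hinv : ∀ t u w, Ω y₀ (flowDeriv F t y₀ u) (flowDeriv F t y₀ w) = Ω y₀ u w)
    (hd : ∀ᶠ y in 𝓝 y₀, ∀ w, fderiv ℝ h y w = -Ω y (flowField F y) w) : TameAt h y₀ := by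
  have : CompleteSpace E := FiniteDimensional.complete ℝ E
  set A := fderiv ℝ (flowField F) y₀ with hA
  set Q := fderiv ℝ (fderiv ℝ h) y₀ with hQdef
  have hQ : ∀ u, Q u = -Ω y₀ (A u) := hF.hessian_eq hOm hd
  have hsymm : ∀ u w, Q u w = Q w u := fun u w =>
    (hh.isSymmSndFDerivAt (by simp)) u w
  have hBQ : ∀ t ∈ Icc 0 T, ∀ u w, Q (flowDeriv F t y₀ u) (flowDeriv F t y₀ w) = Q u w := by
    intro t ht u w
    have := DFunLike.congr_fun (hF.comp_flowDeriv ht) u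
    simp only [ContinuousLinearMap.comp_apply] at this
    rw [hQ, hQ, this]
    simp [hinv, ← hA]
  have hmean : ∀ u, ∫ t in (0 : ℝ)..T, Q u (flowDeriv F t y₀ u) = 0 := by
    intro u
    rw [hF.flowMean_apply, hsymm, hQ, hA, hF.fderiv_flowMean]
    simp
  have hBc : ContinuousOn (fun t => flowDeriv F t y₀) (Icc 0 T) := by
    have := hF.continuousOn_flowDeriv_time (fun s _ => hF.mem s) (t := T)
      ⟨hF.period_pos.le, le_rfl⟩
    rwa [uIcc_of_le hF.period_pos.le] at this
  obtain ⟨v, hv'⟩ := LinearMap.BilinForm.exists_orthogonal_basis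
    (B := LinearMap.mk₂ ℝ (fun u w => Q u w) (by simp) (by simp) (by simp) (by simp))
    ⟨fun u w => by simpa using hsymm u w⟩
  have hv : ∀ i j, i ≠ j → Q (v i) (v j) = 0 := fun i j hij => by simpa using hv' hij
  have hpos := not_existsUnique_form_pos hv hF.period_pos hF.flowDeriv_zero hBc hBQ hmean
  have hneg := not_existsUnique_form_neg hv hF.period_pos hF.flowDeriv_zero hBc hBQ hmean
  set lam := fun i => Q (v i) (v i) with hlam
  set L := signSplitting v lam with hL
  refine tameAt_of_morseBott (L := L) hh ?_ (fun p hp => form_signSplitting_pos hv hp)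
    (fun q hq => form_signSplitting_neg hv hq) ?_
    (isPreconnected_sphere_of_not_existsUnique hpos)
    (isPreconnected_sphere_of_not_existsUnique hneg)
  · ext w
    rw [hd.self_of_nhds w, hF.flowField_self]
    simp
  -- A vector `ξ` that is `Ω`-orthogonal to the normal directions and has zero mean is zero: at `y₀`
  -- the mean condition makes `ξ` orthogonal to the axis too, and this persists near `y₀`. It is
  -- applied to the generator at `y`, whose mean is `F (T, y) - y = 0`.
  have hSev := eventually_joint_ker_eq_bot (f := fun y =>
    ((ContinuousLinearMap.compL ℝ _ E ℝ).flip (normalIncl L)).comp (Ω y))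
    (continuousAt_const.clm_comp hOm)
    (hF.continuousAt_flowMean ⟨hF.period_pos.le, le_rfl⟩) (by
    intro ξ hξ1 hξ2
    replace hξ1 : ∀ n, Ω y₀ ξ (normalIncl L n) = 0 := fun n => DFunLike.congr_fun hξ1 n
    refine hnd ξ fun w => ?_
    obtain ⟨⟨z, n⟩, rfl⟩ := L.surjective w
    have hz : fderiv ℝ (flowField F) y₀ (L (z, 0)) = 0 := by
      refine hnd _ fun w => ?_
      have h1 : Q (L (z, 0)) w = 0 := form_signSplitting_axis hv z w
      rw [hQ] at h1
      simpa using h1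
    have hz0 : Ω y₀ ξ (L (z, 0)) = 0 := by
      have h1 := hF.flowMean_apply ((Ω y₀).flip (L (z, 0))) ξ
      have h2 : ∫ t in (0 : ℝ)..T, (Ω y₀).flip (L (z, 0)) (flowDeriv F t y₀ ξ) =
          ∫ t in (0 : ℝ)..T, Ω y₀ ξ (L (z, 0)) := by
        refine intervalIntegral.integral_congr fun t ht => ?_
        rw [uIcc_of_le hF.period_pos.le] at ht
        have := hinv t ξ (L (z, 0))
        rw [hF.flowDeriv_of_fderiv_eq_zero hz ht] at this
        simpa using this
      rw [h2, hξ2, map_zero] at h1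
      simpa [hF.period_pos.ne'] using h1
    have : L (z, n) = L (z, 0) + normalIncl L n := by
      rw [normalIncl_apply, ← map_add]
      simp
    rw [this, map_add, hz0, hξ1, add_zero])
  filter_upwards [hSev, hd, hF.eventually_mem] with y hy hdy hyO hn
  have h0 : flowField F y = 0 := by
    refine hy _ (ContinuousLinearMap.ext fun n => ?_) ?_
    · simpa [hdy] using hn n
    · have := hF.flow_sub hyO ⟨hF.period_pos.le, le_rfl⟩
      rw [hF.period y (hyO 0 ⟨le_rfl, hF.period_pos.le⟩), sub_self] at this
      exact this.symm
  ext w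
  rw [hdy, h0]
  simp

end Hamiltonian

/-! ### Regular points -/

section RegularPoints

theorem tameAt_fst {K : Type*} [NormedAddCommGroup K] [NormedSpace ℝ K] (p : ℝ × K) :
    TameAt (Prod.fst : ℝ × K → ℝ) p where
  fibre W hW := by
    obtain ⟨ε, hε, h⟩ := Metric.mem_nhds_iff.1 hW
    refine ⟨_, Metric.ball_mem_nhds p hε, h, fun s => ?_⟩
    refine Convex.isPreconnected ((convex_ball p ε).inter ?_)
    exact (convex_singleton s).linear_preimage (LinearMap.fst ℝ ℝ K)
  max := Or.inr <| .of_forall fun q _ hq => by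
    have := hq.fderiv_eq_zero
    rw [fderiv_fst] at this
    simpa using DFunLike.congr_fun this (1, 0)
  min := Or.inr <| .of_forall fun q _ hq => by
    have := hq.fderiv_eq_zero
    rw [fderiv_fst] at this
    simpa using DFunLike.congr_fun this (1, 0)

/-- Near a regular point a function is a linear projection in suitable coordinates. -/
theorem tameAt_of_fderiv_ne_zero {E : Type*} [NormedAddCommGroup E] [NormedSpace ℝ E]
    [FiniteDimensional ℝ E] {h : E → ℝ} {y₀ : E} (hh : ContDiffAt ℝ 1 h y₀)
    (h0 : fderiv ℝ h y₀ ≠ 0) : TameAt h y₀ := by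
  have : CompleteSpace E := FiniteDimensional.complete ℝ E
  have hs := hh.hasStrictFDerivAt (by simp)
  have hr : (fderiv ℝ h y₀).range = ⊤ :=
    LinearMap.range_eq_top.2 (LinearMap.surjective (f := (fderiv ℝ h y₀).toLinearMap)
      fun h => h0 (ContinuousLinearMap.coe_injective h))
  set e := hs.implicitToOpenPartialHomeomorph h _ hr with he
  have hmem : y₀ ∈ e.source := hs.mem_implicitToOpenPartialHomeomorph_source hr
  have := TameAt.of_comp e.symm (g := h) (x := e y₀) (e.map_source hmem) ?_
  · rwa [e.left_inv hmem] at this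
  refine (tameAt_fst (e y₀)).congr ?_
  filter_upwards [e.open_target.mem_nhds (e.map_source hmem)] with q hq
  rw [Function.comp_apply, ← hs.implicitToOpenPartialHomeomorph_fst hr, ← he, e.right_inv hq]

end RegularPoints

/-! ### The circle action in charts -/

section BilinearForm

variable {E : Type*} [NormedAddCommGroup E] [NormedSpace ℝ E]

/-- An alternating 2-form as a bilinear form. -/
noncomputable def bilinearForm (η : E [⋀^Fin 2]→L[ℝ] ℝ) : E →L[ℝ] E →L[ℝ] ℝ :=
  ((continuousMultilinearCurryFin1 ℝ E ℝ).toContinuousLinearEquiv :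
    (E [×1]→L[ℝ] ℝ) →L[ℝ] E →L[ℝ] ℝ).comp
    (continuousMultilinearCurryLeftEquiv ℝ (fun _ : Fin 2 => E) ℝ η.toContinuousMultilinearMap)

theorem bilinearForm_apply (η : E [⋀^Fin 2]→L[ℝ] ℝ) (u w : E) :
    bilinearForm η u w = η ![u, w] := by
  change η (Fin.cons u (Fin.snoc 0 w)) = _
  congr 1
  ext i
  fin_cases i <;> rfl

theorem continuous_bilinearForm :
    Continuous (bilinearForm : (E [⋀^Fin 2]→L[ℝ] ℝ) → E →L[ℝ] E →L[ℝ] ℝ) := by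
  have h1 : Continuous fun η : E [⋀^Fin 2]→L[ℝ] ℝ =>
      continuousMultilinearCurryLeftEquiv ℝ (fun _ : Fin 2 => E) ℝ η.toContinuousMultilinearMap :=
    (continuousMultilinearCurryLeftEquiv ℝ (fun _ : Fin 2 => E) ℝ).continuous.comp
      (ContinuousAlternatingMap.toContinuousMultilinearMapCLM ℝ).continuous
  exact continuous_const.clm_comp h1

end BilinearForm

section Chart

variable {E : Type*} [NormedAddCommGroup E] [NormedSpace ℝ E]
  {M : Type*} [TopologicalSpace M] [ChartedSpace E M]

variable (E) in
/-- The derivative of the inverse of the preferred chart at `x₀`. -/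
noncomputable def chartDeriv (x₀ : M) (y : E) : E →L[ℝ] E :=
  mfderiv 𝓘(ℝ, E) 𝓘(ℝ, E) (extChartAt 𝓘(ℝ, E) x₀).symm y

/-- A 2-form in the preferred chart at `x₀`, as a bilinear form. -/
noncomputable def chartForm (Ω : DiffForm E M 2) (x₀ : M) (y : E) : E →L[ℝ] E →L[ℝ] ℝ :=
  bilinearForm (Ω.inChart x₀ y)

/-- A 2-form at a point, with the tangent space spelled out as the model space. -/
noncomputable def formAt (Ω : DiffForm E M 2) (x : M) (u w : E) : ℝ :=
  Ω x ![(u : TangentSpace 𝓘(ℝ, E) x), w]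

theorem chartForm_apply (Ω : DiffForm E M 2) (x₀ : M) (y u w : E) :
    chartForm Ω x₀ y u w =
      formAt Ω ((extChartAt 𝓘(ℝ, E) x₀).symm y) (chartDeriv E x₀ y u) (chartDeriv E x₀ y w) := by
  rw [chartForm, bilinearForm_apply]
  change Ω _ _ = Ω _ _
  congr 1
  ext i
  fin_cases i <;> rfl

theorem DiffForm.IsSmooth.continuousOn_chartForm {Ω : DiffForm E M 2} (hΩ : Ω.IsSmooth) (x₀ : M) :
    ContinuousOn (chartForm Ω x₀) (extChartAt 𝓘(ℝ, E) x₀).target :=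
  continuous_bilinearForm.comp_continuousOn (hΩ x₀).continuousOn

variable [IsManifold 𝓘(ℝ, E) ∞ M]

theorem hasMFDerivAt_extChartAt_symm {x₀ : M} {y : E}
    (hy : y ∈ (extChartAt 𝓘(ℝ, E) x₀).target) :
    HasMFDerivAt 𝓘(ℝ, E) 𝓘(ℝ, E) (extChartAt 𝓘(ℝ, E) x₀).symm y (chartDeriv E x₀ y) := by
  have : IsManifold 𝓘(ℝ, E) 1 M := IsManifold.of_le (n := ∞) (by simp)
  have := mdifferentiableWithinAt_extChartAt_symm (I := 𝓘(ℝ, E)) hy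
  rw [ModelWithCorners.range_eq_univ, mdifferentiableWithinAt_univ] at this
  exact this.hasMFDerivAt

theorem chartDeriv_bijective {x₀ : M} {y : E} (hy : y ∈ (extChartAt 𝓘(ℝ, E) x₀).target) :
    Function.Bijective (chartDeriv E x₀ y) := by
  have : IsManifold 𝓘(ℝ, E) 1 M := IsManifold.of_le (n := ∞) (by simp)
  have := isInvertible_mfderivWithin_extChartAt_symm (I := 𝓘(ℝ, E)) hy
  rw [ModelWithCorners.range_eq_univ, mfderivWithin_univ] at this
  exact this.bijective

theorem chartForm_nondegenerate {Ω : DiffForm E M 2} (hΩ : IsSymplecticForm Ω) {x₀ : M} {y v : E}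
    (hy : y ∈ (extChartAt 𝓘(ℝ, E) x₀).target) (hv : ∀ w, chartForm Ω x₀ y v w = 0) : v = 0 := by
  have hb := chartDeriv_bijective hy
  have h0 : chartDeriv E x₀ y v = 0 := by
    refine hΩ.nondegenerate ((extChartAt 𝓘(ℝ, E) x₀).symm y) (chartDeriv E x₀ y v) fun w => ?_
    obtain ⟨w, rfl⟩ := hb.2 w
    have := hv w
    rwa [chartForm_apply] at this
  exact hb.1 (h0.trans (map_zero _).symm)

end Chart

section ChartFlow

variable {E : Type*} [NormedAddCommGroup E] [NormedSpace ℝ E]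
  {M : Type*} [TopologicalSpace M] [ChartedSpace E M] [MulAction Circle M]

variable (E) in
/-- The circle action, in the preferred chart at `x₀`, as a local flow. -/
noncomputable def chartFlow (x₀ : M) (p : ℝ × E) : E :=
  extChartAt 𝓘(ℝ, E) x₀ (Circle.exp p.1 • (extChartAt 𝓘(ℝ, E) x₀).symm p.2)

variable (E) in
/-- The domain on which `chartFlow` is meaningful. -/
def chartFlowDomain (x₀ : M) : Set (ℝ × E) :=
  {p | p.2 ∈ (extChartAt 𝓘(ℝ, E) x₀).target ∧
    Circle.exp p.1 • (extChartAt 𝓘(ℝ, E) x₀).symm p.2 ∈ (extChartAt 𝓘(ℝ, E) x₀).source}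

theorem zero_mem_chartFlowDomain {x₀ : M} {y : E} (hy : y ∈ (extChartAt 𝓘(ℝ, E) x₀).target) :
    (0, y) ∈ chartFlowDomain E x₀ := by
  refine ⟨hy, ?_⟩
  simpa using (extChartAt 𝓘(ℝ, E) x₀).map_target hy

theorem symm_chartFlow {x₀ : M} {p : ℝ × E} (hp : p ∈ chartFlowDomain E x₀) :
    (extChartAt 𝓘(ℝ, E) x₀).symm (chartFlow E x₀ p) =
      Circle.exp p.1 • (extChartAt 𝓘(ℝ, E) x₀).symm p.2 :=
  (extChartAt 𝓘(ℝ, E) x₀).left_inv hp.2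

theorem IsSymplecticAction.formAt_mfderiv_smul {Ω : DiffForm E M 2} (hsymp : IsSymplecticAction Ω)
    (g : Circle) (x : M) (u w : E) :
    formAt Ω (g • x) (mfderiv 𝓘(ℝ, E) 𝓘(ℝ, E) (fun x : M => g • x) x u)
      (mfderiv 𝓘(ℝ, E) 𝓘(ℝ, E) (fun x : M => g • x) x w) = formAt Ω x u w := by
  have h := DFunLike.congr_fun (congrFun (hsymp g) x) ![(u : TangentSpace 𝓘(ℝ, E) x), w]
  refine Eq.trans ?_ h
  change Ω (g • x) _ = Ω (g • x) _
  congr 1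
  ext i
  fin_cases i <;> rfl

variable [IsManifold 𝓘(ℝ, E) ∞ M] [ContMDiffSMul (𝓡 1) 𝓘(ℝ, E) ∞ Circle M]

theorem isLocalFlow_chartFlow (x₀ : M) :
    IsLocalFlow (chartFlow E x₀) (chartFlowDomain E x₀) := by
  set ϕ := extChartAt 𝓘(ℝ, E) x₀ with hϕ
  have hsm : ContMDiffOn 𝓘(ℝ, ℝ × E) 𝓘(ℝ, E) ∞
      (fun p : ℝ × E => Circle.exp p.1 • ϕ.symm p.2) {p | p.2 ∈ ϕ.target} := by
    have h1 : ContMDiffOn 𝓘(ℝ, ℝ × E) (𝓡 1) ∞ (fun p : ℝ × E => Circle.exp p.1)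
        {p | p.2 ∈ ϕ.target} :=
      (contMDiff_circleExp.comp contDiff_fst.contMDiff).contMDiffOn
    have h2 : ContMDiffOn 𝓘(ℝ, ℝ × E) 𝓘(ℝ, E) ∞ (fun p : ℝ × E => ϕ.symm p.2)
        {p | p.2 ∈ ϕ.target} :=
      (contMDiffOn_extChartAt_symm x₀).comp contDiff_snd.contMDiff.contMDiffOn fun _ hp => hp
    exact h1.smul h2
  refine ⟨?_, ?_, ?_, ?_⟩
  · exact hsm.continuousOn.isOpen_inter_preimage
      ((isOpen_extChartAt_target x₀).preimage continuous_snd) (isOpen_extChartAt_source x₀)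
  · rw [← contMDiffOn_iff_contDiffOn]
    have h3 := contMDiffOn_extChartAt (I := 𝓘(ℝ, E)) (n := ∞) (x := x₀)
    refine h3.comp (hsm.mono fun p hp => hp.1) fun p hp => ?_
    rw [← extChartAt_source 𝓘(ℝ, E)]
    exact hp.2
  · intro y hy
    change ϕ (Circle.exp 0 • ϕ.symm y) = y
    rw [Circle.exp_zero, one_smul, ϕ.right_inv hy.1]
  · intro s t y hy
    change ϕ (Circle.exp (s + t) • ϕ.symm y) = ϕ (Circle.exp s • ϕ.symm (chartFlow E x₀ (t, y)))
    rw [symm_chartFlow hy, Circle.exp_add, mul_smul]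

/-- The generator of the action read in a chart is the field of the chart flow. -/
theorem generator_symm {x₀ : M} {y : E} (hy : y ∈ (extChartAt 𝓘(ℝ, E) x₀).target) :
    generator E M ((extChartAt 𝓘(ℝ, E) x₀).symm y) =
      chartDeriv E x₀ y (flowField (chartFlow E x₀) y) := by
  have hF := isLocalFlow_chartFlow (E := E) x₀
  have h0 := zero_mem_chartFlowDomain hy
  have h1 := (hF.hasDerivAt_time h0).hasFDerivAt.hasMFDerivAt
  have h2 : HasMFDerivAt 𝓘(ℝ, E) 𝓘(ℝ, E) (extChartAt 𝓘(ℝ, E) x₀).symm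
      (chartFlow E x₀ (0, y)) (chartDeriv E x₀ y) := by
    rw [hF.zero y h0]
    exact hasMFDerivAt_extChartAt_symm hy
  have h3 := HasMFDerivAt.comp (0 : ℝ) h2 h1
  have hev : ∀ᶠ s in 𝓝 (0 : ℝ), (s, y) ∈ chartFlowDomain E x₀ :=
    (Continuous.tendsto (f := fun s : ℝ => (s, y)) (by fun_prop) 0).eventually
      (hF.isOpen.mem_nhds h0)
  have h4 := h3.congr_of_eventuallyEq
    (f₁ := fun t : ℝ => Circle.exp t • (extChartAt 𝓘(ℝ, E) x₀).symm y) (by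
      filter_upwards [hev] with s hs using (symm_chartFlow hs).symm)
  rw [generator, h4.mfderiv]
  change chartDeriv E x₀ y ((1 : ℝ) • _) = _
  rw [one_smul]
  rfl

/-- At a fixed point, the derivative of the chart flow is the derivative of the action read in the
chart. -/
theorem mfderiv_smul_fixedPoint {x₀ : M} (hx₀ : ∀ g : Circle, g • x₀ = x₀) (t : ℝ) (u : E) :
    chartDeriv E x₀ (extChartAt 𝓘(ℝ, E) x₀ x₀)
        (flowDeriv (chartFlow E x₀) t (extChartAt 𝓘(ℝ, E) x₀ x₀) u) =
      mfderiv 𝓘(ℝ, E) 𝓘(ℝ, E) (fun x : M => Circle.exp t • x) x₀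
        (chartDeriv E x₀ (extChartAt 𝓘(ℝ, E) x₀ x₀) u) := by
  have hF := isLocalFlow_chartFlow (E := E) x₀
  have hy := mem_extChartAt_target (I := 𝓘(ℝ, E)) x₀
  have hx : (extChartAt 𝓘(ℝ, E) x₀).symm (extChartAt 𝓘(ℝ, E) x₀ x₀) = x₀ := by simp
  set y₀ := extChartAt 𝓘(ℝ, E) x₀ x₀ with hy₀
  have hmem : (t, y₀) ∈ chartFlowDomain E x₀ := by
    refine ⟨hy, ?_⟩
    rw [hx, hx₀]
    exact mem_extChartAt_source x₀
  have hfix : chartFlow E x₀ (t, y₀) = y₀ := by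
    rw [chartFlow, hx, hx₀]
  have h1 := (hF.hasFDerivAt_space hmem).hasMFDerivAt
  have h2 : HasMFDerivAt 𝓘(ℝ, E) 𝓘(ℝ, E) (extChartAt 𝓘(ℝ, E) x₀).symm
      (chartFlow E x₀ (t, y₀)) (chartDeriv E x₀ y₀) := by
    rw [hfix]
    exact hasMFDerivAt_extChartAt_symm hy
  have h3 := HasMFDerivAt.comp y₀ h2 h1
  have h4 : HasMFDerivAt 𝓘(ℝ, E) 𝓘(ℝ, E) (fun x : M => Circle.exp t • x)
      ((extChartAt 𝓘(ℝ, E) x₀).symm y₀)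
      (mfderiv 𝓘(ℝ, E) 𝓘(ℝ, E) (fun x : M => Circle.exp t • x) x₀) := by
    rw [hx]
    exact ((ContMDiffSMul.contMDiff_const_smul (I := 𝓡 1) (n := ∞) (Circle.exp t)).mdifferentiable
      (by simp) x₀).hasMFDerivAt
  have h5 := HasMFDerivAt.comp y₀ h4 (hasMFDerivAt_extChartAt_symm hy)
  have hev : ∀ᶠ y in 𝓝 y₀, (t, y) ∈ chartFlowDomain E x₀ :=
    (Continuous.tendsto (f := fun y : E => (t, y)) (by fun_prop) y₀).eventually
      (hF.isOpen.mem_nhds hmem)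
  have h6 := h3.congr_of_eventuallyEq
    (f₁ := (fun x : M => Circle.exp t • x) ∘ (extChartAt 𝓘(ℝ, E) x₀).symm) (by
      filter_upwards [hev] with s hs using (symm_chartFlow hs).symm)
  exact DFunLike.congr_fun (hasMFDerivAt_unique h6 h5) u

theorem IsSymplecticAction.chartForm_flowDeriv {Ω : DiffForm E M 2} (hsymp : IsSymplecticAction Ω)
    {x₀ : M} (hx₀ : ∀ g : Circle, g • x₀ = x₀) (t : ℝ) (u w : E) :
    chartForm Ω x₀ (extChartAt 𝓘(ℝ, E) x₀ x₀)
        (flowDeriv (chartFlow E x₀) t (extChartAt 𝓘(ℝ, E) x₀ x₀) u)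
        (flowDeriv (chartFlow E x₀) t (extChartAt 𝓘(ℝ, E) x₀ x₀) w) =
      chartForm Ω x₀ (extChartAt 𝓘(ℝ, E) x₀ x₀) u w := by
  have hx : (extChartAt 𝓘(ℝ, E) x₀).symm (extChartAt 𝓘(ℝ, E) x₀ x₀) = x₀ := by simp
  rw [chartForm_apply, chartForm_apply, hx, mfderiv_smul_fixedPoint hx₀,
    mfderiv_smul_fixedPoint hx₀, ← hsymp.formAt_mfderiv_smul (Circle.exp t) x₀, hx₀]

theorem isPeriodicFlowAt_chartFlow {x₀ : M} (hx₀ : ∀ g : Circle, g • x₀ = x₀) :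
    IsPeriodicFlowAt (chartFlow E x₀) (chartFlowDomain E x₀) (extChartAt 𝓘(ℝ, E) x₀ x₀)
      (2 * Real.pi) where
  toIsLocalFlow := isLocalFlow_chartFlow x₀
  period_pos := Real.two_pi_pos
  mem t := by
    refine ⟨mem_extChartAt_target x₀, ?_⟩
    simp [hx₀]
  fixed t := by simp [chartFlow, hx₀]
  period y hy := by
    rw [chartFlow, Circle.exp_two_pi, one_smul, (extChartAt 𝓘(ℝ, E) x₀).right_inv hy.1]

/-- Zeros of the generator are fixed points. -/
theorem smul_eq_of_flowField_eq_zero {x₀ : M}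
    (h0 : flowField (chartFlow E x₀) (extChartAt 𝓘(ℝ, E) x₀ x₀) = 0) (g : Circle) :
    g • x₀ = x₀ := by
  have hF := isLocalFlow_chartFlow (E := E) x₀
  have hy := mem_extChartAt_target (I := 𝓘(ℝ, E)) x₀
  have hx : (extChartAt 𝓘(ℝ, E) x₀).symm (extChartAt 𝓘(ℝ, E) x₀ x₀) = x₀ := by simp
  set y₀ := extChartAt 𝓘(ℝ, E) x₀ x₀ with hy₀
  have h0m := zero_mem_chartFlowDomain hy
  have hO : IsOpen {t : ℝ | (t, y₀) ∈ chartFlowDomain E x₀} :=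
    hF.isOpen.preimage (by fun_prop)
  obtain ⟨ε, hε, hball⟩ := Metric.isOpen_iff.1 hO 0 h0m
  have hd : ∀ t ∈ Metric.ball (0 : ℝ) ε, HasDerivAt (fun s => chartFlow E x₀ (s, y₀)) 0 t := by
    intro t ht
    have := hF.hasDerivAt_time (hball ht)
    rwa [hF.fderiv_time (hball ht) h0m, h0, map_zero] at this
  have hconst : ∀ t ∈ Metric.ball (0 : ℝ) ε, Circle.exp t • x₀ = x₀ := by
    intro t ht
    have h1 : chartFlow E x₀ (t, y₀) = chartFlow E x₀ (0, y₀) :=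
      Metric.isOpen_ball.is_const_of_deriv_eq_zero (convex_ball (0 : ℝ) ε).isPreconnected
        (fun s hs => (hd s hs).differentiableAt.differentiableWithinAt)
        (fun s hs => (hd s hs).deriv) ht (Metric.mem_ball_self hε)
    have h2 := symm_chartFlow (hball ht)
    rw [h1, hF.zero y₀ h0m, hx] at h2
    exact h2.symm
  obtain ⟨θ, rfl⟩ := Circle.exp_surjective g
  obtain ⟨n, hn⟩ := exists_nat_gt (|θ| / ε)
  have hn0 : (0 : ℝ) < n := lt_of_le_of_lt (by positivity) hn
  have hmem : Circle.exp (θ / n) ∈ MulAction.stabilizer Circle x₀ := by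
    refine hconst _ ?_
    rw [mem_ball_zero_iff, Real.norm_eq_abs, abs_div, Nat.abs_cast, div_lt_iff₀ hn0]
    rwa [div_lt_iff₀ hε, mul_comm] at hn
  have := pow_mem hmem n
  rwa [← Circle.exp_nsmul, nsmul_eq_mul, mul_div_cancel₀ _ hn0.ne'] at this

end ChartFlow

section Lift

variable {E : Type*} [NormedAddCommGroup E] [NormedSpace ℝ E]
  {M : Type*} [TopologicalSpace M] [ChartedSpace E M] [MulAction Circle M]
  [IsManifold 𝓘(ℝ, E) ∞ M] [ContMDiffSMul (𝓡 1) 𝓘(ℝ, E) ∞ Circle M]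
  {Ω : DiffForm E M 2} {f : M → ℝ} {U : Set M}

theorem fderiv_comp_extChartAt_symm (hU : IsOpen U) (hf : ContMDiffOn 𝓘(ℝ, E) 𝓘(ℝ, ℝ) ∞ f U)
    (hd : ∀ x ∈ U, ∀ v : TangentSpace 𝓘(ℝ, E) x,
      Ω.contract (generator E M) x ![v] = -(mfderiv 𝓘(ℝ, E) 𝓘(ℝ, ℝ) f x v : ℝ)) {x₀ : M} {y : E}
    (hy : y ∈ (extChartAt 𝓘(ℝ, E) x₀).target) (hyU : (extChartAt 𝓘(ℝ, E) x₀).symm y ∈ U) (w : E) :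
    fderiv ℝ (f ∘ (extChartAt 𝓘(ℝ, E) x₀).symm) y w =
      -chartForm Ω x₀ y (flowField (chartFlow E x₀) y) w := by
  have h1 := ((hf.contMDiffAt (hU.mem_nhds hyU)).mdifferentiableAt (by simp)).hasMFDerivAt
  let Df : E →L[ℝ] ℝ := mfderiv 𝓘(ℝ, E) 𝓘(ℝ, ℝ) f ((extChartAt 𝓘(ℝ, E) x₀).symm y)
  have h2 : HasMFDerivAt 𝓘(ℝ, E) 𝓘(ℝ, ℝ) (f ∘ (extChartAt 𝓘(ℝ, E) x₀).symm) y
      (Df.comp (chartDeriv E x₀ y)) := HasMFDerivAt.comp y h1 (hasMFDerivAt_extChartAt_symm hy)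
  have h3 := hd _ hyU (chartDeriv E x₀ y w)
  have h4 : HasFDerivAt (f ∘ (extChartAt 𝓘(ℝ, E) x₀).symm) (Df.comp (chartDeriv E x₀ y)) y :=
    hasMFDerivAt_iff_hasFDerivAt.1 h2
  rw [h4.fderiv, chartForm_apply, ← generator_symm hy]
  change mfderiv 𝓘(ℝ, E) 𝓘(ℝ, ℝ) f _ (chartDeriv E x₀ y w) = _
  rw [← neg_eq_iff_eq_neg.2 h3]
  rfl

/-- A local Hamiltonian of a symplectic circle action is tame. -/
theorem tameAt_of_contract_eq [FiniteDimensional ℝ E] (hΩ : IsSymplecticForm Ω)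
    (hsymp : IsSymplecticAction Ω) (hU : IsOpen U) (hf : ContMDiffOn 𝓘(ℝ, E) 𝓘(ℝ, ℝ) ∞ f U)
    (hd : ∀ x ∈ U, ∀ v : TangentSpace 𝓘(ℝ, E) x,
      Ω.contract (generator E M) x ![v] = -(mfderiv 𝓘(ℝ, E) 𝓘(ℝ, ℝ) f x v : ℝ)) {x₀ : M}
    (hx₀ : x₀ ∈ U) : TameAt f x₀ := by
  have hy := mem_extChartAt_target (I := 𝓘(ℝ, E)) x₀
  have hx : (extChartAt 𝓘(ℝ, E) x₀).symm (extChartAt 𝓘(ℝ, E) x₀ x₀) = x₀ := by simp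
  suffices h : TameAt (f ∘ (extChartAt 𝓘(ℝ, E) x₀).symm) (extChartAt 𝓘(ℝ, E) x₀ x₀) by
    have h2 := TameAt.of_comp (chartAt E x₀).symm (g := f) (x := chartAt E x₀ x₀)
      (mem_chart_target E x₀) h
    rwa [(chartAt E x₀).left_inv (mem_chart_source E x₀)] at h2
  set y₀ := extChartAt 𝓘(ℝ, E) x₀ x₀ with hy₀
  have htarget := (isOpen_extChartAt_target (I := 𝓘(ℝ, E)) x₀).mem_nhds hy
  have hsymm : ContMDiffAt 𝓘(ℝ, E) 𝓘(ℝ, E) ∞ (extChartAt 𝓘(ℝ, E) x₀).symm y₀ :=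
    (contMDiffOn_extChartAt_symm x₀).contMDiffAt htarget
  have hev : ∀ᶠ y in 𝓝 y₀, ∀ w, fderiv ℝ (f ∘ (extChartAt 𝓘(ℝ, E) x₀).symm) y w =
      -chartForm Ω x₀ y (flowField (chartFlow E x₀) y) w := by
    have hUy : ∀ᶠ y in 𝓝 y₀, (extChartAt 𝓘(ℝ, E) x₀).symm y ∈ U := by
      refine hsymm.continuousAt.eventually (hU.mem_nhds ?_)
      rwa [hx]
    filter_upwards [htarget, hUy] with y h1 h2
    exact fderiv_comp_extChartAt_symm hU hf hd h1 h2
  have hsm : ContDiffAt ℝ ∞ (f ∘ (extChartAt 𝓘(ℝ, E) x₀).symm) y₀ := by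
    rw [← contMDiffAt_iff_contDiffAt]
    refine ContMDiffAt.comp y₀ ?_ hsymm
    rw [hx]
    exact hf.contMDiffAt (hU.mem_nhds hx₀)
  by_cases h0 : fderiv ℝ (f ∘ (extChartAt 𝓘(ℝ, E) x₀).symm) y₀ = 0
  · have hX : flowField (chartFlow E x₀) y₀ = 0 := by
      refine chartForm_nondegenerate hΩ hy fun w => ?_
      have := hev.self_of_nhds w
      rw [h0] at this
      simpa using this.symm
    have hfix := smul_eq_of_flowField_eq_zero hX
    exact (isPeriodicFlowAt_chartFlow hfix).tameAt (hsm.of_le ENat.LEInfty.out)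
      ((hΩ.smooth.continuousOn_chartForm x₀).continuousAt htarget)
      (fun v => chartForm_nondegenerate hΩ hy) (hsymp.chartForm_flowDeriv hfix) hev
  · exact tameAt_of_fderiv_ne_zero (hsm.of_le (by exact_mod_cast le_top)) h0

end Lift

/-! ### The covering on which the Hamiltonian is real-valued -/

section Covering

variable {M : Type*} {P : AddSubgroup ℝ} {Φ : M → ℝ ⧸ P}

/-- `Φ : M → ℝ / P` has continuous local real-valued lifts. -/
def HasLocalLifts [TopologicalSpace M] (Φ : M → ℝ ⧸ P) : Prop :=
  ∀ x, ∃ (U : Set M) (f : M → ℝ), x ∈ U ∧ IsOpen U ∧ ContinuousOn f U ∧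
    ∀ z ∈ U, (QuotientAddGroup.mk (f z) : ℝ ⧸ P) = Φ z

theorem HasLocalLifts.continuous [TopologicalSpace M] (h : HasLocalLifts Φ) : Continuous Φ := by
  rw [continuous_iff_continuousAt]
  intro x
  obtain ⟨U, f, hxU, hU, hf, hfΦ⟩ := h x
  have h1 : ContinuousAt (fun z => (QuotientAddGroup.mk (f z) : ℝ ⧸ P)) x :=
    continuous_quot_mk.continuousAt.comp (hf.continuousAt (hU.mem_nhds hxU))
  exact h1.congr (by filter_upwards [hU.mem_nhds hxU] with z hz using hfΦ z hz)

theorem exists_pos_forall_abs_lt_eq_zero (P : AddSubgroup ℝ) [DiscreteTopology P] :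
    ∃ ε > 0, ∀ p ∈ P, |p| < ε → p = 0 := by
  obtain ⟨ε, hε, h⟩ := Metric.isOpen_iff.1 (isOpen_discrete ({0} : Set P)) 0 rfl
  refine ⟨ε, hε, fun p hp hpε => ?_⟩
  have : (⟨p, hp⟩ : P) ∈ Metric.ball (0 : P) ε := by
    simpa [Metric.mem_ball, Subtype.dist_eq] using hpε
  exact congrArg Subtype.val (h this)

/-- The pullback to `M` of the covering `ℝ → ℝ / P` along `Φ`. -/
abbrev LevelCover (Φ : M → ℝ ⧸ P) : Type _ :=
  {z : M × ℝ // (QuotientAddGroup.mk z.2 : ℝ ⧸ P) = Φ z.1}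

namespace LevelCover

/-- The covering map `LevelCover Φ → M`. -/
def base (z : LevelCover Φ) : M := z.1.1

/-- The real-valued lift of `Φ` to `LevelCover Φ`. -/
def level (z : LevelCover Φ) : ℝ := z.1.2

theorem mk_level (z : LevelCover Φ) : (QuotientAddGroup.mk z.level : ℝ ⧸ P) = Φ z.base := z.2

theorem ext' {z w : LevelCover Φ} (h1 : z.base = w.base) (h2 : z.level = w.level) : z = w :=
  Subtype.ext (Prod.ext h1 h2)

theorem base_surjective : Function.Surjective (base : LevelCover Φ → M) := fun x => by
  obtain ⟨t, ht⟩ := QuotientAddGroup.mk_surjective (Φ x)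
  exact ⟨⟨(x, t), ht⟩, rfl⟩

theorem level_sub_level_mem {z w : LevelCover Φ} (h : z.base = w.base) :
    z.level - w.level ∈ P := by
  rw [← QuotientAddGroup.eq_zero_iff, QuotientAddGroup.mk_sub, mk_level, mk_level, h, sub_self]

/-- The deck transformations of `LevelCover Φ`. -/
def translate (p : P) (z : LevelCover Φ) : LevelCover Φ :=
  ⟨(z.base, z.level + p), by
    rw [QuotientAddGroup.mk_add, (QuotientAddGroup.eq_zero_iff (p : ℝ)).2 p.2, add_zero, mk_level]⟩

theorem level_translate (p : P) (z : LevelCover Φ) : (translate p z).level = z.level + p := rfl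

theorem exists_translate_eq {z w : LevelCover Φ} (h : z.base = w.base) :
    ∃ p : P, translate p z = w :=
  ⟨⟨w.level - z.level, level_sub_level_mem h.symm⟩,
    ext' h (by rw [level_translate]; ring)⟩

theorem image_preimage_level (t : ℝ) :
    base '' ((level : LevelCover Φ → ℝ) ⁻¹' {t}) = Φ ⁻¹' {(QuotientAddGroup.mk t : ℝ ⧸ P)} := by
  ext x
  constructor
  · rintro ⟨z, rfl, rfl⟩
    exact (mk_level z).symm
  · intro hx
    exact ⟨⟨(x, t), hx.symm⟩, rfl, rfl⟩

variable [TopologicalSpace M]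

theorem continuous_base : Continuous (base : LevelCover Φ → M) :=
  continuous_fst.comp continuous_subtype_val

theorem continuous_level : Continuous (level : LevelCover Φ → ℝ) :=
  continuous_snd.comp continuous_subtype_val

theorem continuous_translate (p : P) : Continuous (translate p : LevelCover Φ → LevelCover Φ) :=
  Continuous.subtype_mk (continuous_base.prodMk (continuous_level.add continuous_const)) _

/-- The deck transformations preserving the component of `c`, as a group of real numbers. -/
def componentStabilizer (c : LevelCover Φ) : AddSubgroup ℝ where
  carrier := {r | ∃ h : r ∈ P, ∀ z ∈ connectedComponent c, translate ⟨r, h⟩ z ∈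
    connectedComponent c}
  zero_mem' := ⟨P.zero_mem, fun z hz => by
    convert hz
    exact ext' rfl (by simp [level_translate])⟩
  add_mem' := by
    rintro r s ⟨hr, hr'⟩ ⟨hs, hs'⟩
    refine ⟨P.add_mem hr hs, fun z hz => ?_⟩
    convert hs' _ (hr' z hz) using 1
    exact ext' rfl (by simp [level_translate, add_assoc])
  neg_mem' := by
    rintro r ⟨hr, hr'⟩
    refine ⟨P.neg_mem hr, fun z hz => ?_⟩
    have h1 : translate ⟨-r, P.neg_mem hr⟩ (translate ⟨r, hr⟩ z) = z :=
      ext' rfl (by simp [level_translate])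
    have h2 := (continuous_translate (Φ := Φ) ⟨-r, P.neg_mem hr⟩).image_connectedComponent_subset
      (translate ⟨r, hr⟩ z)
    rw [h1, ← connectedComponent_eq hz, connectedComponent_eq (hr' z hz)] at h2
    rw [connectedComponent_eq hz]
    rw [← connectedComponent_eq (hr' z hz), connectedComponent_eq hz] at h2
    exact h2 ⟨z, mem_connectedComponent, rfl⟩

theorem level_sub_level_mem_componentStabilizer {c z w : LevelCover Φ}
    (hz : z ∈ connectedComponent c) (hw : w ∈ connectedComponent c) (h : z.base = w.base) :
    w.level - z.level ∈ componentStabilizer c := by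
  refine ⟨level_sub_level_mem h.symm, fun u hu => ?_⟩
  have h1 : translate ⟨w.level - z.level, level_sub_level_mem h.symm⟩ z = w :=
    ext' h (by simp [level_translate])
  have h2 := (continuous_translate (Φ := Φ)
    ⟨w.level - z.level, level_sub_level_mem h.symm⟩).image_connectedComponent_subset z
  rw [h1, ← connectedComponent_eq hz, ← connectedComponent_eq hw] at h2
  exact h2 ⟨u, hu, rfl⟩

/-- The levels of a connected covering form an interval invariant under a nonzero translation. -/
theorem level_surjective [PreconnectedSpace (LevelCover Φ)] [Nonempty M] (hP : P ≠ ⊥) :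
    Function.Surjective (level : LevelCover Φ → ℝ) := by
  obtain ⟨x⟩ := ‹Nonempty M›
  obtain ⟨c, -⟩ := base_surjective (Φ := Φ) x
  obtain ⟨p, hpP, hp⟩ : ∃ p ∈ P, 0 < p := by
    obtain ⟨q, hq, hq0⟩ := P.bot_or_exists_ne_zero.resolve_left hP
    rcases lt_or_gt_of_ne hq0 with h | h
    · exact ⟨-q, P.neg_mem hq, neg_pos.2 h⟩
    · exact ⟨q, hq, h⟩
  have hmem : ∀ n : ℤ, c.level + n * p ∈ range (level : LevelCover Φ → ℝ) := fun n =>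
    ⟨translate ⟨n * p, by simpa using P.zsmul_mem hpP n⟩ c, rfl⟩
  rw [← range_eq_univ]
  refine (isPreconnected_range continuous_level).eq_univ_of_unbounded ?_ ?_
  · rintro ⟨b, hb⟩
    obtain ⟨n, hn⟩ := exists_nat_gt ((c.level - b) / p)
    have := hb (hmem (-n))
    rw [div_lt_iff₀ hp] at hn
    push_cast at this
    linarith
  · rintro ⟨b, hb⟩
    obtain ⟨n, hn⟩ := exists_nat_gt ((b - c.level) / p)
    have := hb (hmem n)
    rw [div_lt_iff₀ hp] at hn
    push_cast at this
    linarith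

/-- Over the domain of a local lift `f`, each sheet of the covering is the graph of a translate of
`f`; discreteness of `P` makes the sheet open. -/
theorem exists_chart [DiscreteTopology P] (c : LevelCover Φ) {U : Set M} {f : M → ℝ}
    (hU : IsOpen U) (hf : ContinuousOn f U)
    (hfΦ : ∀ z ∈ U, (QuotientAddGroup.mk (f z) : ℝ ⧸ P) = Φ z) (hc : c.base ∈ U) :
    ∃ e : OpenPartialHomeomorph (LevelCover Φ) M, c ∈ e.source ∧ (e : LevelCover Φ → M) = base ∧
      e.target = U ∧ ∀ x ∈ U, (e.symm x).level = f x + (c.level - f c.base) := by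
  classical
  obtain ⟨ε, hε, hP⟩ := exists_pos_forall_abs_lt_eq_zero P
  set d := c.level - f c.base with hd
  have hdP : (QuotientAddGroup.mk d : ℝ ⧸ P) = 0 := by
    rw [hd, QuotientAddGroup.mk_sub, mk_level, hfΦ _ hc, sub_self]
  have hmem : ∀ x ∈ U, (QuotientAddGroup.mk (f x + d) : ℝ ⧸ P) = Φ x := fun x hx => by
    rw [QuotientAddGroup.mk_add, hdP, add_zero, hfΦ x hx]
  set inv : M → LevelCover Φ := fun x => if h : x ∈ U then ⟨(x, f x + d), hmem x h⟩ else c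
    with hinv
  have hinvU : ∀ x ∈ U, (inv x).1 = (x, f x + d) := fun x hx => by
    rw [hinv]
    dsimp only
    rw [dif_pos hx]
  have hlev : ContinuousOn (fun z : LevelCover Φ => z.level - (f z.base + d)) (base ⁻¹' U) :=
    continuous_level.continuousOn.sub
      ((hf.comp continuous_base.continuousOn fun _ hz => hz).add continuousOn_const)
  refine ⟨{ toFun := base
            invFun := inv
            source := base ⁻¹' U ∩ (fun z => z.level - (f z.base + d)) ⁻¹' Metric.ball 0 ε
            target := U
            map_source' := fun z hz => hz.1
            map_target' := fun x hx => ?_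
            left_inv' := fun z hz => ?_
            right_inv' := fun x hx => ?_
            open_source := hlev.isOpen_inter_preimage (hU.preimage continuous_base)
              Metric.isOpen_ball
            open_target := hU
            continuousOn_toFun := continuous_base.continuousOn
            continuousOn_invFun := ?_ }, ?_, rfl, rfl, fun x hx => ?_⟩
  · have h1 : (inv x).base = x := congrArg Prod.fst (hinvU x hx)
    have h2 : (inv x).level = f x + d := congrArg Prod.snd (hinvU x hx)
    simpa [h1, h2, hx] using hε
  · refine Subtype.ext ?_
    rw [hinvU _ hz.1]
    refine Prod.ext rfl ?_
    have h1 : z.level - (f z.base + d) ∈ P := by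
      rw [← QuotientAddGroup.eq_zero_iff, QuotientAddGroup.mk_sub, mk_level, hmem _ hz.1, sub_self]
    have h2 := hP _ h1 (by simpa using hz.2)
    exact (sub_eq_zero.1 h2).symm
  · exact congrArg Prod.fst (hinvU x hx)
  · have hind : IsInducing (Subtype.val : LevelCover Φ → M × ℝ) := ⟨rfl⟩
    rw [hind.continuousOn_iff]
    exact (continuousOn_id.prodMk (hf.add continuousOn_const)).congr hinvU
  · refine ⟨hc, ?_⟩
    simpa [hd] using hε
  · exact congrArg Prod.snd (hinvU x hx)

section LocalLifts

variable [DiscreteTopology P]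

theorem isClosedEmbedding_val (h : HasLocalLifts Φ) :
    IsClosedEmbedding (Subtype.val : LevelCover Φ → M × ℝ) := by
  have : IsClosed (P : Set ℝ) := AddSubgroup.isClosed_of_discrete
  have : T3Space (ℝ ⧸ P) := QuotientAddGroup.instT3Space P
  have hmk : Continuous (QuotientAddGroup.mk : ℝ → ℝ ⧸ P) := continuous_quot_mk
  refine IsClosed.isClosedEmbedding_subtypeVal ?_
  exact isClosed_eq (hmk.comp continuous_snd) (h.continuous.comp continuous_fst)

theorem isCompact_preimage_level [CompactSpace M] (h : HasLocalLifts Φ) (a b : ℝ) :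
    IsCompact ((level : LevelCover Φ → ℝ) ⁻¹' Icc a b) := by
  have := (isClosedEmbedding_val h).isCompact_preimage
    ((isCompact_univ (X := M)).prod (isCompact_Icc (a := a) (b := b)))
  convert this using 1
  ext z
  simp [level]

theorem exists_chart_base (h : HasLocalLifts Φ) (c : LevelCover Φ) :
    ∃ e : OpenPartialHomeomorph (LevelCover Φ) M, c ∈ e.source ∧ (e : LevelCover Φ → M) = base := by
  obtain ⟨U, f, hxU, hU, hf, hfΦ⟩ := h c.base
  obtain ⟨e, he, heb, -⟩ := exists_chart c hU hf hfΦ hxU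
  exact ⟨e, he, heb⟩

theorem isOpenMap_base (h : HasLocalLifts Φ) : IsOpenMap (base : LevelCover Φ → M) := by
  rw [isOpenMap_iff_nhds_le]
  intro c
  obtain ⟨e, he, heb⟩ := exists_chart_base h c
  rw [← heb, e.map_nhds_eq he]

theorem locallyConnectedSpace [LocallyConnectedSpace M] (h : HasLocalLifts Φ) :
    LocallyConnectedSpace (LevelCover Φ) := by
  choose e he _ using exists_chart_base h
  let _ : ChartedSpace M (LevelCover Φ) :=
    { atlas := range e
      chartAt := e
      mem_chart_source := he
      chart_mem_atlas := mem_range_self }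
  exact ChartedSpace.locallyConnectedSpace M (LevelCover Φ)

theorem tameAt_level (c : LevelCover Φ) {U : Set M} {f : M → ℝ} (hU : IsOpen U)
    (hf : ContinuousOn f U) (hfΦ : ∀ z ∈ U, (QuotientAddGroup.mk (f z) : ℝ ⧸ P) = Φ z)
    (hc : c.base ∈ U) (hT : TameAt f c.base) : TameAt (level : LevelCover Φ → ℝ) c := by
  obtain ⟨e, he, heb, het, hes⟩ := exists_chart c hU hf hfΦ hc
  have h1 := TameAt.of_comp e.symm (g := level) (x := e c) (e.map_source he) ?_
  · rwa [e.left_inv he] at h1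
  rw [heb]
  refine (hT.add_const (c.level - f c.base)).congr ?_
  filter_upwards [hU.mem_nhds hc] with x hx using (hes x hx).symm

/-- Every component of `LevelCover Φ` covers `M`. -/
theorem exists_mem_component [PreconnectedSpace M] [LocallyConnectedSpace M]
    (h : HasLocalLifts Φ) (c : LevelCover Φ) (x : M) : ∃ z ∈ connectedComponent c, z.base = x := by
  have := locallyConnectedSpace h
  have hopen : ∀ z : LevelCover Φ, IsOpen (base '' connectedComponent z) := fun z =>
    isOpenMap_base h _ isOpen_connectedComponent
  by_contra! hx
  have hsub : (base '' connectedComponent c)ᶜ =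
      ⋃ z ∈ {z : LevelCover Φ | z.base ∉ base '' connectedComponent c},
        base '' connectedComponent z := by
    ext y
    simp only [mem_iUnion, exists_prop, mem_ofPred_eq]
    constructor
    · intro hy
      obtain ⟨z, rfl⟩ := base_surjective (Φ := Φ) y
      exact ⟨z, hy, z, mem_connectedComponent, rfl⟩
    · rintro ⟨z, hz, w, hw, rfl⟩ ⟨w', hw', hww'⟩
      obtain ⟨p, rfl⟩ := exists_translate_eq hww'
      refine hz ?_
      -- moving `z` back by the deck transformation lands in the component of `c`
      have h1 : translate (-p) (translate p w') = w' :=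
        ext' rfl (by simp [level_translate])
      have h2 := (continuous_translate (Φ := Φ) (-p)).image_connectedComponent_subset
        (translate p w')
      rw [h1, ← connectedComponent_eq hw', ← connectedComponent_eq hw] at h2
      exact ⟨translate (-p) z, h2 ⟨z, mem_connectedComponent, rfl⟩, rfl⟩
  have hclopen : IsClopen (base '' connectedComponent c) := by
    refine ⟨⟨?_⟩, hopen c⟩
    rw [hsub]
    exact isOpen_biUnion fun z _ => hopen z
  have huniv := hclopen.eq_univ ⟨c.base, c, mem_connectedComponent, rfl⟩
  obtain ⟨z, hz, hzx⟩ := huniv.ge (mem_univ x)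
  exact hx z hz hzx

/-- If the deck transformations preserve a component, then the covering is connected. -/
theorem preconnectedSpace_of_le [PreconnectedSpace M] [LocallyConnectedSpace M]
    (h : HasLocalLifts Φ) (hP : ∀ c : LevelCover Φ, P ≤ componentStabilizer c) :
    PreconnectedSpace (LevelCover Φ) := by
  rw [preconnectedSpace_iff_connectedComponent]
  intro c
  rw [eq_univ_iff_forall]
  intro w
  obtain ⟨z, hz, hzw⟩ := exists_mem_component h c w.base
  obtain ⟨p, rfl⟩ := exists_translate_eq hzw
  obtain ⟨_, h2⟩ := hP c p.2
  exact h2 z hz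

end LocalLifts

end LevelCover

end Covering

/-! ### Path lifting and periods -/

section PathLifting

variable {E : Type*} [NormedAddCommGroup E] [NormedSpace ℝ E]
  {M : Type*} [TopologicalSpace M] [ChartedSpace E M] {P : AddSubgroup ℝ} {Φ : M → ℝ ⧸ P}
  {η : DiffForm E M 1} {U : Set M} {f : M → ℝ}

variable (Φ η) in
/-- The closed 1-form `η` is `-dΦ` for the smooth map `Φ : M → ℝ / P`. -/
structure IsPrimitive : Prop where
  smooth : ∀ x, ∃ U f, x ∈ U ∧ IsSmoothLift E Φ U f
  differential : ∀ U f, IsSmoothLift E Φ U f → ∀ x ∈ U, ∀ v : TangentSpace 𝓘(ℝ, E) x,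
    η x ![v] = -(mfderiv 𝓘(ℝ, E) 𝓘(ℝ, ℝ) f x v : ℝ)

theorem IsPrimitive.hasLocalLifts (h : IsPrimitive Φ η) : HasLocalLifts Φ := fun x => by
  obtain ⟨U, f, hx, hf⟩ := h.smooth x
  exact ⟨U, f, hx, hf.isOpen, hf.smooth.continuousOn, hf.lifts⟩

/-- The function whose integral over `[0, 1]` is the integral of `η` over `σ`. -/
noncomputable def SmoothSimplex.integrand (η : DiffForm E M 1) (σ : SmoothSimplex E M) (t : ℝ) :
    ℝ :=
  η (σ.toFun t) ![mfderivWithin 𝓘(ℝ, ℝ) 𝓘(ℝ, E) σ.toFun (Icc 0 1) t (1 : ℝ)]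

theorem IsSmoothLift.contDiffWithinAt_comp (hf : IsSmoothLift E Φ U f) (σ : SmoothSimplex E M)
    {t : ℝ} (ht : t ∈ Icc (0 : ℝ) 1) (htU : σ.toFun t ∈ U) :
    ContDiffWithinAt ℝ ∞ (f ∘ σ.toFun) (Icc 0 1) t := by
  rw [← contMDiffWithinAt_iff_contDiffWithinAt]
  exact (hf.smooth.contMDiffAt (hf.isOpen.mem_nhds htU)).comp_contMDiffWithinAt t (σ.smooth t ht)

theorem IsSmoothLift.hasDerivWithinAt_comp (hf : IsSmoothLift E Φ U f)
    (hd : ∀ x ∈ U, ∀ v : TangentSpace 𝓘(ℝ, E) x,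
      η x ![v] = -(mfderiv 𝓘(ℝ, E) 𝓘(ℝ, ℝ) f x v : ℝ)) (σ : SmoothSimplex E M)
    {t : ℝ} (ht : t ∈ Icc (0 : ℝ) 1) (htU : σ.toFun t ∈ U) :
    HasDerivWithinAt (f ∘ σ.toFun) (-σ.integrand η t) (Icc 0 1) t := by
  have h1 := ((hf.smooth.contMDiffAt (hf.isOpen.mem_nhds htU)).mdifferentiableAt
    (by simp)).hasMFDerivAt
  have h2 := ((σ.smooth t ht).mdifferentiableWithinAt (by simp)).hasMFDerivWithinAt
  let Df : E →L[ℝ] ℝ := mfderiv 𝓘(ℝ, E) 𝓘(ℝ, ℝ) f (σ.toFun t)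
  let Dσ : ℝ →L[ℝ] E := mfderivWithin 𝓘(ℝ, ℝ) 𝓘(ℝ, E) σ.toFun (Icc 0 1) t
  have h3 : HasMFDerivWithinAt 𝓘(ℝ, ℝ) 𝓘(ℝ, ℝ) (f ∘ σ.toFun) (Icc 0 1) t (Df.comp Dσ) :=
    h1.comp_hasMFDerivWithinAt t h2
  have h4 : HasFDerivWithinAt (f ∘ σ.toFun) (Df.comp Dσ) (Icc 0 1) t :=
    hasMFDerivWithinAt_iff_hasFDerivWithinAt.1 h3
  have h5 : -σ.integrand η t = Df (Dσ 1) := neg_eq_iff_eq_neg.2 (hd _ htU (Dσ 1))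
  rw [h5]
  exact h4.hasDerivWithinAt

theorem IsPrimitive.continuousOn_integrand (h : IsPrimitive Φ η) (σ : SmoothSimplex E M) :
    ContinuousOn (σ.integrand η) (Icc 0 1) := by
  intro t ht
  obtain ⟨U, f, htU, hf⟩ := h.smooth (σ.toFun t)
  have hu : UniqueDiffOn ℝ (Icc (0 : ℝ) 1) := uniqueDiffOn_Icc one_pos
  have h1 : ContinuousWithinAt (fun s => -(fderivWithin ℝ (f ∘ σ.toFun) (Icc 0 1) s 1))
      (Icc 0 1) t :=
    (((hf.contDiffWithinAt_comp σ ht htU).fderivWithin_right (m := 0) hu (by simp)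
      ht).continuousWithinAt.clm_apply continuousWithinAt_const).neg
  have hev : ∀ᶠ s in 𝓝[Icc 0 1] t, σ.toFun s ∈ U :=
    (σ.smooth t ht).continuousWithinAt.eventually (hf.isOpen.mem_nhds htU)
  have heq : ∀ s ∈ Icc (0 : ℝ) 1, σ.toFun s ∈ U →
      σ.integrand η s = -(fderivWithin ℝ (f ∘ σ.toFun) (Icc 0 1) s 1) := by
    intro s hs hsU
    have := (hf.hasDerivWithinAt_comp (h.differential U f hf) σ hs hsU).derivWithin (hu s hs)
    rw [fderivWithin_derivWithin, this, neg_neg]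
  refine h1.congr_of_eventuallyEq ?_ (heq t ht htU)
  filter_upwards [hev, self_mem_nhdsWithin] with s hsU hs using heq s hs hsU

theorem IsPrimitive.hasDerivWithinAt_integral (h : IsPrimitive Φ η) (σ : SmoothSimplex E M)
    {t : ℝ} (ht : t ∈ Icc (0 : ℝ) 1) :
    HasDerivWithinAt (fun t => ∫ s in (0 : ℝ)..t, σ.integrand η s) (σ.integrand η t)
      (Icc 0 1) t := by
  have hc := h.continuousOn_integrand σ
  have : Fact (t ∈ Icc (0 : ℝ) 1) := ⟨ht⟩
  refine intervalIntegral.integral_hasDerivWithinAt_right (t := Icc 0 1) ?_ ?_ (hc t ht)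
  · refine (hc.mono ?_).intervalIntegrable
    rw [uIcc_of_le ht.1]
    exact Icc_subset_Icc_right ht.2
  · exact hc.stronglyMeasurableAtFilter_nhdsWithin measurableSet_Icc t

/-- The integral of `-η` lifts `Φ` along smooth paths. -/
theorem IsPrimitive.mk_sub_integral_eq (h : IsPrimitive Φ η) (σ : SmoothSimplex E M) {a : ℝ}
    (ha : (QuotientAddGroup.mk a : ℝ ⧸ P) = Φ (σ.toFun 0)) {t : ℝ} (ht : t ∈ Icc (0 : ℝ) 1) :
    (QuotientAddGroup.mk (a - ∫ s in (0 : ℝ)..t, σ.integrand η s) : ℝ ⧸ P) = Φ (σ.toFun t) := by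
  let ψ : Icc (0 : ℝ) 1 → ℝ ⧸ P := fun t =>
    QuotientAddGroup.mk (a - ∫ s in (0 : ℝ)..t, σ.integrand η s) - Φ (σ.toFun t)
  have hψ : IsLocallyConstant ψ := by
    rw [IsLocallyConstant.iff_eventually_eq]
    rintro ⟨t, ht⟩
    obtain ⟨U, f, htU, hf⟩ := h.smooth (σ.toFun t)
    have hev : ∀ᶠ s in 𝓝[Icc 0 1] t, σ.toFun s ∈ U :=
      (σ.smooth t ht).continuousWithinAt.eventually (hf.isOpen.mem_nhds htU)
    obtain ⟨δ, hδ, hball⟩ := Metric.mem_nhdsWithin_iff.1 hev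
    have hd : ∀ s ∈ Metric.ball t δ ∩ Icc 0 1,
        HasDerivWithinAt (fun s => a - (∫ r in (0 : ℝ)..s, σ.integrand η r) - f (σ.toFun s)) 0
          (Metric.ball t δ ∩ Icc 0 1) s := by
      intro s hs
      have h1 := ((h.hasDerivWithinAt_integral σ hs.2).const_sub a).sub
        (hf.hasDerivWithinAt_comp (h.differential U f hf) σ hs.2 (hball hs))
      rw [sub_self] at h1
      exact h1.mono inter_subset_right
    have hconv : Convex ℝ (Metric.ball t δ ∩ Icc 0 1) := (convex_ball t δ).inter (convex_Icc 0 1)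
    rw [nhds_subtype_eq_comap]
    refine eventually_comap.2 ?_
    filter_upwards [Metric.ball_mem_nhds t hδ]
    rintro _ hs ⟨s, hs'⟩ rfl
    have hmem : ∀ r, r ∈ Metric.ball t δ ∩ Icc 0 1 →
        (QuotientAddGroup.mk (a - ∫ s in (0 : ℝ)..r, σ.integrand η s) : ℝ ⧸ P) - Φ (σ.toFun r) =
          QuotientAddGroup.mk (a - (∫ s in (0 : ℝ)..r, σ.integrand η s) - f (σ.toFun r)) := by
      intro r hr
      rw [QuotientAddGroup.mk_sub _ (a - _), hf.lifts _ (hball hr)]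
    have h1 : s ∈ Metric.ball t δ ∩ Icc 0 1 := ⟨hs, hs'⟩
    have h2 : t ∈ Metric.ball t δ ∩ Icc 0 1 := ⟨Metric.mem_ball_self hδ, ht⟩
    change _ - _ = _ - _
    rw [hmem s h1, hmem t h2]
    congr 1
    refine hconv.is_const_of_fderivWithin_eq_zero (𝕜 := ℝ)
      (f := fun s => a - (∫ r in (0 : ℝ)..s, σ.integrand η r) - f (σ.toFun s))
      (fun r hr => (hd r hr).differentiableWithinAt) (fun r hr => ?_) h1 h2
    by_cases hu : UniqueDiffWithinAt ℝ (Metric.ball t δ ∩ Icc 0 1) r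
    · rw [(hd r hr).hasFDerivWithinAt.fderivWithin hu]
      ext
      simp
    · exact fderivWithin_zero_of_not_uniqueDiffWithinAt hu
  have h0 : ψ ⟨0, left_mem_Icc.2 zero_le_one⟩ = 0 := by
    simp [ψ, ha]
  have h1 := hψ.apply_eq_of_preconnectedSpace ⟨t, ht⟩ ⟨0, left_mem_Icc.2 zero_le_one⟩
  rw [h0] at h1
  exact sub_eq_zero.1 h1

/-- The endpoint of the lift of a path starting at `z` and the point `w` over its end lie in the
same component, so their difference in level preserves it. -/
theorem IsPrimitive.integral_add_level_mem_componentStabilizer (h : IsPrimitive Φ η)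
    (c : LevelCover Φ) (σ : SmoothSimplex E M)
    {z w : LevelCover Φ} (hz : z ∈ connectedComponent c) (hw : w ∈ connectedComponent c)
    (hz0 : z.base = σ.toFun 0) (hw1 : w.base = σ.toFun 1) :
    σ.integral η + (w.level - z.level) ∈ LevelCover.componentStabilizer c := by
  have ha : (QuotientAddGroup.mk z.level : ℝ ⧸ P) = Φ (σ.toFun 0) := by
    rw [z.mk_level, hz0]
  let γ : Icc (0 : ℝ) 1 → LevelCover Φ := fun t =>
    ⟨(σ.toFun t, z.level - ∫ s in (0 : ℝ)..t, σ.integrand η s),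
      h.mk_sub_integral_eq σ ha t.2⟩
  have hγ : Continuous γ := by
    have hI : ContinuousOn (fun t => ∫ s in (0 : ℝ)..t, σ.integrand η s) (Icc 0 1) := fun t ht =>
      (h.hasDerivWithinAt_integral σ ht).continuousWithinAt
    refine Continuous.subtype_mk (Continuous.prodMk ?_ (continuous_const.sub ?_)) _
    · exact continuousOn_iff_continuous_domRestrict.1 σ.smooth.continuousOn
    · exact continuousOn_iff_continuous_domRestrict.1 hI
  have hγ0 : γ ⟨0, left_mem_Icc.2 zero_le_one⟩ = z :=
    LevelCover.ext' hz0.symm (by simp [γ, LevelCover.level])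
  have hγ1 : γ ⟨1, right_mem_Icc.2 zero_le_one⟩ ∈ connectedComponent c := by
    rw [connectedComponent_eq hz]
    refine (isPreconnected_range hγ).subset_connectedComponent ⟨_, hγ0⟩ ⟨_, rfl⟩
  have := LevelCover.level_sub_level_mem_componentStabilizer hγ1 hw hw1.symm
  convert this using 1
  change σ.integral η + (w.level - z.level) = w.level - (z.level - σ.integral η)
  ring

/-- The deck transformation by a period preserves the components: integrating over the simplices of
a chain and closing up the resulting paths in the component of `c` moves each boundary point by its
level in the component, and these contributions cancel for a cycle. -/
theorem IsPrimitive.periodGroup_le_componentStabilizer (h : IsPrimitive Φ η) (c : LevelCover Φ)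
    (hc : ∀ x, ∃ z ∈ connectedComponent c, z.base = x) :
    periodGroup η ≤ LevelCover.componentStabilizer c := by
  choose z hz hzx using hc
  let ev : (M →₀ ℤ) →+ ℝ := Finsupp.liftAddHom fun x =>
    (AddMonoidHom.mulRight (z x).level).comp (Int.castAddHom ℝ)
  have hev : ∀ x n, ev (Finsupp.single x n) = n * (z x).level := fun x n => by simp [ev]
  have hb : ∀ σ n, boundary E M (Finsupp.single σ n) =
      Finsupp.single (σ.toFun 1) n - Finsupp.single (σ.toFun 0) n := fun σ n => by simp [boundary]
  have hi : ∀ σ n, chainIntegral η (Finsupp.single σ n) = n * σ.integral η := fun σ n => by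
    simp [chainIntegral]
  have key : ∀ a : SmoothSimplex E M →₀ ℤ,
      chainIntegral η a + ev (boundary E M a) ∈ LevelCover.componentStabilizer c := by
    intro a
    induction a using Finsupp.induction_linear with
    | zero => simp
    | add a b iha ihb =>
      rw [map_add, map_add, map_add, add_add_add_comm]
      exact add_mem iha ihb
    | single σ n =>
      have h1 := zsmul_mem (h.integral_add_level_mem_componentStabilizer c σ
        (hz (σ.toFun 0)) (hz (σ.toFun 1)) (hzx _) (hzx _)) n
      convert h1 using 1
      rw [hb, map_sub, hev, hev, hi, zsmul_eq_mul]
      ring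
  rintro _ ⟨a, ha, rfl⟩
  have hmem := key a
  rw [AddMonoidHom.mem_ker.1 ha, map_zero, add_zero] at hmem
  exact hmem

end PathLifting

section Hamiltonian

variable {E : Type*} [NormedAddCommGroup E] [NormedSpace ℝ E]
  {M : Type*} [TopologicalSpace M] [ChartedSpace E M] {Ω : DiffForm E M 2}

theorem contract_apply (X : ∀ x : M, TangentSpace 𝓘(ℝ, E) x) (x : M)
    (v : TangentSpace 𝓘(ℝ, E) x) : Ω.contract X x ![v] = Ω x ![X x, v] := rfl

variable [MulAction Circle M] [ContMDiffSMul (𝓡 1) 𝓘(ℝ, E) ∞ Circle M]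

theorem mdifferentiable_exp_smul (x : M) :
    MDifferentiable 𝓘(ℝ, ℝ) 𝓘(ℝ, E) fun t : ℝ => Circle.exp t • x :=
  (ContMDiff.smul (I := 𝓡 1) (n := ∞) contMDiff_circleExp contMDiff_const).mdifferentiable
    (by simp)

/-- A Hamiltonian of the generator is invariant under the circle. -/
theorem smul_invariant_of_contract_eq {H : M → ℝ} (hH : ContMDiff 𝓘(ℝ, E) 𝓘(ℝ, ℝ) ∞ H)
    (hd : ∀ (x : M) (v : TangentSpace 𝓘(ℝ, E) x),
      Ω.contract (generator E M) x ![v] = -(mfderiv 𝓘(ℝ, E) 𝓘(ℝ, ℝ) H x v : ℝ))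
    (g : Circle) (x : M) : H (g • x) = H x := by
  have h0 : ∀ z : M, HasDerivAt (fun s : ℝ => H (Circle.exp s • z)) 0 0 := by
    intro z
    have h1 : HasMFDerivAt 𝓘(ℝ, E) 𝓘(ℝ, ℝ) H (Circle.exp 0 • z)
        (mfderiv 𝓘(ℝ, E) 𝓘(ℝ, ℝ) H (Circle.exp 0 • z)) :=
      (hH.mdifferentiable (by simp) _).hasMFDerivAt
    let DH : E →L[ℝ] ℝ := mfderiv 𝓘(ℝ, E) 𝓘(ℝ, ℝ) H (Circle.exp 0 • z)
    let Dc : ℝ →L[ℝ] E := mfderiv 𝓘(ℝ, ℝ) 𝓘(ℝ, E) (fun t : ℝ => Circle.exp t • z) 0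
    have h2 : HasMFDerivAt 𝓘(ℝ, ℝ) 𝓘(ℝ, ℝ) (H ∘ fun t : ℝ => Circle.exp t • z) 0 (DH.comp Dc) :=
      h1.comp (0 : ℝ) (mdifferentiable_exp_smul (E := E) z 0).hasMFDerivAt
    have h3 : HasFDerivAt (H ∘ fun t : ℝ => Circle.exp t • z) (DH.comp Dc) 0 :=
      hasMFDerivAt_iff_hasFDerivAt.1 h2
    have h4 : DH (Dc 1) = 0 := by
      have hz : Circle.exp 0 • z = z := by rw [Circle.exp_zero, one_smul]
      have h5 : ∀ z', z' = z → (mfderiv 𝓘(ℝ, E) 𝓘(ℝ, ℝ) H z' : E →L[ℝ] ℝ) =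
          (mfderiv 𝓘(ℝ, E) 𝓘(ℝ, ℝ) H z : E →L[ℝ] ℝ) := by
        rintro _ rfl
        rfl
      rw [show DH = _ from h5 _ hz]
      have h6 := hd z (generator E M z)
      rw [contract_apply, (Ω z).map_eq_zero_of_eq _ (i := 0) (j := 1) rfl (by decide)] at h6
      exact neg_eq_zero.1 h6.symm
    have h7 := h3.hasDerivAt
    rwa [show (DH.comp Dc) 1 = 0 from h4] at h7
  have h1 : ∀ t : ℝ, HasDerivAt (fun s : ℝ => H (Circle.exp s • x)) 0 t := by
    intro t
    have h2 : HasDerivAt (fun s : ℝ => H (Circle.exp (s + t) • x)) 0 0 := by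
      simpa only [Circle.exp_add, mul_smul] using h0 (Circle.exp t • x)
    have h3 : HasDerivAt (fun s : ℝ => H (Circle.exp (s + t) • x)) 0 (t - t) := by
      rwa [sub_self]
    have h4 := h3.comp_sub_const t t
    simpa only [sub_add_cancel] using h4
  obtain ⟨θ, rfl⟩ := Circle.exp_surjective g
  have := is_const_of_deriv_eq_zero (fun t => (h1 t).differentiableAt) (fun t => (h1 t).deriv) θ 0
  simpa using this

/-- A circle-valued Hamiltonian without periods is a Hamiltonian. -/
theorem IsCircleValuedHamiltonian.isHamiltonianAction {P : AddSubgroup ℝ} {Φ : M → ℝ ⧸ P}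
    (hΦ : IsCircleValuedHamiltonian Ω Φ) (hP : P = ⊥) : IsHamiltonianAction Ω := by
  choose H hH using fun x => QuotientAddGroup.mk_surjective (Φ x)
  have hinj : ∀ a b : ℝ, (QuotientAddGroup.mk a : ℝ ⧸ P) = QuotientAddGroup.mk b → a = b := by
    intro a b hab
    rw [QuotientAddGroup.eq, hP, AddSubgroup.mem_bot] at hab
    linarith
  have hsm : ContMDiff 𝓘(ℝ, E) 𝓘(ℝ, ℝ) ∞ H := by
    intro x
    obtain ⟨U, f, hx, hf⟩ := hΦ.smooth x
    have hU := hf.isOpen.mem_nhds hx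
    refine (hf.smooth.contMDiffAt hU).congr_of_eventuallyEq ?_
    filter_upwards [hU] with z hz
    exact hinj _ _ ((hH z).trans (hf.lifts z hz).symm)
  have hd := hΦ.differential univ H ⟨isOpen_univ, hsm.contMDiffOn, fun x _ => hH x⟩
  exact ⟨H, hsm, smul_invariant_of_contract_eq hsm fun x => hd x (mem_univ x),
    fun x => hd x (mem_univ x)⟩

end Hamiltonian

end CircleAction

open CircleAction in
theorem lemma2p1
    {E : Type*} [NormedAddCommGroup E] [NormedSpace ℝ E] [FiniteDimensional ℝ E]
    {M : Type*} [TopologicalSpace M] [ChartedSpace E M] [IsManifold 𝓘(ℝ, E) ∞ M]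
    [T2Space M] [CompactSpace M] [ConnectedSpace M]
    [MulAction Circle M] [ContMDiffSMul (𝓡 1) 𝓘(ℝ, E) ∞ Circle M]
    (Ω : CircleAction.DiffForm E M 2)
    (hΩ : CircleAction.IsSymplecticForm Ω)
    (hsymp : CircleAction.IsSymplecticAction Ω)
    (hnonham : ¬ CircleAction.IsHamiltonianAction Ω)
    (P : AddSubgroup ℝ)
    (hP : P = CircleAction.periodGroup (Ω.contract (CircleAction.generator E M)))
    (hdiscrete : DiscreteTopology P)
    (Φ : M → ℝ ⧸ P)
    (hΦ : CircleAction.IsCircleValuedHamiltonian Ω Φ)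
    (y : ℝ ⧸ P) :
    IsConnected (Φ ⁻¹' {y}) := by
  have hprim : IsPrimitive Φ (Ω.contract (generator E M)) := ⟨hΦ.smooth, hΦ.differential⟩
  have hlift := hprim.hasLocalLifts
  have : LocallyConnectedSpace M := ChartedSpace.locallyConnectedSpace E M
  have : LocallyConnectedSpace (LevelCover Φ) := LevelCover.locallyConnectedSpace hlift
  have : PreconnectedSpace (LevelCover Φ) := by
    refine LevelCover.preconnectedSpace_of_le hlift fun c => ?_
    exact hP.le.trans (hprim.periodGroup_le_componentStabilizer c
      (LevelCover.exists_mem_component hlift c))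
  have htame : ∀ c : LevelCover Φ, TameAt LevelCover.level c := by
    intro c
    obtain ⟨U, f, hc, hf⟩ := hΦ.smooth c.base
    exact LevelCover.tameAt_level c hf.isOpen hf.smooth.continuousOn hf.lifts hc
      (tameAt_of_contract_eq hΩ hsymp hf.isOpen hf.smooth (hΦ.differential U f hf) hc)
  obtain ⟨t, rfl⟩ := QuotientAddGroup.mk_surjective y
  rw [← LevelCover.image_preimage_level]
  have hsurj : Function.Surjective (LevelCover.level : LevelCover Φ → ℝ) :=
    LevelCover.level_surjective fun hbot => hnonham (hΦ.isHamiltonianAction hbot)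
  obtain ⟨c, hc⟩ := hsurj t
  refine IsConnected.image ⟨⟨c, hc⟩, ?_⟩ _ LevelCover.continuous_base.continuousOn
  exact isPreconnected_fibre LevelCover.continuous_level
    (LevelCover.isCompact_preimage_level hlift) htame t
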